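/- Let $(G,\phi)$ be a finite magnetic group, that is, a finite group $G$ with a surjective homomorphism $\phi:G\to\mathbb Z/2$. All algebras are finite-dimensional, associative and unital, and graded means $\mathbb Z/2$-graded. A graded complex algebra $A\ne 0$ is central simple if its only two-sided graded ideals are $0$ and $A$, and the homogeneous elements that commute in the graded sense with all homogeneous elements span $\mathbb C\cdot 1$. A magnetic $(G,\phi)$-equivariant graded algebra is a graded complex algebra on which $G$ acts by degree-preserving ring automorphisms, $g$ acting $\mathbb C$-linearly if $\phi(g)=0$ and $\mathbb C$-antilinearly if $\phi(g)=1$; a magnetic representation of $(G,\phi)$ is a finite-dimensional complex vector space on which $G$ acts by additive maps with the same rule. For magnetic representations $V_0,V_1$, $G$ acts on the graded algebra $\mathrm{End}(V_0,V_1)$ of endomorphisms of $V_0\oplus V_1$ by conjugation. Two magnetic equivariant central simple graded algebras $A,B$ are similar if $A\hat\otimes\mathrm{End}(V_0,V_1)\cong B\hat\otimes\mathrm{End}(W_0,W_1)$, $G$-equivariantly and as graded complex algebras, for some magnetic representations with $V_0\oplus V_1\neq0$ and $W_0\oplus W_1\ne0$. The set of similarity classes is $\mathrm{GrBr}_{(G,\phi)}(\mathbb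 C)$; omitting $G$ throughout one gets $\mathrm{GrBr}(\mathbb C)$. Let $\mathbb C^*_\phi$ be $\mathbb C^*$ on which $g$ acts by the $\phi(g)$-th power of complex conjugation. Similarity is an equivalence relation, the graded tensor product $\hat\otimes$ makes $\mathrm{GrBr}_{(G,\phi)}(\mathbb C)$ and $\mathrm{GrBr}(\mathbb C)$ abelian groups, and $\mathrm{GrBr}(\mathbb C)\cong\mathbb Z/2$. Moreover: 1. Forgetting the $G$-action defines a surjective homomorphism $\mathrm{GrBr}_{(G,\phi)}(\mathbb C)\to\mathrm{GrBr}(\mathbb C)$. With $\mathrm{GrBr}_{(G,\phi)}(\mathbb C)'$ denoting its kernel, the short exact sequence $$0\to \mathrm{GrBr}_{(G,\phi)}(\mathbb C)'\to \mathrm{GrBr}_{(G,\phi)}(\mathbb C)\to \mathrm{GrBr}(\mathbb C)\cong\mathbb Z/2\to 0$$ does not split. 2. There is a short exact sequence of abelian groups $$0\to H^2(G,\mathbb C^*_\phi)\to \mathrm{GrBr}_{(G,\phi)}(\mathbb C)'\to \mathrm{Hom}(G,\mathbb Z/2)\to 0 .$$ Its second map sends $[A]$ to a homomorphism $\psi$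 such that, for some isomorphism of graded algebras $A\cong\mathrm{End}(V_0,V_1)$, every $g\in G$ acts on $A$ as conjugation by a bijection of $V_0\oplus V_1$ that is homogeneous of degree $\psi(g)$ and linear or antilinear according to $\phi(g)$. Its first map sends the class of a $2$-cocycle $f$ to $[\mathrm{End}(V)]$, where $V$ is a nonzero finite-dimensional complex vector space placed in degree $0$, with bijections $T_g:V\to V$ ($g\in G$), linear or antilinear according to $\phi(g)$, such that $T_gT_h=f(g,h)T_{gh}$, and $g$ acts on $\mathrm{End}(V)$ as conjugation by $T_g$; such $V$ and $T_g$ exist for every $f$, and the class does not depend on their choice. 3. If $(G,\phi)\cong(\mathbb Z/2,\mathrm{id})$, then $\mathrm{GrBr}_{(G,\phi)}(\mathbb C)\cong\mathbb Z/8$ and $\mathrm{GrBr}_{(G,\phi)}(\mathbb C)'\cong\mathbb Z/4$, and the sequence in 2 does not split; so that sequence does not split in general. -/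

import Mathlib

open scoped TensorProduct

noncomputable section

namespace MagBrauer

/-! ### Complex conjugation, twisted coefficients -/

/-- `conjPow d` is the `d`-th power of complex conjugation, for `d ∈ ℤ/2`
(written multiplicatively). -/
def conjPow (d : Multiplicative (ZMod 2)) : ℂ →+* ℂ :=
  if d = 1 then RingHom.id ℂ else starRingEnd ℂ

theorem conjPow_one (c : ℂ) : conjPow 1 c = c := by simp [conjPow]

theorem conjPow_mul (d e : Multiplicative (ZMod 2)) (c : ℂ) :
    conjPow (d * e) c = conjPow d (conjPow e c) := by
  have h : ∀ x : Multiplicative (ZMod 2), x = 1 ∨ x = Multiplicative.ofAdd 1 := by decide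
  have h1 : (Multiplicative.ofAdd (1 : ZMod 2)) ≠ 1 := by decide
  have h2 : (Multiplicative.ofAdd (1 : ZMod 2)) * Multiplicative.ofAdd 1 = 1 := by decide
  rcases h d with rfl | rfl <;> rcases h e with rfl | rfl <;> simp [conjPow, h1, h2]

variable {G : Type} [Group G]

/-- The group `ℂ^*_φ`: the units of `ℂ`, on which `g : G` acts by the `φ g`-th power of
complex conjugation. -/
def TwistedUnits (_φ : G →* Multiplicative (ZMod 2)) : Type := ℂˣ

instance (φ : G →* Multiplicative (ZMod 2)) : CommGroup (TwistedUnits φ) :=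
  inferInstanceAs (CommGroup ℂˣ)

/-- The underlying complex number of an element of `ℂ^*_φ`. -/
def TwistedUnits.val {φ : G →* Multiplicative (ZMod 2)} (u : TwistedUnits φ) : ℂ :=
  Units.val (α := ℂ) u

instance (φ : G →* Multiplicative (ZMod 2)) : MulDistribMulAction G (TwistedUnits φ) where
  smul g u := Units.map (conjPow (φ g) : ℂ →* ℂ) u
  one_smul u := Units.ext (by
    change conjPow (φ 1) (Units.val (α := ℂ) u) = Units.val (α := ℂ) u
    rw [map_one, conjPow_one])
  mul_smul g h u := Units.ext (by
    change conjPow (φ (g * h)) (Units.val (α := ℂ) u) =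
      conjPow (φ g) (conjPow (φ h) (Units.val (α := ℂ) u))
    rw [map_mul, conjPow_mul])
  smul_mul g u v := map_mul (Units.map (conjPow (φ g) : ℂ →* ℂ)) u v
  smul_one g := map_one (Units.map (conjPow (φ g) : ℂ →* ℂ))

/-- The `G`-module `ℂ^*_φ`, written additively as required by group cohomology. -/
abbrev unitsRep (φ : G →* Multiplicative (ZMod 2)) : Rep ℤ G :=
  Rep.ofMulDistribMulAction G (TwistedUnits φ)

/-- The second cohomology group `H²(G, ℂ^*_φ)`. -/
abbrev H2 (φ : G →* Multiplicative (ZMod 2)) : Type := groupCohomology.H2 (unitsRep φ)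

/-- The class in `H²(G, ℂ^*_φ)` of a (multiplicatively written) 2-cocycle. -/
def H2.mk {φ : G →* Multiplicative (ZMod 2)} (f : G × G → TwistedUnits φ)
    (hf : groupCohomology.IsMulCocycle₂ f) : H2 φ :=
  groupCohomology.H2π (unitsRep φ) (groupCohomology.cocyclesOfIsMulCocycle₂ hf)

/-! ### Graded algebras -/

/-- A finite dimensional complex vector space. -/
structure FDSpace where
  carrier : Type
  [addCommGroup : AddCommGroup carrier]
  [module : Module ℂ carrier]
  [finite : FiniteDimensional ℂ carrier]

attribute [instance] FDSpace.addCommGroup FDSpace.module FDSpace.finite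

/-- A finite dimensional associative unital `ℤ/2`-graded complex algebra. -/
structure GrAlg where
  carrier : Type
  [ring : Ring carrier]
  [algebra : Algebra ℂ carrier]
  [finite : FiniteDimensional ℂ carrier]
  grading : ZMod 2 → Submodule ℂ carrier
  [graded : GradedAlgebra grading]

attribute [instance] GrAlg.ring GrAlg.algebra GrAlg.finite GrAlg.graded

/-- An isomorphism of graded complex algebras. -/
structure GrAlg.Iso (A B : GrAlg) where
  toEquiv : A.carrier ≃ₐ[ℂ] B.carrier
  map_mem : ∀ i, ∀ a ∈ A.grading i, toEquiv a ∈ B.grading i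

/-- The graded center: the span of the homogeneous elements that commute in the graded sense
with every homogeneous element. -/
def GrAlg.gradedCenter (A : GrAlg) : Submodule ℂ A.carrier :=
  Submodule.span ℂ {a | ∃ i, a ∈ A.grading i ∧
    ∀ j, ∀ b ∈ A.grading j, a * b = (-1 : ℤˣ) ^ (i * j) • (b * a)}

/-- Central simple graded algebras over `ℂ`. -/
structure GrAlg.IsCentralSimple (A : GrAlg) : Prop where
  nontrivial : Nontrivial A.carrier
  simple : ∀ I : Ideal A.carrier, I.IsTwoSided → I.IsHomogeneous A.grading → I = ⊥ ∨ I = ⊤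
  central : A.gradedCenter = LinearMap.range (Algebra.linearMap ℂ A.carrier)

/-! ### Gradings from a parity operator -/

section Grading

variable {M : Type} [AddCommGroup M] [Module ℂ M]

theorem zmod_two_cases (d : ZMod 2) : d = 0 ∨ d = 1 := by
  revert d; decide

theorem eq_neg_self_complex {M : Type} [AddCommGroup M] [Module ℂ M] {x : M} (h : x = -x) :
    x = 0 := by
  have h2 : (2 : ℂ) • x = 0 := by rw [two_smul]; exact add_eq_zero_iff_eq_neg.2 h
  exact (smul_eq_zero.1 h2).resolve_left two_ne_zero

/-- The sign `(-1)^d`, as a complex number. -/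
def sgn (d : ZMod 2) : ℂ := if d = 0 then 1 else -1

theorem sgn_zero : sgn 0 = 1 := if_pos rfl

theorem sgn_one : sgn 1 = -1 := if_neg (by decide)

theorem sgn_add (d e : ZMod 2) : sgn (d + e) = sgn d * sgn e := by
  have h : (1 : ZMod 2) + 1 = 0 := by decide
  rcases zmod_two_cases d with rfl | rfl <;> rcases zmod_two_cases e with rfl | rfl <;>
    simp [sgn_zero, sgn_one, h]

theorem isInternal_of_parity (𝒜 : ZMod 2 → Submodule ℂ M) (S : M →ₗ[ℂ] M)
    (h0 : ∀ a ∈ 𝒜 0, S a = a) (h1 : ∀ a ∈ 𝒜 1, S a = -a) (hs : 𝒜 0 ⊔ 𝒜 1 = ⊤) :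
    DirectSum.IsInternal 𝒜 := by
  rw [DirectSum.isInternal_submodule_iff_isCompl 𝒜 (i := 0) (j := 1) (by decide)
    (by ext x; simpa using zmod_two_cases x)]
  refine ⟨Submodule.disjoint_def.2 fun x hx hy => ?_, codisjoint_iff.2 hs⟩
  have h : x = -x := (h0 x hx).symm.trans (h1 x hy)
  exact eq_neg_self_complex h

end Grading

/-! ### The graded tensor product -/

namespace GrAlg

open GradedTensorProduct

variable (A B : GrAlg)

/-- The degree `n` part of the graded tensor product, spanned by the `a ⊗ b` with
`∂a + ∂b = n`. -/
def tensorGrading (n : ZMod 2) : Submodule ℂ (A.grading ᵍ⊗[ℂ] B.grading) :=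
  Submodule.span ℂ {x | ∃ i j, i + j = n ∧ ∃ a ∈ A.grading i, ∃ b ∈ B.grading j,
    x = a ᵍ⊗ₜ[ℂ] b}

/-- The parity operator of a graded algebra. -/
def parity : A.carrier →ₗ[ℂ] A.carrier :=
  GradedAlgebra.proj A.grading 0 - GradedAlgebra.proj A.grading 1

theorem parity_apply {i : ZMod 2} {a : A.carrier} (ha : a ∈ A.grading i) :
    A.parity a = sgn i • a := by
  have h01 : (0 : ZMod 2) ≠ 1 := by decide
  rcases zmod_two_cases i with rfl | rfl
  · simp [parity, GradedAlgebra.proj_apply, DirectSum.decompose_of_mem_same _ ha,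
      DirectSum.decompose_of_mem_ne _ ha h01, sgn_zero]
  · simp [parity, GradedAlgebra.proj_apply, DirectSum.decompose_of_mem_same _ ha,
      DirectSum.decompose_of_mem_ne _ ha h01.symm, sgn_one]

variable {A B} in
theorem tmul_induction {p : A.grading ᵍ⊗[ℂ] B.grading → Prop} (x : A.grading ᵍ⊗[ℂ] B.grading)
    (hom : ∀ i j, ∀ a ∈ A.grading i, ∀ b ∈ B.grading j, p (a ᵍ⊗ₜ[ℂ] b))
    (zero : p 0) (add : ∀ x y, p x → p y → p (x + y)) : p x := by
  change A.carrier ⊗[ℂ] B.carrier at x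
  induction x using TensorProduct.induction_on with
  | zero => exact zero
  | add x y hx hy => exact add _ _ hx hy
  | tmul a b =>
    change p (a ᵍ⊗ₜ[ℂ] b)
    induction a using DirectSum.Decomposition.inductionOn A.grading with
    | zero => simpa [tmul] using zero
    | add a a' ha ha' => simpa [tmul, TensorProduct.add_tmul] using add _ _ ha ha'
    | homogeneous a =>
      induction b using DirectSum.Decomposition.inductionOn B.grading with
      | zero => simpa [tmul] using zero
      | add b b' hb hb' => simpa [tmul, TensorProduct.tmul_add] using add _ _ hb hb'
      | homogeneous b => exact hom _ _ _ a.2 _ b.2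

theorem tensorGrading_isInternal : DirectSum.IsInternal (tensorGrading A B) := by
  let S : (A.grading ᵍ⊗[ℂ] B.grading) →ₗ[ℂ] (A.grading ᵍ⊗[ℂ] B.grading) :=
    (of ℂ A.grading B.grading).toLinearMap ∘ₗ TensorProduct.map A.parity B.parity ∘ₗ
      (of ℂ A.grading B.grading).symm.toLinearMap
  have key : ∀ n, ∀ x ∈ tensorGrading A B n, S x = sgn n • x := by
    intro n x hx
    induction hx using Submodule.span_induction with
    | mem x hx =>
      obtain ⟨i, j, rfl, a, ha, b, hb, rfl⟩ := hx
      change of ℂ A.grading B.grading (A.parity a ⊗ₜ B.parity b) = _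
      rw [parity_apply A ha, parity_apply B hb, TensorProduct.smul_tmul_smul, map_smul, sgn_add]
    | zero => simp
    | add x y _ _ hx hy => rw [map_add, hx, hy, smul_add]
    | smul c x _ hx => rw [map_smul, hx, smul_comm]
  refine isInternal_of_parity _ S (fun a ha => by simpa [sgn_zero] using key 0 a ha)
    (fun a ha => by simpa [sgn_one] using key 1 a ha) (eq_top_iff.2 fun x _ => ?_)
  induction x using tmul_induction with
  | zero => exact zero_mem _
  | add x y hx hy => exact add_mem (hx trivial) (hy trivial)
  | hom i j a ha b hb =>
    have h : a ᵍ⊗ₜ[ℂ] b ∈ tensorGrading A B (i + j) :=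
      Submodule.subset_span ⟨i, j, rfl, a, ha, b, hb, rfl⟩
    rcases zmod_two_cases (i + j) with h' | h' <;> rw [h'] at h
    · exact Submodule.mem_sup_left h
    · exact Submodule.mem_sup_right h

instance : GradedAlgebra (tensorGrading A B) where
  toDecomposition := (tensorGrading_isInternal A B).chooseDecomposition
  one_mem := Submodule.subset_span ⟨0, 0, rfl, 1, SetLike.one_mem_graded _, 1,
    SetLike.one_mem_graded _, rfl⟩
  mul_mem := by
    intro m n x y hx hy
    have h : tensorGrading A B m * tensorGrading A B n ≤ tensorGrading A B (m + n) := by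
      rw [tensorGrading, tensorGrading, Submodule.span_mul_span, Submodule.span_le]
      rintro _ ⟨_, ⟨i, j, rfl, a, ha, b, hb, rfl⟩, _, ⟨k, l, rfl, c, hc, d, hd, rfl⟩, rfl⟩
      change _ ∈ tensorGrading A B _
      have e := tmul_coe_mul_coe_tmul A.grading B.grading a ⟨b, hb⟩ ⟨c, hc⟩ d
      dsimp only at e ⊢
      rw [e, Units.smul_def]
      refine zsmul_mem ?_ _
      exact Submodule.subset_span ⟨i + k, j + l, by ring, a * c,
        SetLike.mul_mem_graded ha hc, b * d, SetLike.mul_mem_graded hb hd, rfl⟩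
    exact h (Submodule.mul_mem_mul hx hy)

/-- The graded tensor product of graded algebras. -/
def tensor : GrAlg where
  carrier := A.grading ᵍ⊗[ℂ] B.grading
  finite := inferInstanceAs (FiniteDimensional ℂ (A.carrier ⊗[ℂ] B.carrier))
  grading := tensorGrading A B

end GrAlg

/-! ### Graded endomorphism algebras -/

section Endo

variable (V₀ V₁ : Type) [AddCommGroup V₀] [Module ℂ V₀] [AddCommGroup V₁] [Module ℂ V₁]

/-- The homogeneous parts `V₀ ⊕ 0` and `0 ⊕ V₁` of the graded vector space `V₀ ⊕ V₁`. -/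
def part (i : ZMod 2) : Submodule ℂ (V₀ × V₁) :=
  if i = 0 then Submodule.prod ⊤ ⊥ else Submodule.prod ⊥ ⊤

/-- The endomorphisms of `V₀ ⊕ V₁` of degree `d`. -/
def endGrading (d : ZMod 2) : Submodule ℂ (Module.End ℂ (V₀ × V₁)) where
  carrier := {f | ∀ i, ∀ v ∈ part V₀ V₁ i, f v ∈ part V₀ V₁ (i + d)}
  add_mem' hf hg i v hv := add_mem (hf i v hv) (hg i v hv)
  zero_mem' _ _ _ := zero_mem _
  smul_mem' c _ hf i v hv := Submodule.smul_mem _ c (hf i v hv)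

/-- The parity operator of `V₀ ⊕ V₁`. -/
def vparity : Module.End ℂ (V₀ × V₁) := LinearMap.prodMap LinearMap.id (-LinearMap.id)

theorem vparity_vparity (v : V₀ × V₁) : vparity V₀ V₁ (vparity V₀ V₁ v) = v := by
  obtain ⟨x, y⟩ := v
  simp [vparity]

theorem mem_part_iff (i : ZMod 2) (v : V₀ × V₁) :
    v ∈ part V₀ V₁ i ↔ vparity V₀ V₁ v = sgn i • v := by
  obtain ⟨x, y⟩ := v
  rcases zmod_two_cases i with rfl | rfl
  · simp only [part, vparity, sgn_zero, if_pos, one_smul, LinearMap.prodMap_apply, Prod.mk.injEq,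
      Submodule.mem_prod, Submodule.mem_top, Submodule.mem_bot, LinearMap.id_apply, true_and,
      LinearMap.neg_apply]
    exact ⟨fun h => by simp [h], fun h => eq_neg_self_complex h.symm⟩
  · simp only [part, vparity, sgn_one, one_ne_zero, if_false, neg_smul, one_smul,
      LinearMap.prodMap_apply, Prod.mk.injEq, Prod.neg_mk,
      Submodule.mem_prod, Submodule.mem_top, Submodule.mem_bot, LinearMap.id_apply, and_true,
      LinearMap.neg_apply]
    exact ⟨fun h => by simp [h], fun h => eq_neg_self_complex h⟩

theorem mem_endGrading_iff (d : ZMod 2) (f : Module.End ℂ (V₀ × V₁)) :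
    f ∈ endGrading V₀ V₁ d ↔
      vparity V₀ V₁ * f * vparity V₀ V₁ = sgn d • f := by
  have hs : ∀ i, sgn i * sgn i = 1 := fun i => by
    rcases zmod_two_cases i with rfl | rfl <;> simp [sgn_zero, sgn_one]
  constructor
  · intro hf
    have key : ∀ i, ∀ v ∈ part V₀ V₁ i, (vparity V₀ V₁ * f * vparity V₀ V₁) v = (sgn d • f) v := by
      intro i v hv
      have h1 := (mem_part_iff V₀ V₁ _ _).1 (hf i v hv)
      rw [Module.End.mul_apply, Module.End.mul_apply, (mem_part_iff V₀ V₁ _ _).1 hv, map_smul,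
        map_smul, h1, sgn_add, smul_smul, ← mul_assoc, hs, one_mul, LinearMap.smul_apply]
    ext v
    · exact congrArg Prod.fst (key 0 (v, 0) (by simp [part]))
    · exact congrArg Prod.snd (key 0 (v, 0) (by simp [part]))
    · exact congrArg Prod.fst (key 1 (0, v) (by simp [part]))
    · exact congrArg Prod.snd (key 1 (0, v) (by simp [part]))
  · intro hf i v hv
    have h1 := (mem_part_iff V₀ V₁ _ _).1 hv
    have h2 := LinearMap.congr_fun hf (vparity V₀ V₁ v)
    rw [Module.End.mul_apply, Module.End.mul_apply, vparity_vparity, h1] at h2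
    rw [mem_part_iff, h2, LinearMap.smul_apply, map_smul, smul_smul, sgn_add, mul_comm]

theorem endGrading_isInternal : DirectSum.IsInternal (endGrading V₀ V₁) := by
  have hP : vparity V₀ V₁ * vparity V₀ V₁ = 1 := LinearMap.ext (vparity_vparity V₀ V₁)
  let S : Module.End ℂ (V₀ × V₁) →ₗ[ℂ] Module.End ℂ (V₀ × V₁) :=
    LinearMap.mulLeft ℂ (vparity V₀ V₁) ∘ₗ LinearMap.mulRight ℂ (vparity V₀ V₁)
  have hS : ∀ f, S f = vparity V₀ V₁ * f * vparity V₀ V₁ := fun f => (mul_assoc _ _ _).symm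
  have hSS : ∀ f, S (S f) = f := fun f => by
    rw [hS, hS, mul_assoc, mul_assoc, hP, mul_one, ← mul_assoc, hP, one_mul]
  refine isInternal_of_parity _ S (fun f hf => ?_) (fun f hf => ?_) (eq_top_iff.2 fun f _ => ?_)
  · rw [hS, (mem_endGrading_iff V₀ V₁ 0 f).1 hf, sgn_zero, one_smul]
  · rw [hS, (mem_endGrading_iff V₀ V₁ 1 f).1 hf, sgn_one]
    exact neg_one_smul ℂ f
  · have h : f = (1 / 2 : ℂ) • (f + S f) + (1 / 2 : ℂ) • (f - S f) := by
      rw [← smul_add, add_add_sub_cancel, ← two_smul ℂ f, smul_smul]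
      norm_num
    rw [h]
    refine Submodule.add_mem_sup (Submodule.smul_mem _ _ ?_) (Submodule.smul_mem _ _ ?_)
    · rw [mem_endGrading_iff, ← hS, map_add, hSS, sgn_zero, one_smul, add_comm]
    · rw [mem_endGrading_iff, ← hS, map_sub, hSS, sgn_one]
      exact (neg_sub f (S f)).symm.trans (neg_one_smul ℂ (f - S f)).symm

instance : GradedAlgebra (endGrading V₀ V₁) where
  toDecomposition := (endGrading_isInternal V₀ V₁).chooseDecomposition
  one_mem := fun i v hv => by simpa using hv
  mul_mem := by
    intro d e f g hf hg i v hv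
    have h := hf _ _ (hg i v hv)
    rwa [add_assoc, add_comm e d] at h

end Endo

/-- The graded algebra `End(V₀, V₁)` of endomorphisms of `V₀ ⊕ V₁`. -/
def GrAlg.endo (V₀ V₁ : FDSpace) : GrAlg where
  carrier := Module.End ℂ (V₀.carrier × V₁.carrier)
  grading := endGrading V₀.carrier V₁.carrier

/-! ### Similarity and the graded Brauer group of `ℂ` -/

/-- Central simple graded algebras over `ℂ`. -/
def CSGA : Type 1 := {A : GrAlg // A.IsCentralSimple}

/-- `A` and `B` are similar if `A ⊗ End(V₀, V₁) ≅ B ⊗ End(W₀, W₁)` as graded algebras, for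
some nonzero graded vector spaces `V₀ ⊕ V₁` and `W₀ ⊕ W₁`. -/
def CSGA.Similar (A B : CSGA) : Prop :=
  ∃ V₀ V₁ W₀ W₁ : FDSpace, Nontrivial (V₀.carrier × V₁.carrier) ∧
    Nontrivial (W₀.carrier × W₁.carrier) ∧
    Nonempty (GrAlg.Iso (A.1.tensor (GrAlg.endo V₀ V₁)) (B.1.tensor (GrAlg.endo W₀ W₁)))

/-- The graded Brauer group `GrBr(ℂ)`, as a set: similarity classes of central simple graded
algebras over `ℂ`. -/
def GrBrC : Type 1 := Quot CSGA.Similar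

/-- The similarity class of a central simple graded algebra. -/
def GrBrC.mk (A : CSGA) : GrBrC := Quot.mk _ A

/-! ### Magnetic equivariant graded algebras -/

/-- A finite dimensional magnetic representation of `(G, φ)`: `g` acts `ℂ`-linearly if `φ g` is
trivial and `ℂ`-antilinearly otherwise. -/
structure MagRep (φ : G →* Multiplicative (ZMod 2)) extends FDSpace where
  ρ : G →* AddMonoid.End carrier
  ρ_smul : ∀ g (c : ℂ) v, ρ g (c • v) = conjPow (φ g) c • ρ g v

/-- A `(G, φ)`-equivariant graded algebra: `G` acts by ring automorphisms of degree `0`, where `g`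
acts `ℂ`-linearly if `φ g` is trivial and `ℂ`-antilinearly otherwise. -/
structure MagAlg (φ : G →* Multiplicative (ZMod 2)) extends GrAlg where
  τ : G →* RingAut carrier
  τ_smul : ∀ g (c : ℂ) a, τ g (c • a) = conjPow (φ g) c • τ g a
  τ_mem : ∀ g i, ∀ a ∈ grading i, τ g a ∈ grading i

/-- Isomorphism of magnetic equivariant graded algebras: a `G`-equivariant isomorphism of graded
complex algebras. -/
structure MagAlg.Iso {φ : G →* Multiplicative (ZMod 2)} (A B : MagAlg φ) extends
    GrAlg.Iso A.toGrAlg B.toGrAlg where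
  map_τ : ∀ g a, toEquiv (A.τ g a) = B.τ g (toEquiv a)

namespace MagAlg

open GradedTensorProduct

variable {φ : G →* Multiplicative (ZMod 2)}

section Tensor

variable (A B : MagAlg φ)

/-- The action of `g` as a semilinear map. -/
def τSemi (g : G) : A.carrier →ₛₗ[conjPow (φ g)] A.carrier where
  toFun := A.τ g
  map_add' := map_add (A.τ g)
  map_smul' := A.τ_smul g

/-- The additive map `a ⊗ b ↦ g a ⊗ g b`. -/
def tensorMap (g : G) : (A.grading ᵍ⊗[ℂ] B.grading) →ₛₗ[conjPow (φ g)]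
    (A.grading ᵍ⊗[ℂ] B.grading) :=
  TensorProduct.map (A.τSemi g) (B.τSemi g)

theorem tensorMap_tmul (g : G) (a : A.carrier) (b : B.carrier) :
    tensorMap A B g (a ᵍ⊗ₜ[ℂ] b) = A.τ g a ᵍ⊗ₜ[ℂ] B.τ g b := rfl

theorem tensorMap_one (x : A.grading ᵍ⊗[ℂ] B.grading) : tensorMap A B 1 x = x := by
  induction x using GrAlg.tmul_induction with
  | zero => simp
  | add x y hx hy => rw [map_add, hx, hy]
  | hom i j a _ b _ => simp [tensorMap_tmul]

theorem tensorMap_mul (g h : G) (x : A.grading ᵍ⊗[ℂ] B.grading) :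
    tensorMap A B (g * h) x = tensorMap A B g (tensorMap A B h x) := by
  induction x using GrAlg.tmul_induction with
  | zero => simp
  | add x y hx hy => rw [map_add, hx, hy, map_add, map_add]
  | hom i j a _ b _ => simp [tensorMap_tmul]

theorem tensorMap_map_mul (g : G) (x y : A.grading ᵍ⊗[ℂ] B.grading) :
    tensorMap A B g (x * y) = tensorMap A B g x * tensorMap A B g y := by
  induction x using GrAlg.tmul_induction with
  | zero => simp
  | add x x' hx hx' => rw [add_mul, map_add, hx, hx', map_add, add_mul]
  | hom i j a ha b hb =>
    induction y using GrAlg.tmul_induction with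
    | zero => simp
    | add y y' hy hy' => rw [mul_add, map_add, hy, hy', map_add, mul_add]
    | hom k l c hc d hd =>
      have e := tmul_coe_mul_coe_tmul (R := ℂ) A.grading B.grading a ⟨b, hb⟩ ⟨c, hc⟩ d
      have e' := tmul_coe_mul_coe_tmul (R := ℂ) A.grading B.grading (A.τ g a)
        ⟨B.τ g b, B.τ_mem g _ _ hb⟩ ⟨A.τ g c, A.τ_mem g _ _ hc⟩ (B.τ g d)
      dsimp only at e e'
      rw [e, tensorMap_tmul, tensorMap_tmul, e', Units.smul_def, Units.smul_def, map_zsmul,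
        tensorMap_tmul, map_mul, map_mul]

theorem tensorMap_mem (g : G) (n : ZMod 2) (x : A.grading ᵍ⊗[ℂ] B.grading)
    (hx : x ∈ GrAlg.tensorGrading A.toGrAlg B.toGrAlg n) :
    tensorMap A B g x ∈ GrAlg.tensorGrading A.toGrAlg B.toGrAlg n := by
  induction hx using Submodule.span_induction with
  | zero => rw [map_zero]; exact zero_mem _
  | add x y _ _ hx hy => rw [map_add]; exact add_mem hx hy
  | smul c x _ hx => rw [map_smulₛₗ]; exact Submodule.smul_mem _ _ hx
  | mem x hx =>
    obtain ⟨i, j, rfl, a, ha, b, hb, rfl⟩ := hx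
    exact Submodule.subset_span ⟨i, j, rfl, _, A.τ_mem g i a ha, _, B.τ_mem g j b hb, rfl⟩

/-- The graded tensor product of magnetic equivariant graded algebras, with action
`g (a ⊗ b) = g a ⊗ g b`. -/
def tensor : MagAlg φ where
  toGrAlg := A.toGrAlg.tensor B.toGrAlg
  τ :=
    { toFun g :=
        { toFun := tensorMap A B g
          invFun := tensorMap A B g⁻¹
          left_inv x := (tensorMap_mul A B g⁻¹ g x).symm.trans
            (by rw [inv_mul_cancel]; exact tensorMap_one A B x)
          right_inv x := (tensorMap_mul A B g g⁻¹ x).symm.trans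
            (by rw [mul_inv_cancel]; exact tensorMap_one A B x)
          map_mul' := tensorMap_map_mul A B g
          map_add' := map_add (tensorMap A B g) }
      map_one' := RingEquiv.ext (tensorMap_one A B)
      map_mul' g h := RingEquiv.ext (tensorMap_mul A B g h) }
  τ_smul g c x := map_smulₛₗ (tensorMap A B g) c x
  τ_mem := tensorMap_mem A B

end Tensor

section Endo

variable (V₀ V₁ : MagRep φ)

/-- The action of `g` on `V₀ ⊕ V₁`. -/
def sumMap (g : G) : (V₀.carrier × V₁.carrier) →ₛₗ[conjPow (φ g)] (V₀.carrier × V₁.carrier) where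
  toFun v := (V₀.ρ g v.1, V₁.ρ g v.2)
  map_add' v w := by simp
  map_smul' c v := by simp [V₀.ρ_smul, V₁.ρ_smul]

theorem sumMap_one (v : V₀.carrier × V₁.carrier) : sumMap V₀ V₁ 1 v = v := by
  simp [sumMap]

theorem sumMap_mul (g h : G) (v : V₀.carrier × V₁.carrier) :
    sumMap V₀ V₁ (g * h) v = sumMap V₀ V₁ g (sumMap V₀ V₁ h v) := by
  simp [sumMap]

theorem sumMap_mem (g : G) (i : ZMod 2) (v : V₀.carrier × V₁.carrier)
    (hv : v ∈ part V₀.carrier V₁.carrier i) :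
    sumMap V₀ V₁ g v ∈ part V₀.carrier V₁.carrier i := by
  rcases zmod_two_cases i with rfl | rfl <;> simp_all [part, sumMap]

/-- Conjugation `F ↦ ρ(g) F ρ(g)⁻¹`. -/
def conjEnd (g : G) (F : Module.End ℂ (V₀.carrier × V₁.carrier)) :
    Module.End ℂ (V₀.carrier × V₁.carrier) where
  toFun v := sumMap V₀ V₁ g (F (sumMap V₀ V₁ g⁻¹ v))
  map_add' v w := by simp only [map_add]
  map_smul' c v := by
    rw [map_smulₛₗ, map_smul, map_smulₛₗ, ← conjPow_mul, ← map_mul, mul_inv_cancel, map_one,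
      conjPow_one, RingHom.id_apply]

theorem conjEnd_one (F : Module.End ℂ (V₀.carrier × V₁.carrier)) : conjEnd V₀ V₁ 1 F = F :=
  LinearMap.ext fun v => by
    change sumMap V₀ V₁ 1 (F (sumMap V₀ V₁ 1⁻¹ v)) = F v
    rw [inv_one, sumMap_one, sumMap_one]

theorem conjEnd_mul (g h : G) (F : Module.End ℂ (V₀.carrier × V₁.carrier)) :
    conjEnd V₀ V₁ (g * h) F = conjEnd V₀ V₁ g (conjEnd V₀ V₁ h F) :=
  LinearMap.ext fun v => by
    change sumMap V₀ V₁ (g * h) (F (sumMap V₀ V₁ (g * h)⁻¹ v)) =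
      sumMap V₀ V₁ g (sumMap V₀ V₁ h (F (sumMap V₀ V₁ h⁻¹ (sumMap V₀ V₁ g⁻¹ v))))
    rw [mul_inv_rev, sumMap_mul, sumMap_mul]

theorem conjEnd_map_mul (g : G) (E F : Module.End ℂ (V₀.carrier × V₁.carrier)) :
    conjEnd V₀ V₁ g (E * F) = conjEnd V₀ V₁ g E * conjEnd V₀ V₁ g F :=
  LinearMap.ext fun v => by
    change sumMap V₀ V₁ g (E (F (sumMap V₀ V₁ g⁻¹ v))) = sumMap V₀ V₁ g (E (sumMap V₀ V₁ g⁻¹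
      (sumMap V₀ V₁ g (F (sumMap V₀ V₁ g⁻¹ v)))))
    rw [← sumMap_mul, inv_mul_cancel, sumMap_one]

/-- The graded algebra `End(V₀, V₁)` of endomorphisms of the direct sum of two magnetic
representations, on which `g` acts by `F ↦ ρ(g) F ρ(g)⁻¹`. -/
def endo : MagAlg φ where
  toGrAlg := GrAlg.endo V₀.toFDSpace V₁.toFDSpace
  τ :=
    { toFun g :=
        { toFun := conjEnd V₀ V₁ g
          invFun := conjEnd V₀ V₁ g⁻¹
          left_inv F := (conjEnd_mul V₀ V₁ g⁻¹ g F).symm.trans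
            (by rw [inv_mul_cancel]; exact conjEnd_one V₀ V₁ F)
          right_inv F := (conjEnd_mul V₀ V₁ g g⁻¹ F).symm.trans
            (by rw [mul_inv_cancel]; exact conjEnd_one V₀ V₁ F)
          map_mul' := conjEnd_map_mul V₀ V₁ g
          map_add' E F := LinearMap.ext fun v => map_add (sumMap V₀ V₁ g) _ _ }
      map_one' := RingEquiv.ext (conjEnd_one V₀ V₁)
      map_mul' g h := RingEquiv.ext (conjEnd_mul V₀ V₁ g h) }
  τ_smul g c F := LinearMap.ext fun v => map_smulₛₗ (sumMap V₀ V₁ g) c _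
  τ_mem g d F hF := fun i v hv => sumMap_mem V₀ V₁ g _ _ (hF _ _ (sumMap_mem V₀ V₁ g⁻¹ _ _ hv))

end Endo

end MagAlg

/-! ### The magnetic equivariant graded Brauer group -/

/-- Magnetic `(G, φ)`-equivariant central simple graded algebras. -/
def MECSGA (φ : G →* Multiplicative (ZMod 2)) : Type 1 :=
  {A : MagAlg φ // A.toGrAlg.IsCentralSimple}

/-- `A` and `B` are similar if `A ⊗ End(V₀, V₁) ≅ B ⊗ End(W₀, W₁)` as graded algebras with
`G`-action, for some magnetic representations with `V₀ ⊕ V₁` and `W₀ ⊕ W₁` nonzero. -/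
def MECSGA.Similar {φ : G →* Multiplicative (ZMod 2)} (A B : MECSGA φ) : Prop :=
  ∃ V₀ V₁ W₀ W₁ : MagRep φ, Nontrivial (V₀.carrier × V₁.carrier) ∧
    Nontrivial (W₀.carrier × W₁.carrier) ∧
    Nonempty (MagAlg.Iso (A.1.tensor (MagAlg.endo V₀ V₁)) (B.1.tensor (MagAlg.endo W₀ W₁)))

/-- The magnetic equivariant graded Brauer group `GrBr_{(G,φ)}(ℂ)`, as a set: similarity classes of
magnetic `(G, φ)`-equivariant central simple graded algebras. -/
def GrBr (φ : G →* Multiplicative (ZMod 2)) : Type 1 := Quot (MECSGA.Similar (φ := φ))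

/-- The similarity class of a magnetic equivariant central simple graded algebra. -/
def GrBr.mk {φ : G →* Multiplicative (ZMod 2)} (A : MECSGA φ) : GrBr φ := Quot.mk _ A

/-- The central simple graded algebra obtained by forgetting the `G`-action. -/
def MECSGA.forget {φ : G →* Multiplicative (ZMod 2)} (A : MECSGA φ) : CSGA := ⟨A.1.toGrAlg, A.2⟩

/-- The group structure on `GrBr(ℂ)` is the one induced by the graded tensor product (which
preserves central simple graded algebras). -/
def GrBrC.IsTensorAddition [AddCommGroup GrBrC] : Prop :=
  ∀ A B : CSGA, ∃ h : (A.1.tensor B.1).IsCentralSimple,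
    GrBrC.mk A + GrBrC.mk B = GrBrC.mk ⟨A.1.tensor B.1, h⟩

/-- The group structure on `GrBr_{(G,φ)}(ℂ)` is the one induced by the graded tensor product
(which preserves magnetic equivariant central simple graded algebras). -/
def GrBr.IsTensorAddition (φ : G →* Multiplicative (ZMod 2)) [AddCommGroup (GrBr φ)] : Prop :=
  ∀ A B : MECSGA φ, ∃ h : (A.1.tensor B.1).toGrAlg.IsCentralSimple,
    GrBr.mk A + GrBr.mk B = GrBr.mk ⟨A.1.tensor B.1, h⟩

/-- `A` is, as a graded algebra, an endomorphism algebra `End(V₀, V₁)` on which every `g : G` acts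
as conjugation by a `φ g`-semilinear automorphism of `V₀ ⊕ V₁` (that is, by `M_g K^{φ g}` with
`M_g` invertible) that is homogeneous of degree `ψ g`. -/
def MagAlg.HasDegreeCharacter {φ : G →* Multiplicative (ZMod 2)} (A : MagAlg φ)
    (ψ : Additive G →+ ZMod 2) : Prop :=
  ∃ (V₀ V₁ : FDSpace) (θ : GrAlg.Iso A.toGrAlg (GrAlg.endo V₀ V₁)),
    ∀ g : G, ∃ T : (V₀.carrier × V₁.carrier) ≃+ (V₀.carrier × V₁.carrier),
      (∀ (c : ℂ) v, T (c • v) = conjPow (φ g) c • T v) ∧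
      (∀ i, ∀ v ∈ part V₀.carrier V₁.carrier i,
        T v ∈ part V₀.carrier V₁.carrier (i + ψ (Additive.ofMul g))) ∧
      ∀ (a : A.carrier) v,
        (show Module.End ℂ (V₀.carrier × V₁.carrier) from θ.toEquiv (A.τ g a)) (T v) =
          T ((show Module.End ℂ (V₀.carrier × V₁.carrier) from θ.toEquiv a) v)

/-- `A` is the endomorphism algebra, concentrated in degree `0`, of a projective magnetic
representation `g ↦ T g` with cocycle `f`, that is `T g ∘ T h = f (g, h) • T (g h)`, on which `g`
acts as conjugation by `T g`. -/
def MagAlg.IsProjectiveEnd {φ : G →* Multiplicative (ZMod 2)} (A : MagAlg φ)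
    (f : G × G → TwistedUnits φ) : Prop :=
  ∃ (V : FDSpace) (T : G → V.carrier ≃+ V.carrier)
    (θ : A.carrier ≃ₐ[ℂ] Module.End ℂ V.carrier),
    (∀ g (c : ℂ) v, T g (c • v) = conjPow (φ g) c • T g v) ∧
    (∀ g h v, T g (T h v) = (f (g, h)).val • T (g * h) v) ∧
    A.grading 0 = ⊤ ∧
    ∀ g a v, θ (A.τ g a) (T g v) = T g (θ a v)

end MagBrauer

end

/-! Over `ℂ` a central simple graded algebra is `End V` or `End V ⊗ Cl`, with `V` a super vector
space and `Cl` the Clifford algebra of rank one (`GrAlg.IsCentralSimple.exists_iso`). If the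
underlying algebra is simple, Wedderburn makes it a matrix algebra and Skolem–Noether turns the
parity automorphism into conjugation by an involution. Otherwise a nontrivial ideal `I` satisfies `A
= I ⊕ σ I`, with `σ` the parity; writing `1 = e + σ e`, the element `z = e - σ e` is odd, central
and of square one, so `A` is its even part tensored with `Cl`. Since `Cl ⊗ Cl` is an endomorphism
algebra, the central simple algebras are exactly the tensor factors of endomorphism algebras, which
gives closure under tensor products. A dimension count separates `Cl` from `End V`, so `GrBr(ℂ)` has
order two.

Suppose a magnetic equivariant algebra is `End V` after forgetting `G`. By a semilinear form of
Skolem–Noether, `g` acts as conjugation by a semilinear `T_g`, unique up to a scalar. Uniqueness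
gives `T_g T_h = c(g,h) T_{gh}` with `c` a 2-cocycle in `ℂ^*_φ`, and `T_g P = ± P T_g` with the sign
given by a character `deg`. Such data form a `ProjRep` (`exists_projRep`). Under tensor products
degrees add, and cocycles multiply with the extra factor `(-1)^{deg_R(g) deg_S(h)}`. The pair of
`deg` and the class of `c` is a complete invariant of the Brauer class (`GrBr.ofRep_eq_iff`). This
yields the sequence in 2: the twisted regular representation realizes every cocycle in degree zero,
`swapRep` realizes every character, and together they supply inverses.

Everything else rests on the class `[Cl]`, where `G` acts by powers of complex conjugation. Twice
this class has degree `φ`. Any other lift of the generator of `GrBr(ℂ)` differs by a kernel element,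
whose double has degree zero, so no lift has order two. If `φ` is bijective and `s` is the
nontrivial element, `4 [Cl]` has degree zero and a cocycle with `f(1,1) f(s,s) = -1`, whereas a
coboundary gives `|x(s)|² > 0`. The sign of this real number is the only invariant in degree zero,
so `[Cl]` generates a group of order eight, `2 [Cl]` generates the kernel, and a splitting of the
sequence in 2 would force `4 [Cl] = 0`. -/

noncomputable section

namespace MagBrauer

/-! ### Signs -/

theorem sgn_mul_self (d : ZMod 2) : sgn d * sgn d = 1 := by
  rcases zmod_two_cases d with rfl | rfl <;> simp [sgn_zero, sgn_one]

theorem sgn_ne_zero (d : ZMod 2) : sgn d ≠ 0 := fun h => by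
  simpa [h] using sgn_mul_self d

theorem sgn_injective : Function.Injective sgn := by
  intro d e h
  rcases zmod_two_cases d with rfl | rfl <;> rcases zmod_two_cases e with rfl | rfl <;>
    first | rfl | (rw [sgn_zero, sgn_one] at h; norm_num at h)

theorem sgn_eq_or (d : ZMod 2) : sgn d = 1 ∨ sgn d = -1 := by
  rcases zmod_two_cases d with rfl | rfl <;> simp [sgn_zero, sgn_one]

/-- Signs are real; this is why the Koszul rule is compatible with antilinear actions. -/
theorem conjPow_sgn (d : Multiplicative (ZMod 2)) (e : ZMod 2) : conjPow d (sgn e) = sgn e := by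
  rcases sgn_eq_or e with h | h <;> simp [h]

theorem units_neg_one_pow_smul {M : Type} [AddCommGroup M] [Module ℂ M] (d : ZMod 2) (x : M) :
    ((-1 : ℤˣ) ^ d) • x = sgn d • x := by
  rcases zmod_two_cases d with rfl | rfl
  · simp [sgn_zero]
  · rw [uzpow_one, sgn_one, Units.smul_def]; simp

theorem conjPow_conjPow (d : Multiplicative (ZMod 2)) (c : ℂ) : conjPow d (conjPow d c) = c := by
  rw [← conjPow_mul]
  have h : ∀ x : Multiplicative (ZMod 2), x * x = 1 := by decide
  rw [h, conjPow_one]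

namespace GrAlg

/-! ### The parity operator -/

section Parity

variable (A : GrAlg)

theorem homogeneous_induction {p : A.carrier → Prop} (x : A.carrier)
    (hom : ∀ i, ∀ a ∈ A.grading i, p a) (add : ∀ x y, p x → p y → p (x + y)) : p x := by
  induction x using DirectSum.Decomposition.inductionOn A.grading with
  | zero => exact hom 0 0 (zero_mem _)
  | add a a' ha ha' => exact add _ _ ha ha'
  | homogeneous a => exact hom _ _ a.2

theorem one_mem : (1 : A.carrier) ∈ A.grading 0 := SetLike.one_mem_graded A.grading

variable {A} in
theorem mul_mem {i j : ZMod 2} {a b : A.carrier} (ha : a ∈ A.grading i) (hb : b ∈ A.grading j) :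
    a * b ∈ A.grading (i + j) := SetLike.mul_mem_graded ha hb

/-- The degree is an eigenvalue of one involution. From here on gradings are handled through the
parity operator instead of through direct sum decompositions. -/
theorem mem_grading_iff {i : ZMod 2} {a : A.carrier} :
    a ∈ A.grading i ↔ A.parity a = sgn i • a := by
  refine ⟨A.parity_apply, fun h => ?_⟩
  have hx : a = GradedAlgebra.proj A.grading 0 a + GradedAlgebra.proj A.grading 1 a := by
    clear h
    induction a using A.homogeneous_induction with
    | add x y hx hy => rw [map_add, map_add]; nth_rewrite 1 [hx, hy]; abel
    | hom j a ha =>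
      rcases zmod_two_cases j with rfl | rfl
      · simp [GradedAlgebra.proj_apply, DirectSum.decompose_of_mem_same _ ha,
          DirectSum.decompose_of_mem_ne A.grading ha (show (0 : ZMod 2) ≠ 1 by decide)]
      · simp [GradedAlgebra.proj_apply, DirectSum.decompose_of_mem_same _ ha,
          DirectSum.decompose_of_mem_ne A.grading ha (show (1 : ZMod 2) ≠ 0 by decide)]
  have h0 : GradedAlgebra.proj A.grading 0 a ∈ A.grading 0 := by
    rw [GradedAlgebra.proj_apply]; exact SetLike.coe_mem _
  have h1 : GradedAlgebra.proj A.grading 1 a ∈ A.grading 1 := by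
    rw [GradedAlgebra.proj_apply]; exact SetLike.coe_mem _
  have h' : GradedAlgebra.proj A.grading 0 a - GradedAlgebra.proj A.grading 1 a = sgn i • a := h
  rcases zmod_two_cases i with rfl | rfl
  · have : GradedAlgebra.proj A.grading 1 a = 0 := by
      apply eq_neg_self_complex
      rw [sgn_zero, one_smul] at h'
      nth_rewrite 3 [hx] at h'
      rw [sub_eq_add_neg] at h'
      exact (add_left_cancel h').symm
    rw [hx, this, add_zero]; exact h0
  · have : GradedAlgebra.proj A.grading 0 a = 0 := by
      apply eq_neg_self_complex
      rw [sgn_one, neg_one_smul] at h'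
      nth_rewrite 3 [hx] at h'
      rw [sub_eq_add_neg, neg_add] at h'
      exact (add_right_cancel h')
    rw [hx, this, zero_add]; exact h1

theorem parity_parity (a : A.carrier) : A.parity (A.parity a) = a := by
  induction a using A.homogeneous_induction with
  | hom i a ha => rw [A.parity_apply ha, map_smul, A.parity_apply ha, smul_smul, sgn_mul_self,
      one_smul]
  | add x y hx hy => rw [map_add, map_add, hx, hy]

theorem parity_mul (a b : A.carrier) : A.parity (a * b) = A.parity a * A.parity b := by
  induction a using A.homogeneous_induction with
  | add x y hx hy => rw [add_mul, map_add, map_add, hx, hy, add_mul]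
  | hom i a ha =>
    induction b using A.homogeneous_induction with
    | add x y hx hy => rw [mul_add, map_add, map_add, hx, hy, mul_add]
    | hom j b hb =>
      rw [A.parity_apply (SetLike.mul_mem_graded ha hb), A.parity_apply ha, A.parity_apply hb,
        sgn_add, smul_mul_smul_comm]

theorem parity_one : A.parity 1 = 1 := by
  rw [A.parity_apply (SetLike.one_mem_graded A.grading), sgn_zero, one_smul]

theorem add_parity_mem (a : A.carrier) (i : ZMod 2) : a + sgn i • A.parity a ∈ A.grading i := by
  rw [mem_grading_iff, map_add, map_smul, parity_parity, smul_add, smul_smul, sgn_mul_self,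
    one_smul, add_comm]

theorem eq_half_smul_add (a : A.carrier) :
    a = (1 / 2 : ℂ) • ((a + sgn 0 • A.parity a) + (a + sgn 1 • A.parity a)) := by
  rw [sgn_zero, sgn_one, one_smul, neg_one_smul,
    show a + A.parity a + (a + -A.parity a) = (2 : ℂ) • a by rw [two_smul]; abel, smul_smul]
  norm_num

end Parity

/-- The parity operator as an algebra automorphism. -/
def parityEquiv (A : GrAlg) : A.carrier ≃ₐ[ℂ] A.carrier :=
  AlgEquiv.ofLinearEquiv (LinearEquiv.ofInvolutive A.parity A.parity_parity) A.parity_one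
    A.parity_mul

theorem parityEquiv_apply (A : GrAlg) (a : A.carrier) : A.parityEquiv a = A.parity a := rfl

/-- The graded algebra given by an algebra with an involutive automorphism. -/
abbrev ofParity (A : Type) [Ring A] [Algebra ℂ A] [FiniteDimensional ℂ A] (σ : A →ₐ[ℂ] A)
    (hσ : ∀ a, σ (σ a) = a) : GrAlg where
  carrier := A
  grading i := LinearMap.ker (σ.toLinearMap - sgn i • LinearMap.id)
  graded :=
    { toDecomposition := by
        refine (isInternal_of_parity _ σ.toLinearMap (fun a ha => ?_) (fun a ha => ?_)
          (eq_top_iff.2 fun a _ => ?_)).chooseDecomposition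
        · simpa [sgn_zero, sub_eq_zero] using ha
        · simpa [sgn_one, add_eq_zero_iff_eq_neg] using ha
        · have h : a = (1 / 2 : ℂ) • (a + σ a) + (1 / 2 : ℂ) • (a - σ a) := by
            rw [← smul_add, add_add_sub_cancel, ← two_smul ℂ a, smul_smul]
            norm_num
          rw [h]
          refine Submodule.add_mem_sup (Submodule.smul_mem _ _ ?_) (Submodule.smul_mem _ _ ?_)
          · simp [sgn_zero, hσ, add_comm]
          · simp [sgn_one, hσ]
      one_mem := by simp [sgn_zero]
      mul_mem := by
        intro i j a b ha hb
        rw [LinearMap.mem_ker, LinearMap.sub_apply, sub_eq_zero] at ha hb ⊢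
        simp only [AlgHom.toLinearMap_apply, LinearMap.smul_apply, LinearMap.id_apply] at ha hb ⊢
        rw [map_mul, ha, hb, sgn_add, smul_mul_smul_comm] }

theorem mem_ofParity_iff {A : Type} [Ring A] [Algebra ℂ A] [FiniteDimensional ℂ A] {σ : A →ₐ[ℂ] A}
    {hσ : ∀ a, σ (σ a) = a} {i : ZMod 2} {a : A} :
    a ∈ (ofParity A σ hσ).grading i ↔ σ a = sgn i • a := by
  change a ∈ LinearMap.ker (σ.toLinearMap - sgn i • LinearMap.id) ↔ _
  rw [LinearMap.mem_ker, LinearMap.sub_apply, sub_eq_zero]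
  rfl

theorem ofParity_parity {A : Type} [Ring A] [Algebra ℂ A] [FiniteDimensional ℂ A] {σ : A →ₐ[ℂ] A}
    {hσ : ∀ a, σ (σ a) = a} (a : A) : (ofParity A σ hσ).parity a = σ a := by
  induction a using (ofParity A σ hσ).homogeneous_induction with
  | hom i a ha => rw [(ofParity A σ hσ).parity_apply ha]; exact (mem_ofParity_iff (A := A).1 ha).symm
  | add x y hx hy => exact (map_add _ x y).trans ((congrArg₂ _ hx hy).trans (map_add σ x y).symm)

/-! ### Isomorphisms of graded algebras -/

namespace Iso

variable {A B C : GrAlg}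

theorem map_parity (e : Iso A B) (a : A.carrier) : e.toEquiv (A.parity a) = B.parity (e.toEquiv a) := by
  induction a using A.homogeneous_induction with
  | hom i a ha => rw [A.parity_apply ha, B.parity_apply (e.map_mem i a ha), map_smul]
  | add x y hx hy => simp only [map_add, hx, hy]

theorem map_mem_iff (e : Iso A B) (i : ZMod 2) (a : A.carrier) :
    e.toEquiv a ∈ B.grading i ↔ a ∈ A.grading i := by
  refine ⟨fun h => ?_, e.map_mem i a⟩
  rw [mem_grading_iff] at h ⊢
  rw [← e.map_parity, ← map_smul] at h
  exact e.toEquiv.injective h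

/-- An algebra isomorphism that is compatible with the parity operators is graded. -/
def ofParity (e : A.carrier ≃ₐ[ℂ] B.carrier) (h : ∀ a, e (A.parity a) = B.parity (e a)) :
    Iso A B where
  toEquiv := e
  map_mem i a ha := by
    rw [mem_grading_iff] at ha ⊢
    rw [← h, ha, map_smul]

/-- The identity. -/
def refl (A : GrAlg) : Iso A A := ⟨AlgEquiv.refl, fun _ _ h => h⟩

/-- The inverse isomorphism. -/
def symm (e : Iso A B) : Iso B A :=
  ⟨e.toEquiv.symm, fun i b hb => by
    rw [← e.map_mem_iff, AlgEquiv.apply_symm_apply]; exact hb⟩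

/-- The composition of isomorphisms. -/
def trans (e : Iso A B) (f : Iso B C) : Iso A C :=
  ⟨e.toEquiv.trans f.toEquiv, fun i a ha => f.map_mem i _ (e.map_mem i a ha)⟩

end Iso

/-! ### The graded tensor product -/

section Tensor

variable (A B : GrAlg)

/-- The linear identification of the ordinary and the graded tensor product. -/
def tens : A.carrier ⊗[ℂ] B.carrier ≃ₗ[ℂ] (A.tensor B).carrier :=
  GradedTensorProduct.of ℂ A.grading B.grading

theorem tens_one : tens A B (1 ⊗ₜ 1) = 1 := rfl

variable {A B}

theorem tens_mul {i j : ZMod 2} (a : A.carrier) {b : B.carrier} (hb : b ∈ B.grading j)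
    {c : A.carrier} (hc : c ∈ A.grading i) (d : B.carrier) :
    tens A B (a ⊗ₜ b) * tens A B (c ⊗ₜ d) = sgn (j * i) • tens A B ((a * c) ⊗ₜ (b * d)) := by
  have e := GradedTensorProduct.tmul_coe_mul_coe_tmul (R := ℂ) A.grading B.grading a ⟨b, hb⟩
    ⟨c, hc⟩ d
  rw [← units_neg_one_pow_smul]
  exact e

theorem tens_mem {i j : ZMod 2} {a : A.carrier} (ha : a ∈ A.grading i) {b : B.carrier}
    (hb : b ∈ B.grading j) : tens A B (a ⊗ₜ b) ∈ (A.tensor B).grading (i + j) :=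
  Submodule.subset_span (R := ℂ) (M := A.grading ᵍ⊗[ℂ] B.grading) ⟨i, j, rfl, a, ha, b, hb, rfl⟩

theorem tens_induction {p : (A.tensor B).carrier → Prop} (x : (A.tensor B).carrier)
    (hom : ∀ i j, ∀ a ∈ A.grading i, ∀ b ∈ B.grading j, p (tens A B (a ⊗ₜ b)))
    (add : ∀ x y, p x → p y → p (x + y)) : p x :=
  tmul_induction (A := A) (B := B) x hom
    (by
      have h := hom 0 0 0 (zero_mem _) 0 (zero_mem _)
      rw [TensorProduct.zero_tmul, map_zero] at h
      exact h) add

/-- Construction of isomorphisms out of a graded tensor product. -/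
def Iso.ofTensor {C : GrAlg} (e : A.carrier ⊗[ℂ] B.carrier ≃ₗ[ℂ] C.carrier)
    (h_one : e (1 ⊗ₜ 1) = 1)
    (h_mem : ∀ i j, ∀ a ∈ A.grading i, ∀ b ∈ B.grading j, e (a ⊗ₜ b) ∈ C.grading (i + j))
    (h_mul : ∀ i j k l, ∀ a ∈ A.grading i, ∀ b ∈ B.grading j, ∀ c ∈ A.grading k,
      ∀ d ∈ B.grading l, e (a ⊗ₜ b) * e (c ⊗ₜ d) = sgn (j * k) • e ((a * c) ⊗ₜ (b * d))) :
    Iso (A.tensor B) C :=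
  Iso.ofParity (AlgEquiv.ofLinearEquiv ((tens A B).symm.trans e)
    (by rw [← tens_one]; simpa using h_one) (fun x y => by
      induction x using tens_induction with
      | add x x' hx hx' => rw [add_mul, map_add, hx, hx', map_add, add_mul]
      | hom i j a ha b hb =>
        induction y using tens_induction with
        | add y y' hy hy' => rw [mul_add, map_add, hy, hy', map_add, mul_add]
        | hom k l c hc d hd =>
          rw [tens_mul _ hb hc, map_smul]
          simpa using (h_mul i j k l a ha b hb c hc d hd).symm))
    (fun x => by
      induction x using tens_induction with
      | add x y hx hy => simp only [map_add, hx, hy]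
      | hom i j a ha b hb =>
        have h := h_mem i j a ha b hb
        rw [parity_apply _ (tens_mem ha hb), map_smul]
        rw [mem_grading_iff] at h
        simpa using h.symm)

/-- Congruence for the graded tensor product. -/
def Iso.tensor {A' B' : GrAlg} (e : Iso A A') (f : Iso B B') :
    Iso (A.tensor B) (A'.tensor B') :=
  Iso.ofTensor ((TensorProduct.congr e.toEquiv.toLinearEquiv f.toEquiv.toLinearEquiv).trans
    (A'.tens B'))
    (by simp [tens_one])
    (fun i j a ha b hb => by simpa using tens_mem (e.map_mem i a ha) (f.map_mem j b hb))
    (fun i j k l a ha b hb c hc d hd => by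
      simpa using tens_mul (e.toEquiv a) (f.map_mem j b hb) (e.map_mem k c hc) (f.toEquiv d))

theorem Iso.tensor_tens {A' B' : GrAlg} (e : Iso A A') (f : Iso B B') (a b) :
    (e.tensor f).toEquiv (tens A B (a ⊗ₜ b)) = tens A' B' (e.toEquiv a ⊗ₜ f.toEquiv b) := rfl

/-- The algebra isomorphism underlying the graded swap. -/
def commEquiv (A B : GrAlg) : (A.tensor B).carrier ≃ₐ[ℂ] (B.tensor A).carrier :=
  GradedTensorProduct.comm A.grading B.grading

theorem commEquiv_tens {i j : ZMod 2} {a : A.carrier} (ha : a ∈ A.grading i) {b : B.carrier}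
    (hb : b ∈ B.grading j) :
    commEquiv A B (tens A B (a ⊗ₜ b)) = sgn (j * i) • tens B A (b ⊗ₜ a) := by
  rw [← units_neg_one_pow_smul]
  exact GradedTensorProduct.comm_coe_tmul_coe A.grading B.grading ⟨a, ha⟩ ⟨b, hb⟩

/-- The graded swap. -/
def Iso.comm (A B : GrAlg) : Iso (A.tensor B) (B.tensor A) :=
  Iso.ofParity (commEquiv A B) (fun x => by
    induction x using tens_induction with
    | add x y hx hy => simp only [map_add, hx, hy]
    | hom i j a ha b hb =>
      rw [parity_apply _ (tens_mem ha hb), map_smul, commEquiv_tens ha hb, map_smul,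
        parity_apply _ (tens_mem hb ha), add_comm, smul_comm])

theorem Iso.comm_tens {i j : ZMod 2} {a : A.carrier} (ha : a ∈ A.grading i) {b : B.carrier}
    (hb : b ∈ B.grading j) :
    (Iso.comm A B).toEquiv (tens A B (a ⊗ₜ b)) = sgn (j * i) • tens B A (b ⊗ₜ a) :=
  commEquiv_tens ha hb

/-- Induction on homogeneous elements of graded tensor products. -/
theorem tens_induction_mem {n : ZMod 2} (p : (A.tensor B).carrier → Prop)
    {x : (A.tensor B).carrier} (hx : x ∈ (A.tensor B).grading n)
    (hom : ∀ i j, i + j = n → ∀ a ∈ A.grading i, ∀ b ∈ B.grading j, p (tens A B (a ⊗ₜ b)))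
    (add : ∀ x y, p x → p y → p (x + y)) (smul : ∀ (c : ℂ) x, p x → p (c • x)) : p x := by
  refine Submodule.span_induction (R := ℂ) (M := A.grading ᵍ⊗[ℂ] B.grading)
    (p := fun x _ => p x) ?_ ?_ (fun x y _ _ => add x y) (fun c x _ => smul c x) hx
  · rintro _ ⟨i, j, h, a, ha, b, hb, rfl⟩
    exact hom i j h a ha b hb
  · have h := hom n 0 (add_zero _) 0 (zero_mem _) 0 (zero_mem _)
    rw [TensorProduct.zero_tmul, map_zero] at h
    exact h

/-- The linear map underlying the associativity isomorphism. -/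
def assocLinear (A B C : GrAlg) :
    (A.tensor B).carrier ⊗[ℂ] C.carrier ≃ₗ[ℂ] (A.tensor (B.tensor C)).carrier :=
  (TensorProduct.congr (tens A B).symm (LinearEquiv.refl ℂ C.carrier)).trans
    ((TensorProduct.assoc ℂ A.carrier B.carrier C.carrier).trans
      ((TensorProduct.congr (LinearEquiv.refl ℂ A.carrier) (tens B C)).trans
        (tens A (B.tensor C))))

theorem assocLinear_tmul {C : GrAlg} (a : A.carrier) (b : B.carrier) (c : C.carrier) :
    assocLinear A B C (tens A B (a ⊗ₜ b) ⊗ₜ c) =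
      tens A (B.tensor C) (a ⊗ₜ tens B C (b ⊗ₜ c)) := by
  simp [assocLinear]

/-- Associativity of the graded tensor product. -/
def Iso.assoc (A B C : GrAlg) :
    Iso ((A.tensor B).tensor C) (A.tensor (B.tensor C)) :=
  Iso.ofTensor (assocLinear A B C)
    (by rw [← tens_one, assocLinear_tmul, tens_one, tens_one])
    (fun i j x hx c hc => by
      refine tens_induction_mem
        (fun x => assocLinear A B C (x ⊗ₜ c) ∈ (A.tensor (B.tensor C)).grading (i + j)) hx
        (fun k l h a ha b hb => ?_) (fun x y hx hy => ?_) (fun r x hx => ?_)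
      · rw [assocLinear_tmul, ← h, add_assoc]
        exact tens_mem ha (tens_mem hb hc)
      · rw [TensorProduct.add_tmul, map_add]; exact add_mem hx hy
      · rw [← TensorProduct.smul_tmul', map_smul]; exact Submodule.smul_mem _ _ hx)
    (fun i j k l x hx c hc y hy c' hc' => by
      refine tens_induction_mem
        (fun x => assocLinear A B C (x ⊗ₜ c) * assocLinear A B C (y ⊗ₜ c') =
          sgn (j * k) • assocLinear A B C ((x * y) ⊗ₜ (c * c'))) hx
        (fun s t h a ha b hb => ?_) (fun x x' hx hx' => ?_) (fun r x hx => ?_)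
      · refine tens_induction_mem
          (fun y => assocLinear A B C (tens A B (a ⊗ₜ b) ⊗ₜ c) * assocLinear A B C (y ⊗ₜ c') =
            sgn (j * k) • assocLinear A B C ((tens A B (a ⊗ₜ b) * y) ⊗ₜ (c * c'))) hy
          (fun s' t' h' a' ha' b' hb' => ?_) (fun y y' hy hy' => ?_) (fun r y hy => ?_)
        -- Moving `b ⊗ c` past `a'` and then `c` past `b'` costs `(t + j) s' + j t'`; moving `c`
        -- past `a' ⊗ b'` and then `b` past `a'` costs `j (s' + t') + t s'`, the same exponent.
        · rw [assocLinear_tmul, assocLinear_tmul, tens_mul _ (tens_mem hb hc) ha',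
            tens_mul _ hc hb', tens_mul _ hb ha', ← TensorProduct.smul_tmul', map_smul,
            assocLinear_tmul, TensorProduct.tmul_smul, map_smul, smul_smul, smul_smul, ← sgn_add,
            ← sgn_add, ← h']
          congr 2
          ring
        · rw [TensorProduct.add_tmul, map_add, mul_add, mul_add, TensorProduct.add_tmul, map_add,
            smul_add, hy, hy']
        · rw [← TensorProduct.smul_tmul', map_smul, mul_smul_comm, hy, mul_smul_comm,
            ← TensorProduct.smul_tmul', map_smul, smul_comm]
      · rw [TensorProduct.add_tmul, map_add, add_mul, add_mul, TensorProduct.add_tmul, map_add,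
          smul_add, hx, hx']
      · rw [← TensorProduct.smul_tmul', map_smul, smul_mul_assoc, hx, smul_mul_assoc,
          ← TensorProduct.smul_tmul', map_smul, smul_comm])

theorem Iso.assoc_tens {C : GrAlg} (a : A.carrier) (b : B.carrier) (c : C.carrier) :
    (Iso.assoc A B C).toEquiv (tens (A.tensor B) C (tens A B (a ⊗ₜ b) ⊗ₜ c)) =
      tens A (B.tensor C) (a ⊗ₜ tens B C (b ⊗ₜ c)) :=
  assocLinear_tmul a b c

end Tensor

end GrAlg

/-! ### Isomorphisms of magnetic equivariant graded algebras -/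

namespace MagAlg

variable {G : Type} [Group G] {φ : G →* Multiplicative (ZMod 2)}

theorem τ_tens (A B : MagAlg φ) (g : G) (a : A.carrier) (b : B.carrier) :
    (A.tensor B).τ g (GrAlg.tens A.toGrAlg B.toGrAlg (a ⊗ₜ b)) =
      GrAlg.tens A.toGrAlg B.toGrAlg (A.τ g a ⊗ₜ B.τ g b) := rfl

theorem tens_induction {A B : MagAlg φ} {p : (A.tensor B).carrier → Prop} (x : (A.tensor B).carrier)
    (hom : ∀ i j, ∀ a ∈ A.grading i, ∀ b ∈ B.grading j,
      p (GrAlg.tens A.toGrAlg B.toGrAlg (a ⊗ₜ b)))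
    (add : ∀ x y, p x → p y → p (x + y)) : p x :=
  GrAlg.tens_induction (A := A.toGrAlg) (B := B.toGrAlg) x hom add

namespace Iso

variable {A B C : MagAlg φ}

/-- The identity. -/
def refl (A : MagAlg φ) : Iso A A := ⟨GrAlg.Iso.refl _, fun _ _ => rfl⟩

/-- The inverse isomorphism. -/
def symm (e : Iso A B) : Iso B A :=
  ⟨e.toIso.symm, fun g b => by
    refine e.toEquiv.injective ?_
    change e.toEquiv (e.toEquiv.symm _) = e.toEquiv (A.τ g (e.toEquiv.symm b))
    rw [e.map_τ, AlgEquiv.apply_symm_apply, AlgEquiv.apply_symm_apply]⟩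

/-- The composition of isomorphisms. -/
def trans (e : Iso A B) (f : Iso B C) : Iso A C :=
  ⟨e.toIso.trans f.toIso, fun g a =>
    (congrArg f.toEquiv (e.map_τ g a)).trans (f.map_τ g _)⟩

/-- A graded isomorphism out of a tensor product is equivariant if it is so on homogeneous
tensors. -/
def ofTensor (e : GrAlg.Iso (A.toGrAlg.tensor B.toGrAlg) C.toGrAlg)
    (h : ∀ g i j, ∀ a ∈ A.grading i, ∀ b ∈ B.grading j,
      e.toEquiv (GrAlg.tens A.toGrAlg B.toGrAlg (A.τ g a ⊗ₜ B.τ g b)) =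
        C.τ g (e.toEquiv (GrAlg.tens A.toGrAlg B.toGrAlg (a ⊗ₜ b)))) :
    Iso (A.tensor B) C :=
  ⟨e, fun g x => by
    induction x using tens_induction with
    | hom i j a ha b hb => exact h g i j a ha b hb
    | add x y hx hy =>
      rw [map_add, map_add, hx, hy]
      exact (map_add (C.τ g) _ _).symm.trans (congrArg _ (map_add e.toEquiv x y).symm)⟩

/-- Congruence for the graded tensor product. -/
def tensor {A' B' : MagAlg φ} (e : Iso A A') (f : Iso B B') : Iso (A.tensor B) (A'.tensor B') :=
  ofTensor (C := A'.tensor B') (e.toIso.tensor f.toIso) (fun g i j a _ b _ => by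
    refine (GrAlg.Iso.tensor_tens e.toIso f.toIso _ _).trans ?_
    rw [e.map_τ, f.map_τ]
    rfl)

/-- The graded swap. -/
def comm (A B : MagAlg φ) : Iso (A.tensor B) (B.tensor A) :=
  ofTensor (C := B.tensor A) (GrAlg.Iso.comm A.toGrAlg B.toGrAlg) (fun g i j a ha b hb => by
    refine (GrAlg.Iso.comm_tens (A.τ_mem g i a ha) (B.τ_mem g j b hb)).trans ?_
    refine Eq.trans ?_ (congrArg ((B.tensor A).τ g) (GrAlg.Iso.comm_tens ha hb).symm)
    refine Eq.trans ?_ ((B.tensor A).τ_smul g _ _).symm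
    rw [conjPow_sgn]
    rfl)

/-- Associativity of the graded tensor product. -/
def assoc (A B C : MagAlg φ) : Iso ((A.tensor B).tensor C) (A.tensor (B.tensor C)) :=
  ofTensor (A := A.tensor B) (C := A.tensor (B.tensor C))
    (GrAlg.Iso.assoc A.toGrAlg B.toGrAlg C.toGrAlg) (fun g i j x hx c _ => by
    clear hx
    induction x using tens_induction with
    | add x y hx hy =>
      rw [map_add, TensorProduct.add_tmul, TensorProduct.add_tmul, map_add, map_add, map_add, hx,
        hy]
      refine ((map_add ((A.tensor (B.tensor C)).τ g) _ _).symm).trans ?_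
      exact congrArg _ (map_add _ _ _).symm
    | hom i j a ha b hb =>
      rw [τ_tens]
      refine (GrAlg.Iso.assoc_tens _ _ _).trans ?_
      refine Eq.trans ?_ (congrArg _ (GrAlg.Iso.assoc_tens _ _ _).symm)
      rfl)

end Iso

end MagAlg

/-! ### Twisted units -/

namespace TwistedUnits

variable {G : Type} [Group G] {φ : G →* Multiplicative (ZMod 2)}

theorem val_injective : Function.Injective (val (φ := φ)) := fun _ _ h => Units.ext h

theorem val_one : (1 : TwistedUnits φ).val = 1 := rfl

theorem val_mul (u v : TwistedUnits φ) : (u * v).val = u.val * v.val := rfl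

theorem val_smul (g : G) (u : TwistedUnits φ) : (g • u).val = conjPow (φ g) u.val := rfl

theorem val_ne_zero (u : TwistedUnits φ) : u.val ≠ 0 := Units.ne_zero (M₀ := ℂ) u

/-- A nonzero complex number as a twisted unit. -/
def mk0 (z : ℂ) (hz : z ≠ 0) : TwistedUnits φ := Units.mk0 z hz

theorem val_mk0 (z : ℂ) (hz : z ≠ 0) : (mk0 (φ := φ) z hz).val = z := rfl

/-- The sign `(-1)^d` as a twisted unit. -/
def sign (d : ZMod 2) : TwistedUnits φ := mk0 (sgn d) (sgn_ne_zero d)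

theorem val_sign (d : ZMod 2) : (sign (φ := φ) d).val = sgn d := rfl

theorem sign_zero : sign (φ := φ) 0 = 1 := val_injective sgn_zero

theorem sign_mul_self (d : ZMod 2) : sign (φ := φ) d * sign d = 1 := val_injective (sgn_mul_self d)

theorem sign_inv (d : ZMod 2) : (sign (φ := φ) d)⁻¹ = sign d :=
  inv_eq_of_mul_eq_one_left (sign_mul_self d)

end TwistedUnits

/-! ### Super vector spaces -/

/-- A nonzero finite dimensional complex vector space with an involution. -/
structure SSpace extends FDSpace where
  P : Module.End ℂ carrier
  P_sq : P * P = 1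
  nontriv : Nontrivial carrier

attribute [instance] SSpace.nontriv

namespace SSpace

variable (V W : SSpace)

theorem P_P (v : V.carrier) : V.P (V.P v) = v := LinearMap.congr_fun V.P_sq v

/-- The powers of the parity operator. -/
def pw (d : ZMod 2) : Module.End ℂ V.carrier := if d = 0 then 1 else V.P

theorem pw_zero : V.pw 0 = 1 := if_pos rfl

theorem pw_one : V.pw 1 = V.P := if_neg one_ne_zero

theorem pw_add (d e : ZMod 2) : V.pw (d + e) = V.pw d * V.pw e := by
  have h : (1 : ZMod 2) + 1 = 0 := by decide
  rcases zmod_two_cases d with rfl | rfl <;> rcases zmod_two_cases e with rfl | rfl <;>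
    simp [pw_zero, pw_one, h, V.P_sq]

theorem pw_mul_self (d : ZMod 2) : V.pw d * V.pw d = 1 := by
  rw [← pw_add, CharTwo.add_self_eq_zero, pw_zero]

theorem pw_pw (d : ZMod 2) (v : V.carrier) : V.pw d (V.pw d v) = v :=
  LinearMap.congr_fun (V.pw_mul_self d) v

theorem pw_P (d : ZMod 2) (v : V.carrier) : V.pw d (V.P v) = V.P (V.pw d v) := by
  rw [← pw_one, ← Module.End.mul_apply, ← Module.End.mul_apply, ← pw_add, ← pw_add, add_comm]

/-- The powers of the parity operator as linear automorphisms. -/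
def pwEquiv (d : ZMod 2) : V.carrier ≃ₗ[ℂ] V.carrier :=
  LinearEquiv.ofInvolutive (V.pw d) (V.pw_pw d)

/-- Conjugation with the parity operator. -/
def conjP : Module.End ℂ V.carrier →ₐ[ℂ] Module.End ℂ V.carrier :=
  AlgHom.ofLinearMap (LinearMap.mulLeft ℂ V.P ∘ₗ LinearMap.mulRight ℂ V.P)
    (by simp [V.P_sq])
    (fun f g => by
      simp only [LinearMap.comp_apply, LinearMap.mulRight_apply, LinearMap.mulLeft_apply]
      calc V.P * (f * g * V.P) = V.P * f * 1 * (g * V.P) := by simp only [mul_assoc, one_mul]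
        _ = V.P * (f * V.P) * (V.P * (g * V.P)) := by rw [← V.P_sq]; simp only [mul_assoc])

theorem conjP_apply (f : Module.End ℂ V.carrier) : V.conjP f = V.P * (f * V.P) := rfl

theorem conjP_conjP (f : Module.End ℂ V.carrier) : V.conjP (V.conjP f) = f := by
  rw [conjP_apply, conjP_apply]
  calc V.P * (V.P * (f * V.P) * V.P) = (V.P * V.P) * f * (V.P * V.P) := by simp only [mul_assoc]
    _ = f := by rw [V.P_sq, one_mul, mul_one]

/-- The graded algebra of endomorphisms of a super vector space. -/
abbrev alg : GrAlg := GrAlg.ofParity (Module.End ℂ V.carrier) V.conjP V.conjP_conjP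

theorem alg_parity (f : Module.End ℂ V.carrier) : V.alg.parity f = V.P * (f * V.P) :=
  GrAlg.ofParity_parity f

variable {V W} in
theorem P_mul_of_mem {j : ZMod 2} {f : Module.End ℂ V.carrier} (hf : f ∈ V.alg.grading j) :
    V.P * f = sgn j • (f * V.P) := by
  have h : V.conjP f = sgn j • f := (GrAlg.mem_ofParity_iff (A := Module.End ℂ V.carrier)).1 hf
  rw [← smul_mul_assoc, ← h, conjP_apply]
  simp only [mul_assoc, V.P_sq, mul_one]

variable {V W} in
theorem mem_alg_iff {j : ZMod 2} {f : Module.End ℂ V.carrier} :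
    f ∈ V.alg.grading j ↔ V.P * f = sgn j • (f * V.P) := by
  refine ⟨P_mul_of_mem, fun h => (GrAlg.mem_ofParity_iff (A := Module.End ℂ V.carrier)).2 ?_⟩
  rw [conjP_apply, ← mul_assoc, h, smul_mul_assoc, mul_assoc, V.P_sq, mul_one]

variable {V W} in
theorem pw_mul_of_mem {j : ZMod 2} {f : Module.End ℂ V.carrier} (hf : f ∈ V.alg.grading j)
    (d : ZMod 2) : V.pw d * f = sgn (d * j) • (f * V.pw d) := by
  rcases zmod_two_cases d with rfl | rfl
  · rw [zero_mul, sgn_zero, one_smul, pw_zero, one_mul, mul_one]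
  · rw [one_mul, pw_one, P_mul_of_mem hf]

theorem pw_mem (d : ZMod 2) : V.pw d ∈ V.alg.grading 0 := by
  rw [mem_alg_iff, sgn_zero, one_smul, ← pw_one, ← pw_add, ← pw_add, add_comm]

/-- The tensor product of super vector spaces. -/
abbrev tensor : SSpace where
  carrier := V.carrier ⊗[ℂ] W.carrier
  P := TensorProduct.map V.P W.P
  P_sq := by
    rw [← TensorProduct.map_mul, V.P_sq, W.P_sq, TensorProduct.map_one]
  nontriv := inferInstance

/-- The linear automorphism `a ⊗ b ↦ a P^∂b ⊗ b` of `End V ⊗ End W`. -/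
def twist : Module.End ℂ V.carrier ⊗[ℂ] Module.End ℂ W.carrier →ₗ[ℂ]
    Module.End ℂ V.carrier ⊗[ℂ] Module.End ℂ W.carrier :=
  -- The maps `(1 ± conjP) / 2` project `End W` to its even and odd parts, which makes the
  -- degree-dependent formula linear on the whole tensor product.
  (1 / 2 : ℂ) • (TensorProduct.map LinearMap.id (LinearMap.id + W.conjP.toLinearMap) +
    TensorProduct.map (LinearMap.mulRight ℂ V.P) (LinearMap.id - W.conjP.toLinearMap))

variable {V W} in
theorem twist_tmul (a : Module.End ℂ V.carrier) {j : ZMod 2} {b : Module.End ℂ W.carrier}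
    (hb : b ∈ W.alg.grading j) : twist V W (a ⊗ₜ b) = (a * V.pw j) ⊗ₜ b := by
  have h : W.conjP b = sgn j • b := (GrAlg.mem_ofParity_iff (A := Module.End ℂ W.carrier)).1 hb
  simp only [twist, LinearMap.smul_apply, LinearMap.add_apply, TensorProduct.map_tmul,
    LinearMap.id_apply, LinearMap.sub_apply, AlgHom.toLinearMap_apply, h, LinearMap.mulRight_apply]
  rcases zmod_two_cases j with rfl | rfl
  · rw [sgn_zero, one_smul, sub_self, TensorProduct.tmul_zero, add_zero, ← two_smul ℂ b,
      TensorProduct.tmul_smul, smul_smul, pw_zero, mul_one]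
    norm_num
  · rw [sgn_one, neg_one_smul, add_neg_cancel, TensorProduct.tmul_zero, zero_add, sub_neg_eq_add,
      ← two_smul ℂ b, TensorProduct.tmul_smul, smul_smul, pw_one]
    norm_num

/-- `P² = 1`, so the twist is its own inverse; this supplies bijectivity of the map to `End (V ⊗
W)`. -/
theorem twist_twist (x) : twist V W (twist V W x) = x := by
  induction x using TensorProduct.induction_on with
  | zero => simp
  | add x y hx hy => rw [map_add, map_add, hx, hy]
  | tmul a b =>
    induction b using W.alg.homogeneous_induction with
    | add x y hx hy => rw [TensorProduct.tmul_add, map_add, map_add, hx, hy]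
    | hom j b hb => rw [twist_tmul a hb, twist_tmul _ hb, mul_assoc, pw_mul_self, mul_one]

/-- The linear isomorphism `a ⊗ b ↦ a P^∂b ⊗ b` from `End V ⊗ End W` to `End (V ⊗ W)`. -/
def tensorLinear : V.alg.carrier ⊗[ℂ] W.alg.carrier ≃ₗ[ℂ] (V.tensor W).alg.carrier :=
  (LinearEquiv.ofInvolutive (twist V W) (twist_twist V W)).trans
    (homTensorHomEquiv ℂ V.carrier W.carrier V.carrier W.carrier)

variable {V W} in
theorem tensorLinear_tmul (a : Module.End ℂ V.carrier) {j : ZMod 2} {b : Module.End ℂ W.carrier}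
    (hb : b ∈ W.alg.grading j) :
    tensorLinear V W (a ⊗ₜ b) = TensorProduct.map (a * V.pw j) b := by
  change homTensorHomEquiv ℂ V.carrier W.carrier V.carrier W.carrier (twist V W (a ⊗ₜ b)) = _
  rw [twist_tmul a hb, homTensorHomEquiv_apply, TensorProduct.homTensorHomMap_apply]

/-- `End V ⊗ End W ≅ End (V ⊗ W)`. -/
def algTensor : GrAlg.Iso (V.alg.tensor W.alg) (V.tensor W).alg :=
  GrAlg.Iso.ofTensor (tensorLinear V W)
    (by
      refine (tensorLinear_tmul 1 W.alg.one_mem).trans ?_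
      rw [pw_zero, mul_one]
      exact TensorProduct.map_one)
    (fun i j (a : Module.End ℂ V.carrier) ha (b : Module.End ℂ W.carrier) hb => by
      refine mem_alg_iff.2 ?_
      have hP : V.P * (a * V.pw j) = sgn i • ((a * V.pw j) * V.P) := by
        rw [← mul_assoc, P_mul_of_mem ha, smul_mul_assoc, mul_assoc, mul_assoc, ← pw_one, ← pw_add,
          ← pw_add, add_comm]
      rw [tensorLinear_tmul a hb]
      refine (TensorProduct.map_mul _ _ _ _).symm.trans ?_
      rw [hP, P_mul_of_mem hb, TensorProduct.map_smul_left, TensorProduct.map_smul_right, smul_smul,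
        ← sgn_add]
      exact congrArg _ (TensorProduct.map_mul _ _ _ _))
    (fun i j k l (a : Module.End ℂ V.carrier) ha (b : Module.End ℂ W.carrier) hb
        (c : Module.End ℂ V.carrier) hc (d : Module.End ℂ W.carrier) hd => by
      have hbd : b * d ∈ W.alg.grading (j + l) := GrAlg.mul_mem hb hd
      refine (congrArg₂ (· * ·) (tensorLinear_tmul a hb) (tensorLinear_tmul c hd)).trans ?_
      refine ((TensorProduct.map_mul _ _ _ _).symm).trans ?_
      refine Eq.trans ?_ (congrArg (sgn (j * k) • ·) (tensorLinear_tmul (a * c) hbd).symm)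
      -- Moving `P^∂b` past `c` produces exactly the Koszul sign of the graded tensor product.
      have h : (a * V.pw j) * (c * V.pw l) = sgn (j * k) • (a * c * V.pw (j + l)) := by
        rw [mul_assoc, ← mul_assoc (V.pw j), pw_mul_of_mem hc, smul_mul_assoc, mul_smul_comm, pw_add]
        simp only [mul_assoc]
      refine (congrArg (fun z => TensorProduct.map z (b * d)) h).trans ?_
      exact TensorProduct.map_smul_left _ _ _)

variable {V W} in
theorem algTensor_tens (a : Module.End ℂ V.carrier) {j : ZMod 2} {b : Module.End ℂ W.carrier}
    (hb : b ∈ W.alg.grading j) :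
    (algTensor V W).toEquiv (GrAlg.tens V.alg W.alg (a ⊗ₜ b)) =
      TensorProduct.map (a * V.pw j) b :=
  tensorLinear_tmul a hb

end SSpace

/-! ### Semilinear automorphisms -/

section Semilinear

variable {d : Multiplicative (ZMod 2)} {V W : Type} [AddCommGroup V] [Module ℂ V] [AddCommGroup W]
  [Module ℂ W]

theorem symm_semilinear {T : V ≃+ W} (hT : ∀ (c : ℂ) v, T (c • v) = conjPow d c • T v) (c : ℂ)
    (v : W) : T.symm (c • v) = conjPow d c • T.symm v := by
  rw [AddEquiv.symm_apply_eq, hT, AddEquiv.apply_symm_apply, conjPow_conjPow]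

/-- Conjugation of an endomorphism by a semilinear automorphism. -/
def conjSemi (T : V ≃+ W) (hT : ∀ (c : ℂ) v, T (c • v) = conjPow d c • T v) :
    Module.End ℂ V ≃+* Module.End ℂ W where
  toFun f :=
    { toFun v := T (f (T.symm v))
      map_add' v w := by simp only [map_add]
      map_smul' c v := by
        rw [symm_semilinear hT, map_smul, hT, conjPow_conjPow, RingHom.id_apply] }
  invFun f :=
    { toFun v := T.symm (f (T v))
      map_add' v w := by simp only [map_add]
      map_smul' c v := by
        rw [hT, map_smul, symm_semilinear hT, conjPow_conjPow, RingHom.id_apply] }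
  left_inv f := LinearMap.ext fun v => by simp
  right_inv f := LinearMap.ext fun v => by simp
  map_mul' f g := LinearMap.ext fun v => by simp
  map_add' f g := LinearMap.ext fun v => by simp

theorem conjSemi_apply (T : V ≃+ W) (hT : ∀ (c : ℂ) v, T (c • v) = conjPow d c • T v)
    (f : Module.End ℂ V) (v : W) : conjSemi T hT f v = T (f (T.symm v)) := rfl

/-- An additive automorphism satisfying the rule for scalars as a semilinear map. -/
def semi (T : V ≃+ V) (hT : ∀ (c : ℂ) v, T (c • v) = conjPow d c • T v) : V →ₛₗ[conjPow d] V where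
  toFun := T
  map_add' := map_add T
  map_smul' := hT

/-- The tensor product of two semilinear automorphisms. -/
def tensorSemi (T : V ≃+ V) (hT : ∀ (c : ℂ) v, T (c • v) = conjPow d c • T v) (S : W ≃+ W)
    (hS : ∀ (c : ℂ) v, S (c • v) = conjPow d c • S v) : (V ⊗[ℂ] W) ≃+ (V ⊗[ℂ] W) where
  toFun := TensorProduct.map (semi T hT) (semi S hS)
  invFun := TensorProduct.map (semi T.symm (symm_semilinear hT)) (semi S.symm (symm_semilinear hS))
  left_inv x := by
    induction x using TensorProduct.induction_on with
    | zero => simp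
    | add x y hx hy => rw [map_add, map_add, hx, hy]
    | tmul v w => rw [TensorProduct.map_tmul, TensorProduct.map_tmul]; simp [semi]
  right_inv x := by
    induction x using TensorProduct.induction_on with
    | zero => simp
    | add x y hx hy => rw [map_add, map_add, hx, hy]
    | tmul v w => rw [TensorProduct.map_tmul, TensorProduct.map_tmul]; simp [semi]
  map_add' x y := map_add _ x y

theorem tensorSemi_smul (T : V ≃+ V) (hT : ∀ (c : ℂ) v, T (c • v) = conjPow d c • T v) (S : W ≃+ W)
    (hS : ∀ (c : ℂ) v, S (c • v) = conjPow d c • S v) (c : ℂ) (x : V ⊗[ℂ] W) :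
    tensorSemi T hT S hS (c • x) = conjPow d c • tensorSemi T hT S hS x :=
  map_smulₛₗ (TensorProduct.map (semi T hT) (semi S hS)) c x

end Semilinear

/-! ### Projective representations -/

variable {G : Type} [Group G] {φ : G →* Multiplicative (ZMod 2)}

/-- A projective magnetic representation on a super vector space, whose operators are
homogeneous. -/
structure ProjRep (φ : G →* Multiplicative (ZMod 2)) extends SSpace where
  T : G → carrier ≃+ carrier
  T_smul : ∀ g (c : ℂ) v, T g (c • v) = conjPow (φ g) c • T g v
  deg : Additive G →+ ZMod 2
  T_P : ∀ g v, T g (P v) = sgn (deg (Additive.ofMul g)) • P (T g v)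
  c : G × G → TwistedUnits φ
  T_mul : ∀ g h v, T g (T h v) = (c (g, h)).val • T (g * h) v

namespace ProjRep

variable (R S : ProjRep φ)

/-- Associativity of `T_g T_h T_k`: pulling the scalar `c(h,k)` out of `T_g` conjugates it according
to `φ g`, which is the action on `ℂ^*_φ`. -/
theorem isMulCocycle₂ : groupCohomology.IsMulCocycle₂ R.c := by
  intro g h k
  obtain ⟨v, hv⟩ := exists_ne (0 : R.carrier)
  have e := R.T_mul g h (R.T k v)
  rw [R.T_mul h k, R.T_smul, R.T_mul, R.T_mul, smul_smul, smul_smul, ← mul_assoc g h k] at e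
  have h0 : R.T (g * h * k) v ≠ 0 := fun h => hv ((map_eq_zero_iff _ (R.T _).injective).1 h)
  refine TwistedUnits.val_injective ?_
  rw [TwistedUnits.val_mul, TwistedUnits.val_mul, TwistedUnits.val_smul,
    smul_left_injective ℂ h0 e, mul_comm]

theorem T_pw (g : G) (d : ZMod 2) (v : R.carrier) :
    R.T g (R.pw d v) = sgn (R.deg (Additive.ofMul g) * d) • R.pw d (R.T g v) := by
  rcases zmod_two_cases d with rfl | rfl
  · simp [SSpace.pw_zero, sgn_zero]
  · rw [SSpace.pw_one, R.T_P, mul_one]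

/-- Conjugation by the operator of a group element. -/
def conj (g : G) : Module.End ℂ R.carrier ≃+* Module.End ℂ R.carrier :=
  conjSemi (R.T g) (R.T_smul g)

theorem conj_apply (g : G) (f : Module.End ℂ R.carrier) (v : R.carrier) :
    R.conj g f v = R.T g (f ((R.T g).symm v)) := rfl

theorem conj_apply_T (g : G) (f : Module.End ℂ R.carrier) (v : R.carrier) :
    R.conj g f (R.T g v) = R.T g (f v) := by
  rw [conj_apply, AddEquiv.symm_apply_apply]

theorem conj_eq_iff (g : G) (f f' : Module.End ℂ R.carrier) :
    R.conj g f = f' ↔ ∀ v, f' (R.T g v) = R.T g (f v) := by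
  refine ⟨fun h v => by rw [← h, conj_apply_T], fun h => LinearMap.ext fun v => ?_⟩
  rw [conj_apply, ← h, AddEquiv.apply_symm_apply]

theorem conj_smul (g : G) (c : ℂ) (f : Module.End ℂ R.carrier) :
    R.conj g (c • f) = conjPow (φ g) c • R.conj g f :=
  LinearMap.ext fun _ => R.T_smul g c _

/-- The scalar `c(g,h)` cancels in a conjugation, so a projective representation still gives an
honest action on endomorphisms. -/
theorem conj_mul (g h : G) (f : Module.End ℂ R.carrier) :
    R.conj (g * h) f = R.conj g (R.conj h f) := by
  rw [conj_eq_iff]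
  intro v
  have e := R.conj_apply_T g (R.conj h f) (R.T h v)
  rw [R.conj_apply_T h, R.T_mul, R.T_mul, map_smul] at e
  exact smul_right_injective _ (TwistedUnits.val_ne_zero _) e

/-- The cocycle is not normalized, so `T 1` is only a scalar multiple of the identity; `conj 1` is
nevertheless idempotent and injective. -/
theorem conj_one (f : Module.End ℂ R.carrier) : R.conj 1 f = f :=
  (R.conj 1).injective (by rw [← conj_mul, one_mul])

theorem conj_P (g : G) : R.conj g R.P = sgn (R.deg (Additive.ofMul g)) • R.P := by
  rw [conj_eq_iff]
  intro v
  rw [LinearMap.smul_apply, R.T_P]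

/-- The magnetic equivariant graded algebra of endomorphisms of a projective representation. -/
def alg : MagAlg φ where
  toGrAlg := R.toSSpace.alg
  τ :=
    { toFun g := R.conj g
      map_one' := RingEquiv.ext R.conj_one
      map_mul' g h := RingEquiv.ext (R.conj_mul g h) }
  τ_smul := R.conj_smul
  τ_mem g i (a : Module.End ℂ R.carrier) ha := by
    refine SSpace.mem_alg_iff.2 ?_
    -- Conjugating `P a = ± a P` by `T_g` turns `P` into `± P` on both sides, and this second sign
    -- cancels.
    have h := congrArg (R.conj g) (SSpace.P_mul_of_mem ha)
    rw [map_mul, conj_smul, map_mul, conj_P, conjPow_sgn, smul_mul_assoc, mul_smul_comm,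
      smul_comm] at h
    exact smul_right_injective _ (sgn_ne_zero _) h

/-- The operator `S_g Q^d`. -/
def twisted (g : G) (d : ZMod 2) : R.carrier ≃+ R.carrier :=
  (R.pwEquiv d).toAddEquiv.trans (R.T g)

theorem twisted_apply (g : G) (d : ZMod 2) (v : R.carrier) :
    R.twisted g d v = R.T g (R.pw d v) := rfl

theorem twisted_smul (g : G) (d : ZMod 2) (c : ℂ) (v : R.carrier) :
    R.twisted g d (c • v) = conjPow (φ g) c • R.twisted g d v := by
  rw [twisted_apply, map_smul, R.T_smul, twisted_apply]

/-- The operators `T_g ⊗ S_g Q^∂(T_g)`. -/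
def tensorT (g : G) : (R.carrier ⊗[ℂ] S.carrier) ≃+ (R.carrier ⊗[ℂ] S.carrier) :=
  tensorSemi (R.T g) (R.T_smul g) (S.twisted g (R.deg (Additive.ofMul g))) (S.twisted_smul g _)

theorem tensorT_tmul (g : G) (v : R.carrier) (w : S.carrier) :
    tensorT R S g (v ⊗ₜ w) = R.T g v ⊗ₜ S.T g (S.pw (R.deg (Additive.ofMul g)) w) := rfl

theorem tensorT_smul (g : G) (c : ℂ) (x : R.carrier ⊗[ℂ] S.carrier) :
    tensorT R S g (c • x) = conjPow (φ g) c • tensorT R S g x :=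
  tensorSemi_smul _ (R.T_smul g) _ (S.twisted_smul g _) c x

theorem tensorT_P (g : G) (x : R.carrier ⊗[ℂ] S.carrier) :
    tensorT R S g (TensorProduct.map R.P S.P x) = sgn ((R.deg + S.deg) (Additive.ofMul g)) •
      TensorProduct.map R.P S.P (tensorT R S g x) := by
  induction x using TensorProduct.induction_on with
  | zero => simp
  | add x y hx hy => simp only [map_add, smul_add, hx, hy]
  | tmul v w =>
    rw [TensorProduct.map_tmul, tensorT_tmul, tensorT_tmul, TensorProduct.map_tmul, R.T_P,
      S.pw_P, S.T_P, AddMonoidHom.add_apply, sgn_add, TensorProduct.smul_tmul_smul]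

/-- In the product of the operators of `g` and `h`, the power of `Q` (the parity of `S`) attached to
`g` has to pass the operator `S_h`; this creates the sign `(-1)^{deg_R(g) deg_S(h)}`. -/
theorem tensorT_mul (g h : G) (x : R.carrier ⊗[ℂ] S.carrier) :
    tensorT R S g (tensorT R S h x) = (R.c (g, h) * S.c (g, h) *
      TwistedUnits.sign (R.deg (Additive.ofMul g) * S.deg (Additive.ofMul h))).val •
      tensorT R S (g * h) x := by
  induction x using TensorProduct.induction_on with
  | zero => simp
  | add x y hx hy => simp only [map_add, smul_add, hx, hy]
  | tmul v w =>
    have h1 : S.pw (R.deg (Additive.ofMul g)) (S.T h (S.pw (R.deg (Additive.ofMul h)) w)) =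
        sgn (R.deg (Additive.ofMul g) * S.deg (Additive.ofMul h)) •
          S.T h (S.pw (R.deg (Additive.ofMul (g * h))) w) := by
      rw [ofMul_mul, map_add, SSpace.pw_add, Module.End.mul_apply,
        S.T_pw h (R.deg (Additive.ofMul g)), smul_smul,
        mul_comm (S.deg _), sgn_mul_self, one_smul]
    rw [tensorT_tmul, tensorT_tmul, tensorT_tmul, h1, S.T_smul, conjPow_sgn, R.T_mul, S.T_mul,
      smul_smul, TensorProduct.smul_tmul_smul, TwistedUnits.val_mul, TwistedUnits.val_mul,
      TwistedUnits.val_sign]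
    congr 1
    ring

/-- The tensor product of projective representations on super vector spaces. -/
abbrev tensor : ProjRep φ where
  toSSpace := R.toSSpace.tensor S.toSSpace
  T := tensorT R S
  T_smul := tensorT_smul R S
  deg := R.deg + S.deg
  T_P := tensorT_P R S
  c p := R.c p * S.c p *
    TwistedUnits.sign (R.deg (Additive.ofMul p.1) * S.deg (Additive.ofMul p.2))
  T_mul := tensorT_mul R S

theorem tensor_T_tmul (g : G) (v : R.carrier) (w : S.carrier) :
    (R.tensor S).T g (v ⊗ₜ w) = R.T g v ⊗ₜ S.T g (S.pw (R.deg (Additive.ofMul g)) w) := rfl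

theorem tensor_c (p : G × G) : (R.tensor S).c p = R.c p * S.c p *
    TwistedUnits.sign (R.deg (Additive.ofMul p.1) * S.deg (Additive.ofMul p.2)) := rfl

theorem tensor_deg : (R.tensor S).deg = R.deg + S.deg := rfl

/-- Two equal signs cancel: `T_g` passing `P^j` on the left factor, and `Q^∂(T_g)` passing `b` on
the right factor. This is the reason for the power of `Q` in `tensorT`. -/
theorem conj_tensor (g : G) (a : Module.End ℂ R.carrier) {j : ZMod 2} {b : Module.End ℂ S.carrier}
    (hb : b ∈ S.toSSpace.alg.grading j) :
    (R.tensor S).conj g (TensorProduct.map (a * R.pw j) b) =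
      TensorProduct.map (R.conj g a * R.pw j) (S.conj g b) := by
  rw [conj_eq_iff]
  intro x
  induction x using TensorProduct.induction_on with
  | zero => simp
  | add x y hx hy => simp only [map_add, hx, hy]
  | tmul v w =>
    have h1 : R.pw j (R.T g v) = sgn (R.deg (Additive.ofMul g) * j) • R.T g (R.pw j v) := by
      rw [R.T_pw, smul_smul, sgn_mul_self, one_smul]
    have h2 := LinearMap.congr_fun (SSpace.pw_mul_of_mem hb (R.deg (Additive.ofMul g))) w
    rw [Module.End.mul_apply, LinearMap.smul_apply, Module.End.mul_apply] at h2
    rw [tensor_T_tmul, TensorProduct.map_tmul, TensorProduct.map_tmul, tensor_T_tmul,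
      Module.End.mul_apply, Module.End.mul_apply, h1, map_smul, conj_apply_T, conj_apply_T, h2,
      S.T_smul, conjPow_sgn, TensorProduct.tmul_smul, TensorProduct.smul_tmul']

/-- `End R ⊗ End S ≅ End (R ⊗ S)`. -/
def algTensor : MagAlg.Iso (R.alg.tensor S.alg) (R.tensor S).alg :=
  MagAlg.Iso.ofTensor (C := (R.tensor S).alg) (SSpace.algTensor R.toSSpace S.toSSpace)
    (fun g i j a ha b hb => by
      refine (SSpace.algTensor_tens _ (S.alg.τ_mem g j b hb)).trans ?_
      refine (conj_tensor R S g a hb).symm.trans ?_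
      exact (congrArg ((R.tensor S).alg.τ g) (SSpace.algTensor_tens a hb)).symm)

end ProjRep

namespace GrAlg

/-! ### Central simple graded algebras in terms of the parity operator -/

section

variable (A : GrAlg)

theorem decompose_eq (a : A.carrier) (i : ZMod 2) :
    ((DirectSum.decompose A.grading a i : A.grading i) : A.carrier) =
      (1 / 2 : ℂ) • (a + sgn i • A.parity a) := by
  induction a using A.homogeneous_induction with
  | add x y hx hy =>
    rw [DirectSum.decompose_add, DirectSum.add_apply, Submodule.coe_add, hx, hy, map_add, ← smul_add,
      smul_add (sgn i)]
    congr 1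
    abel
  | hom j a ha =>
    rw [A.parity_apply ha, smul_smul]
    by_cases h : j = i
    · subst h
      rw [DirectSum.decompose_of_mem_same _ ha, sgn_mul_self, one_smul, ← two_smul ℂ a, smul_smul]
      norm_num
    · rw [DirectSum.decompose_of_mem_ne _ ha h]
      have : sgn i * sgn j = -1 := by
        rcases zmod_two_cases i with rfl | rfl <;> rcases zmod_two_cases j with rfl | rfl <;>
          simp [sgn_zero, sgn_one] at h ⊢
      rw [this, neg_one_smul, add_neg_cancel, smul_zero]

/-- The homogeneous components of `x` are `(x ± P x) / 2`, so they stay in an ideal exactly when `P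
x` does. -/
theorem isHomogeneous_iff (I : Ideal A.carrier) :
    I.IsHomogeneous A.grading ↔ ∀ x ∈ I, A.parity x ∈ I := by
  have hsmul : ∀ (c : ℂ), ∀ x ∈ I, c • x ∈ I := fun c x hx => by
    rw [Algebra.smul_def]; exact I.mul_mem_left _ hx
  constructor
  · intro h x hx
    have h0 := h 0 hx
    have h1 := h 1 hx
    rw [decompose_eq] at h0 h1
    have e : A.parity x = (1 / 2 : ℂ) • (x + sgn 0 • A.parity x) -
        (1 / 2 : ℂ) • (x + sgn 1 • A.parity x) := by
      rw [sgn_zero, sgn_one, one_smul, neg_one_smul, ← smul_sub,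
        show x + A.parity x - (x + -A.parity x) = (2 : ℂ) • A.parity x by rw [two_smul]; abel,
        smul_smul]
      norm_num
    rw [e]
    exact sub_mem h0 h1
  · intro h i x hx
    rw [decompose_eq]
    exact hsmul _ _ (add_mem hx (hsmul _ _ (h x hx)))

/-- An element of degree `i` that commutes in the graded sense with all homogeneous elements. -/
def GradedCommutes (i : ZMod 2) (a : A.carrier) : Prop :=
  ∀ j, ∀ b ∈ A.grading j, a * b = sgn (i * j) • (b * a)

theorem isCentralSimple_iff : A.IsCentralSimple ↔ Nontrivial A.carrier ∧
    (∀ I : Ideal A.carrier, I.IsTwoSided → (∀ x ∈ I, A.parity x ∈ I) → I = ⊥ ∨ I = ⊤) ∧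
    ∀ i, ∀ a ∈ A.grading i, A.GradedCommutes i a → ∃ c : ℂ, a = c • 1 := by
  constructor
  · rintro ⟨h1, h2, h3⟩
    refine ⟨h1, fun I hI h => h2 I hI ((A.isHomogeneous_iff I).2 h), fun i a ha h => ?_⟩
    have : a ∈ A.gradedCenter := Submodule.subset_span ⟨i, ha, fun j b hb => by
      rw [units_neg_one_pow_smul]; exact h j b hb⟩
    rw [h3] at this
    obtain ⟨c, rfl⟩ := this
    exact ⟨c, Algebra.algebraMap_eq_smul_one c⟩
  · rintro ⟨h1, h2, h3⟩
    refine ⟨h1, fun I hI h => h2 I hI ((A.isHomogeneous_iff I).1 h), le_antisymm ?_ ?_⟩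
    · refine Submodule.span_le.2 ?_
      rintro a ⟨i, ha, h⟩
      obtain ⟨c, rfl⟩ := h3 i a ha fun j b hb => by
        rw [← units_neg_one_pow_smul]; exact h j b hb
      exact ⟨c, Algebra.algebraMap_eq_smul_one c⟩
    · rintro _ ⟨c, rfl⟩
      rw [Algebra.linearMap_apply, Algebra.algebraMap_eq_smul_one]
      refine Submodule.smul_mem _ c (Submodule.subset_span ⟨0, A.one_mem, fun j b _ => ?_⟩)
      rw [zero_mul, uzpow_zero, one_smul, one_mul, mul_one]

end

/-! ### Transport of central simplicity along isomorphisms and to tensor factors -/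

theorem IsCentralSimple.of_iso {A B : GrAlg} (e : Iso A B) (hA : A.IsCentralSimple) :
    B.IsCentralSimple := by
  rw [isCentralSimple_iff] at hA ⊢
  obtain ⟨h1, h2, h3⟩ := hA
  refine ⟨e.toEquiv.symm.toEquiv.nontrivial, fun I hI h => ?_, fun i b hb h => ?_⟩
  · have hc : (I.comap (e.toEquiv : A.carrier →+* B.carrier)).IsTwoSided := inferInstance
    have key : ∀ x, e.toEquiv x ∈ I ↔ x ∈ I.comap (e.toEquiv : A.carrier →+* B.carrier) :=
      fun x => Iff.rfl
    rcases h2 _ hc (fun x hx => by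
      rw [← key] at hx ⊢; rw [e.map_parity]; exact h _ hx) with h0 | h0
    · left
      rw [eq_bot_iff]
      intro y hy
      obtain ⟨x, rfl⟩ := e.toEquiv.surjective y
      rw [key, h0, Ideal.mem_bot] at hy
      rw [hy, map_zero]; exact zero_mem _
    · right
      rw [Ideal.eq_top_iff_one, ← map_one e.toEquiv, key, h0]
      trivial
  · obtain ⟨a, rfl⟩ := e.toEquiv.surjective b
    obtain ⟨c, rfl⟩ := h3 i a ((e.map_mem_iff i a).1 hb) fun j b hb' => e.toEquiv.injective (by
      rw [map_mul, h j _ (e.map_mem j b hb'), map_smul, map_mul])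
    exact ⟨c, by rw [map_smul, map_one]⟩

/-- A graded ideal `I` of `A` extends to the graded ideal `I ⊗ B`, and a graded central `a` to the
graded central `a ⊗ 1`. A linear functional `l` on `B` with `l 1 = 1` gives the retraction `a ⊗ b ↦
l(b) a`, which brings the conclusions back to `A`. -/
theorem IsCentralSimple.of_tensor {A B : GrAlg} (h : (A.tensor B).IsCentralSimple) :
    A.IsCentralSimple := by
  rw [isCentralSimple_iff] at h ⊢
  obtain ⟨h1, h2, h3⟩ := h
  have hAB : Nontrivial (A.carrier ⊗[ℂ] B.carrier) := (tens A B).toEquiv.nontrivial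
  have hA : Nontrivial A.carrier := by
    by_contra hA
    rw [not_nontrivial_iff_subsingleton] at hA
    exact not_subsingleton (A.carrier ⊗[ℂ] B.carrier) inferInstance
  have hB : Nontrivial B.carrier := by
    by_contra hB
    rw [not_nontrivial_iff_subsingleton] at hB
    exact not_subsingleton (A.carrier ⊗[ℂ] B.carrier) inferInstance
  obtain ⟨l, hl⟩ := Module.Projective.exists_dual_eq_one ℂ (one_ne_zero : (1 : B.carrier) ≠ 0)
  let ev : (A.tensor B).carrier →ₗ[ℂ] A.carrier :=
    (TensorProduct.rid ℂ A.carrier).toLinearMap ∘ₗ TensorProduct.map LinearMap.id l ∘ₗ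
      (tens A B).symm.toLinearMap
  have hev : ∀ a b, ev (tens A B (a ⊗ₜ b)) = l b • a := fun a b => by simp [ev]
  have hev1 : ∀ a, ev (tens A B (a ⊗ₜ 1)) = a := fun a => by rw [hev, hl, one_smul]
  refine ⟨hA, fun I hI hσ => ?_, fun i a ha hc => ?_⟩
  · have hsmul : ∀ (c : ℂ), ∀ x ∈ I, c • x ∈ I := fun c x hx => by
      rw [Algebra.smul_def]; exact I.mul_mem_left _ hx
    -- Only homogeneous tensors are taken as generators, since the product formula with its sign
    -- applies to them.
    let S : Set (A.tensor B).carrier := {x | ∃ k l, ∃ a ∈ A.grading k, ∃ b ∈ B.grading l,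
      a ∈ I ∧ x = tens A B (a ⊗ₜ b)}
    let J : Submodule ℂ (A.tensor B).carrier := Submodule.span ℂ S
    have hJ : ∀ x ∈ J, ev x ∈ I := fun x hx => by
      induction hx using Submodule.span_induction with
      | mem x hx =>
        obtain ⟨k, l, a, _, b, _, haI, rfl⟩ := hx
        rw [hev]
        exact hsmul _ _ haI
      | zero => rw [map_zero]; exact zero_mem _
      | add x y _ _ hx hy => rw [map_add]; exact add_mem hx hy
      | smul c x _ hx => rw [map_smul]; exact hsmul _ _ hx
    have hleft : ∀ y, ∀ x ∈ J, y * x ∈ J := fun y x hx => by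
      induction hx using Submodule.span_induction with
      | zero => rw [mul_zero]; exact zero_mem _
      | add x y _ _ hx hy => rw [mul_add]; exact add_mem hx hy
      | smul c x _ hx => rw [mul_smul_comm]; exact Submodule.smul_mem _ _ hx
      | mem x hx =>
        obtain ⟨k, l, a, ha, b, hb, haI, rfl⟩ := hx
        induction y using tens_induction with
        | add y y' hy hy' => rw [add_mul]; exact add_mem hy hy'
        | hom i j c hc d hd =>
          rw [tens_mul _ hd ha]
          exact Submodule.smul_mem _ _ (Submodule.subset_span ⟨_, _, _, mul_mem hc ha, _,
            mul_mem hd hb, I.mul_mem_left _ haI, rfl⟩)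
    have hright : ∀ y, ∀ x ∈ J, x * y ∈ J := fun y x hx => by
      induction hx using Submodule.span_induction with
      | zero => rw [zero_mul]; exact zero_mem _
      | add x y _ _ hx hy => rw [add_mul]; exact add_mem hx hy
      | smul c x _ hx => rw [smul_mul_assoc]; exact Submodule.smul_mem _ _ hx
      | mem x hx =>
        obtain ⟨k, l, a, ha, b, hb, haI, rfl⟩ := hx
        induction y using tens_induction with
        | add y y' hy hy' => rw [mul_add]; exact add_mem hy hy'
        | hom i j c hc d hd =>
          rw [tens_mul _ hb hc]
          exact Submodule.smul_mem _ _ (Submodule.subset_span ⟨_, _, _, mul_mem ha hc, _,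
            mul_mem hb hd, I.mul_mem_right _ haI, rfl⟩)
    have hpar : ∀ x ∈ J, (A.tensor B).parity x ∈ J := fun x hx => by
      induction hx using Submodule.span_induction with
      | zero => rw [map_zero]; exact zero_mem _
      | add x y _ _ hx hy => rw [map_add]; exact add_mem hx hy
      | smul c x _ hx => rw [map_smul]; exact Submodule.smul_mem _ _ hx
      | mem x hx =>
        obtain ⟨k, l, a, ha, b, hb, haI, rfl⟩ := hx
        rw [parity_apply _ (tens_mem ha hb)]
        exact Submodule.smul_mem _ _ (Submodule.subset_span ⟨_, _, _, ha, _, hb, haI, rfl⟩)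
    let K : Ideal (A.tensor B).carrier :=
      { carrier := J
        add_mem' := fun hx hy => add_mem (S := Submodule ℂ _) hx hy
        zero_mem' := zero_mem J
        smul_mem' := hleft }
    have hK : K.IsTwoSided := ⟨fun y hx => hright y _ hx⟩
    have hKJ : ∀ x, x ∈ K ↔ x ∈ J := fun x => Iff.rfl
    rcases h2 K hK hpar with h0 | h0
    · left
      rw [eq_bot_iff]
      intro a ha
      have hzero : ∀ i, ∀ a ∈ A.grading i, a ∈ I → a = 0 := fun i a hai ha => by
        have : tens A B (a ⊗ₜ 1) ∈ K :=
          (hKJ _).2 (Submodule.subset_span ⟨i, 0, a, hai, 1, B.one_mem, ha, rfl⟩)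
        rw [h0, Ideal.mem_bot] at this
        rw [← hev1 a, this, map_zero]
      -- Up to the factor two these are the homogeneous components of `a`, and they lie in `I`
      -- because `I` is stable under parity.
      have hz : ∀ i, a + sgn i • A.parity a = 0 := fun i =>
        hzero i _ (A.add_parity_mem a i) (add_mem ha (hsmul _ _ (hσ _ ha)))
      rw [A.eq_half_smul_add a, hz, hz, add_zero, smul_zero]
      exact zero_mem _
    · right
      rw [Ideal.eq_top_iff_one, ← hev1 1]
      refine hJ _ ((hKJ _).1 ?_)
      rw [h0]
      trivial
  · obtain ⟨c, hc⟩ := h3 i (tens A B (a ⊗ₜ 1))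
      (by simpa using tens_mem ha B.one_mem) (fun n y hy => by
        refine tens_induction_mem (fun y => tens A B (a ⊗ₜ 1) * y =
          sgn (i * n) • (y * tens A B (a ⊗ₜ 1))) hy (fun k l h b hb d hd => ?_)
          (fun x y hx hy => ?_) (fun c x hx => ?_)
        · rw [tens_mul _ B.one_mem hb, tens_mul _ hd ha, zero_mul, sgn_zero, one_smul, one_mul,
            mul_one, hc k b hb, ← TensorProduct.smul_tmul', map_smul, smul_smul, ← sgn_add, ← h,
            mul_comm l, mul_add, add_assoc, CharTwo.add_self_eq_zero, add_zero]
        · rw [mul_add, add_mul, smul_add, hx, hy]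
        · rw [mul_smul_comm, smul_mul_assoc, hx, smul_comm])
    refine ⟨c, ?_⟩
    rw [← hev1 a, hc, map_smul, ← tens_one, hev1]

/-- The isomorphism `A ⊗ B ≅ C` defined by two homomorphisms that commute in the graded sense. -/
def Iso.ofAlgHoms {A B C : GrAlg} (f : A.carrier →ₐ[ℂ] C.carrier) (g : B.carrier →ₐ[ℂ] C.carrier)
    (hf : ∀ i, ∀ a ∈ A.grading i, f a ∈ C.grading i)
    (hg : ∀ i, ∀ b ∈ B.grading i, g b ∈ C.grading i)
    (hfg : ∀ i j, ∀ a ∈ A.grading i, ∀ b ∈ B.grading j, g b * f a = sgn (j * i) • (f a * g b))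
    (hbij : Function.Bijective
      (LinearMap.mul' ℂ C.carrier ∘ₗ TensorProduct.map f.toLinearMap g.toLinearMap)) :
    Iso (A.tensor B) C :=
  Iso.ofTensor (LinearEquiv.ofBijective _ hbij)
    (by simp)
    (fun i j a ha b hb => by simpa using mul_mem (hf i a ha) (hg j b hb))
    (fun i j k l a ha b hb c hc d hd => by
      simp only [LinearEquiv.ofBijective_apply, LinearMap.comp_apply, TensorProduct.map_tmul,
        LinearMap.mul'_apply, AlgHom.toLinearMap_apply, map_mul]
      rw [mul_assoc, ← mul_assoc (g b), hfg k j c hc b hb, smul_mul_assoc, mul_smul_comm]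
      simp only [mul_assoc])

end GrAlg

/-! ### Endomorphism algebras are central simple -/

theorem isSimpleRing_end (V : Type) [AddCommGroup V] [Module ℂ V] [FiniteDimensional ℂ V]
    [Nontrivial V] : IsSimpleRing (Module.End ℂ V) := by
  have : Nonempty (Fin (Module.finrank ℂ V)) := ⟨⟨0, Module.finrank_pos⟩⟩
  exact IsSimpleRing.of_ringEquiv
    (algEquivMatrix (Module.finBasis ℂ V)).symm.toRingEquiv inferInstance

theorem end_eq_smul_one {V : Type} [AddCommGroup V] [Module ℂ V] {f : Module.End ℂ V}
    (h : ∀ g, g * f = f * g) : ∃ c : ℂ, f = c • 1 := by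
  have hf : f ∈ Subalgebra.center ℂ (Module.End ℂ V) := Subalgebra.mem_center_iff.2 h
  rw [Algebra.IsCentral.center_eq_bot, Algebra.mem_bot] at hf
  obtain ⟨c, rfl⟩ := hf
  exact ⟨c, Algebra.algebraMap_eq_smul_one c⟩

/-- An even graded-central element commutes with everything, hence is a scalar. An odd one must
commute with the even element `P`, but being odd it anticommutes with `P`; as `P` is invertible, it
vanishes. -/
theorem SSpace.alg_isCentralSimple (V : SSpace) : V.alg.IsCentralSimple := by
  have hs := isSimpleRing_iff_isTwoSided_imp.1 (isSimpleRing_end V.carrier)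
  refine V.alg.isCentralSimple_iff.2 ⟨hs.1, fun I hI _ => hs.2 I hI,
    fun i (a : Module.End ℂ V.carrier) ha h => ?_⟩
  rcases zmod_two_cases i with rfl | rfl
  · refine end_eq_smul_one (V := V.carrier) fun g => ?_
    induction g using V.alg.homogeneous_induction with
    | add x y hx hy => rw [add_mul, mul_add, hx, hy]
    | hom j g hg =>
      have := h j g hg
      rw [zero_mul, sgn_zero, one_smul] at this
      exact this.symm
  · have h1 : a * V.P = sgn (1 * 0) • (V.P * a) := h 0 V.P (V.pw_one ▸ V.pw_mem 1)
    rw [mul_zero, sgn_zero, one_smul, SSpace.P_mul_of_mem ha, sgn_one, neg_one_smul] at h1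
    have h2 : a * V.P = 0 := eq_neg_self_complex h1
    refine ⟨0, ?_⟩
    rw [zero_smul]
    have h3 : a * V.P * V.P = 0 := by rw [h2, zero_mul]
    rwa [mul_assoc, V.P_sq, mul_one] at h3

/-! ### The Clifford algebra of rank one -/

/-- The swap of `ℂ × ℂ`. -/
def swapHom : ℂ × ℂ →ₐ[ℂ] ℂ × ℂ := AlgHom.prod (AlgHom.snd ℂ ℂ ℂ) (AlgHom.fst ℂ ℂ ℂ)

theorem swapHom_apply (u : ℂ × ℂ) : swapHom u = (u.2, u.1) := rfl

/-- The Clifford algebra of rank one is `ℂ × ℂ`, where the parity operator is the swap. -/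
abbrev cliff : GrAlg := GrAlg.ofParity (ℂ × ℂ) swapHom fun _ => rfl

theorem mem_cliff_iff {i : ZMod 2} {u : ℂ × ℂ} : u ∈ cliff.grading i ↔ u.2 = sgn i * u.1 := by
  refine (GrAlg.mem_ofParity_iff (A := ℂ × ℂ)).trans ?_
  rw [swapHom_apply, Prod.ext_iff]
  simp only [Prod.smul_fst, Prod.smul_snd, smul_eq_mul]
  refine ⟨fun h => h.1, fun h => ⟨h, ?_⟩⟩
  rw [h, ← mul_assoc, sgn_mul_self, one_mul]

/-- The homomorphism from the Clifford algebra defined by a square root of one. -/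
def cliffHom {A : Type} [Ring A] [Algebra ℂ A] (z : A) (hz : z * z = 1) : ℂ × ℂ →ₐ[ℂ] A :=
  AlgHom.ofLinearMap
    (((1 / 2 : ℂ) • (LinearMap.fst ℂ ℂ ℂ + LinearMap.snd ℂ ℂ ℂ)).smulRight 1 +
      ((1 / 2 : ℂ) • (LinearMap.fst ℂ ℂ ℂ - LinearMap.snd ℂ ℂ ℂ)).smulRight z)
    (by simp [← two_mul])
    (fun u v => by
      simp only [LinearMap.add_apply, LinearMap.smulRight_apply, LinearMap.smul_apply,
        LinearMap.fst_apply, LinearMap.snd_apply, LinearMap.sub_apply, smul_eq_mul, Prod.fst_mul,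
        Prod.snd_mul, add_mul, mul_add, smul_mul_smul_comm, one_mul, mul_one, hz]
      module)

theorem cliffHom_apply {A : Type} [Ring A] [Algebra ℂ A] (z : A) (hz : z * z = 1) (u : ℂ × ℂ) :
    cliffHom z hz u = ((1 / 2 : ℂ) * (u.1 + u.2)) • 1 + ((1 / 2 : ℂ) * (u.1 - u.2)) • z := rfl

theorem cliffHom_one {A : Type} [Ring A] [Algebra ℂ A] (z : A) (hz : z * z = 1) :
    cliffHom z hz (1, 1) = 1 := map_one (cliffHom z hz)

theorem cliffHom_gen {A : Type} [Ring A] [Algebra ℂ A] (z : A) (hz : z * z = 1) :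
    cliffHom z hz (1, -1) = z := by
  rw [cliffHom_apply]
  module

theorem cliffHom_even {A : Type} [Ring A] [Algebra ℂ A] (z : A) (hz : z * z = 1) {u : ℂ × ℂ}
    (hu : u ∈ cliff.grading 0) : cliffHom z hz u = u.1 • 1 := by
  rw [mem_cliff_iff, sgn_zero, one_mul] at hu
  rw [cliffHom_apply, hu]
  module

theorem cliffHom_odd {A : Type} [Ring A] [Algebra ℂ A] (z : A) (hz : z * z = 1) {u : ℂ × ℂ}
    (hu : u ∈ cliff.grading 1) : cliffHom z hz u = u.1 • z := by
  rw [mem_cliff_iff, sgn_one, neg_one_mul] at hu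
  rw [cliffHom_apply, hu]
  module

theorem cliffHom_mem {A : GrAlg} (z : A.carrier) (hz : z * z = 1) (hz1 : z ∈ A.grading 1)
    (i : ZMod 2) (u : ℂ × ℂ) (hu : u ∈ cliff.grading i) : cliffHom z hz u ∈ A.grading i := by
  rcases zmod_two_cases i with rfl | rfl
  · rw [cliffHom_even z hz hu]; exact Submodule.smul_mem _ _ A.one_mem
  · rw [cliffHom_odd z hz hu]; exact Submodule.smul_mem _ _ hz1

/-- Every element of `M ⊗ (ℂ × ℂ)` is of the form `a ⊗ 1 + b ⊗ z`. -/
theorem exists_tmul_cliff {M : Type} [AddCommGroup M] [Module ℂ M] (x : M ⊗[ℂ] (ℂ × ℂ)) :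
    ∃ a b : M, x = a ⊗ₜ ((1, 1) : ℂ × ℂ) + b ⊗ₜ ((1, -1) : ℂ × ℂ) := by
  induction x using TensorProduct.induction_on with
  | zero => exact ⟨0, 0, by simp⟩
  | add x y hx hy =>
    obtain ⟨a, b, rfl⟩ := hx
    obtain ⟨c, d, rfl⟩ := hy
    exact ⟨a + c, b + d, by rw [TensorProduct.add_tmul, TensorProduct.add_tmul]; abel⟩
  | tmul m u =>
    refine ⟨((1 / 2 : ℂ) * (u.1 + u.2)) • m, ((1 / 2 : ℂ) * (u.1 - u.2)) • m, ?_⟩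
    rw [TensorProduct.smul_tmul, TensorProduct.smul_tmul, ← TensorProduct.tmul_add]
    congr 1
    ext <;> simp <;> ring

/-! ### The Clifford algebra of rank two as a matrix algebra -/

/-- The super vector space `ℂ ⊕ ℂ`. -/
abbrev plane : SSpace where
  carrier := ℂ × ℂ
  P := LinearMap.prodMap LinearMap.id (-LinearMap.id)
  P_sq := LinearMap.ext fun v => by simp
  nontriv := inferInstance

/-- The first generator of the Clifford algebra of rank two. -/
def pauliX : Module.End ℂ (ℂ × ℂ) := LinearMap.prod (LinearMap.snd ℂ ℂ ℂ) (LinearMap.fst ℂ ℂ ℂ)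

/-- The second generator of the Clifford algebra of rank two. -/
def pauliY : Module.End ℂ (ℂ × ℂ) :=
  LinearMap.prod (-Complex.I • LinearMap.snd ℂ ℂ ℂ) (Complex.I • LinearMap.fst ℂ ℂ ℂ)

theorem pauliX_apply (v : ℂ × ℂ) : pauliX v = (v.2, v.1) := rfl

theorem pauliY_apply (v : ℂ × ℂ) : pauliY v = (-Complex.I * v.2, Complex.I * v.1) := rfl

theorem plane_P_apply (v : ℂ × ℂ) : plane.P v = (v.1, -v.2) := rfl

theorem pauliX_sq : pauliX * pauliX = 1 := LinearMap.ext fun _ => rfl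

theorem pauliY_sq : pauliY * pauliY = 1 := LinearMap.ext fun v => by
  rw [Module.End.mul_apply, pauliY_apply, pauliY_apply]
  ext <;> simp [← mul_assoc]

theorem pauliY_mul_pauliX : pauliY * pauliX = -(pauliX * pauliY) := LinearMap.ext fun v => by
  rw [LinearMap.neg_apply, Module.End.mul_apply, Module.End.mul_apply, pauliY_apply, pauliX_apply,
    pauliY_apply, pauliX_apply]
  ext <;> simp

theorem pauliX_mem : pauliX ∈ plane.alg.grading 1 :=
  SSpace.mem_alg_iff.2 (LinearMap.ext fun v => by
    rw [LinearMap.smul_apply, Module.End.mul_apply, Module.End.mul_apply, plane_P_apply,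
      plane_P_apply, pauliX_apply, pauliX_apply, sgn_one]
    ext <;> simp)

theorem pauliY_mem : pauliY ∈ plane.alg.grading 1 :=
  SSpace.mem_alg_iff.2 (LinearMap.ext fun v => by
    rw [LinearMap.smul_apply, Module.End.mul_apply, Module.End.mul_apply, plane_P_apply,
      plane_P_apply, pauliY_apply, pauliY_apply, sgn_one]
    ext <;> simp)

/-- Both sides have dimension four, so it suffices that `1`, `X`, `Y` and `XY` are linearly
independent, which is read off from their values on the standard basis. -/
theorem pauli_bijective : Function.Bijective (LinearMap.mul' ℂ (Module.End ℂ (ℂ × ℂ)) ∘ₗ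
    TensorProduct.map (cliffHom pauliX pauliX_sq).toLinearMap
      (cliffHom pauliY pauliY_sq).toLinearMap) := by
  suffices h : Function.Injective (LinearMap.mul' ℂ (Module.End ℂ (ℂ × ℂ)) ∘ₗ
      TensorProduct.map (cliffHom pauliX pauliX_sq).toLinearMap
        (cliffHom pauliY pauliY_sq).toLinearMap) from
    ⟨h, (LinearMap.injective_iff_surjective_of_finrank_eq_finrank
      (by simp [Module.finrank_tensorProduct, Module.finrank_linearMap])).1 h⟩
  refine (injective_iff_map_eq_zero _).2 fun x hx => ?_
  obtain ⟨a, b, rfl⟩ := exists_tmul_cliff x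
  have h10 := LinearMap.congr_fun hx ((1, 0) : ℂ × ℂ)
  have h01 := LinearMap.congr_fun hx ((0, 1) : ℂ × ℂ)
  simp [cliffHom_apply, pauliX_apply, pauliY_apply] at h10 h01
  have e1 : a.1 + a.2 = 0 := by linear_combination h10.1 + h01.2
  have e2 : a.1 - a.2 = 0 := by linear_combination h10.2 + h01.1
  have e3 : b.1 - b.2 = 0 := by
    linear_combination -Complex.I * (h10.1 - h01.2) + (b.1 - b.2) * Complex.I_sq
  have e4 : b.1 + b.2 = 0 := by
    linear_combination -Complex.I * (h10.2 - h01.1) + (b.1 + b.2) * Complex.I_sq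
  have ha : a = 0 := Prod.ext (show a.1 = 0 by linear_combination (e1 + e2) / 2)
    (show a.2 = 0 by linear_combination (e1 - e2) / 2)
  have hb : b = 0 := Prod.ext (show b.1 = 0 by linear_combination (e3 + e4) / 2)
    (show b.2 = 0 by linear_combination (e4 - e3) / 2)
  rw [ha, hb, TensorProduct.zero_tmul, TensorProduct.zero_tmul, add_zero]

/-- The graded tensor square of the Clifford algebra of rank one is the algebra of endomorphisms
of `ℂ ⊕ ℂ`. -/
def cliffSq : GrAlg.Iso (cliff.tensor cliff) plane.alg :=
  GrAlg.Iso.ofAlgHoms (A := cliff) (B := cliff) (C := plane.alg) (cliffHom pauliX pauliX_sq)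
    (cliffHom pauliY pauliY_sq)
    (cliffHom_mem (A := plane.alg) _ _ pauliX_mem) (cliffHom_mem (A := plane.alg) _ _ pauliY_mem)
    (fun i j (a : ℂ × ℂ) ha (b : ℂ × ℂ) hb => by
      rcases zmod_two_cases i with rfl | rfl
      · rw [cliffHom_even _ _ ha, mul_zero, sgn_zero, one_smul, smul_mul_assoc, mul_smul_comm,
          one_mul, mul_one]
      · rcases zmod_two_cases j with rfl | rfl
        · rw [cliffHom_even _ _ hb, zero_mul, sgn_zero, one_smul, smul_mul_assoc, mul_smul_comm,
            one_mul, mul_one]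
        · rw [cliffHom_odd _ _ ha, cliffHom_odd _ _ hb, mul_one, sgn_one, smul_mul_smul_comm,
            smul_mul_smul_comm, pauliY_mul_pauliX, mul_comm a.1]
          module)
    pauli_bijective

namespace GrAlg

/-! ### Classification of central simple graded algebras -/

theorem exists_algEquiv_end (A : Type) [Ring A] [Algebra ℂ A] [FiniteDimensional ℂ A]
    [IsSimpleRing A] : ∃ n : ℕ, NeZero n ∧ Nonempty (A ≃ₐ[ℂ] Module.End ℂ (Fin n → ℂ)) := by
  obtain ⟨n, hn, ⟨e⟩⟩ := IsSimpleRing.exists_algEquiv_matrix_of_isAlgClosed ℂ A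
  exact ⟨n, hn, ⟨e.trans Matrix.toLinAlgEquiv'⟩⟩

/-- A graded algebra that is simple as an ungraded algebra is an endomorphism algebra. -/
theorem exists_iso_alg_of_isSimpleRing (A : GrAlg) [IsSimpleRing A.carrier] :
    ∃ V : SSpace, Nonempty (Iso A V.alg) := by
  obtain ⟨n, hn, ⟨e⟩⟩ := exists_algEquiv_end A.carrier
  -- Skolem–Noether: parity becomes conjugation by a linear automorphism `T`.
  obtain ⟨T, hT⟩ := ((e.symm.trans A.parityEquiv).trans e).eq_linearEquivConjAlgEquiv
  have hT' : ∀ f v, e (A.parity (e.symm f)) (T v) = T (f v) := fun f v => by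
    have h := LinearMap.congr_fun (AlgEquiv.congr_fun hT f) (T v)
    simpa [LinearEquiv.conjAlgEquiv_apply, parityEquiv_apply] using h
  -- Parity is an involution, so conjugation by `T²` is trivial and `T²` is a scalar `α`. Rescaling
  -- `T` by a square root `β` of `α⁻¹` turns it into an involution.
  obtain ⟨α, hα⟩ := (LinearEquiv.conjAlgEquiv_ext_iff (S := ℂ) (f := T.trans T)
    (g := LinearEquiv.refl ℂ (Fin n → ℂ))).1 (AlgEquiv.ext fun f => LinearMap.ext fun v => by
      obtain ⟨v, rfl⟩ := (T.trans T).surjective v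
      have h := hT' (e (A.parity (e.symm f))) (T v)
      rw [AlgEquiv.symm_apply_apply, A.parity_parity, AlgEquiv.apply_symm_apply, hT'] at h
      simpa [LinearEquiv.conjAlgEquiv_apply] using h.symm)
  have hTT : ∀ v, T (T v) = α • v := fun v => congrFun hα v
  have hα0 : α ≠ 0 := by
    rintro rfl
    obtain ⟨v, hv⟩ := exists_ne (0 : Fin n → ℂ)
    have := hTT v
    rw [zero_smul, map_eq_zero_iff _ T.injective, map_eq_zero_iff _ T.injective] at this
    exact hv this
  obtain ⟨β, hβ⟩ := IsAlgClosed.exists_eq_mul_self (α⁻¹)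
  have hββ : β * β * α = 1 := by rw [← hβ, inv_mul_cancel₀ hα0]
  let V : SSpace :=
    { carrier := Fin n → ℂ
      P := β • T.toLinearMap
      P_sq := LinearMap.ext fun v => by simp [hTT, smul_smul, hββ]
      nontriv := inferInstance }
  refine ⟨V, ⟨Iso.ofParity (B := V.alg) e fun a => ?_⟩⟩
  rw [SSpace.alg_parity]
  refine LinearMap.ext fun v => ?_
  have h := hT' (e a) (β • β • T v)
  rw [AlgEquiv.symm_apply_apply, map_smul T, map_smul T, hTT, smul_smul, smul_smul, hββ,
    one_smul] at h
  rw [h]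
  change T (e a (β • β • T v)) = β • T (e a (β • T v))
  rw [map_smul (e a), map_smul T]

/-- A central simple graded algebra that is not simple as an ungraded algebra contains an odd
central square root of one. -/
theorem IsCentralSimple.exists_odd_central {A : GrAlg} (hA : A.IsCentralSimple)
    (h : ¬ IsSimpleRing A.carrier) :
    ∃ z ∈ A.grading 1, z * z = 1 ∧ ∀ x, z * x = x * z := by
  obtain ⟨h1, h2, -⟩ := A.isCentralSimple_iff.1 hA
  rw [isSimpleRing_iff_isTwoSided_imp] at h
  push Not at h
  obtain ⟨I, hI, hbot, htop⟩ := h h1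
  let σ : A.carrier →+* A.carrier := A.parityEquiv
  have hσ : ∀ x, σ x = A.parity x := fun _ => rfl
  -- As parity is an involution, this preimage is the image of `I` under parity. Intersection and
  -- sum of the two are parity-stable ideals, so graded simplicity forces `I ⊓ K = ⊥` and `I ⊔ K =
  -- ⊤`.
  let K : Ideal A.carrier := I.comap σ
  have hK : ∀ x, x ∈ K ↔ A.parity x ∈ I := fun _ => Iff.rfl
  have hKts : K.IsTwoSided := inferInstanceAs (I.comap σ).IsTwoSided
  have hinf : I ⊓ K = ⊥ := by
    refine (h2 (I ⊓ K) ⟨fun b hx => ⟨I.mul_mem_right _ hx.1, K.mul_mem_right _ hx.2⟩⟩ fun x hx => ?_).resolve_right fun h => htop ?_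
    · refine ⟨hx.2, ?_⟩
      change A.parity x ∈ K
      rw [hK, A.parity_parity]
      exact hx.1
    · exact top_le_iff.1 (h ▸ inf_le_left)
  have hsup : I ⊔ K = ⊤ := by
    refine (h2 (I ⊔ K) ⟨fun b hx => ?_⟩ fun x hx => ?_).resolve_left fun h => hbot ?_
    · obtain ⟨y, hy, z, hz, rfl⟩ := Submodule.mem_sup.1 hx
      rw [add_mul]
      exact Submodule.add_mem_sup (I.mul_mem_right _ hy) (K.mul_mem_right _ hz)
    · obtain ⟨y, hy, z, hz, rfl⟩ := Submodule.mem_sup.1 hx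
      rw [map_add, add_comm]
      refine Submodule.add_mem_sup hz ?_
      rw [hK, A.parity_parity]
      exact hy
    · exact le_bot_iff.1 (h ▸ le_sup_left)
  have hzero : ∀ x, x ∈ I → x ∈ K → x = 0 := fun x hx hx' => by
    have : x ∈ I ⊓ K := ⟨hx, hx'⟩
    rwa [hinf, Ideal.mem_bot] at this
  -- The components of `1` in `I ⊕ K` are orthogonal central elements. Parity swaps the two summands
  -- and fixes `1`, so it swaps `e` and `f`, and `e - f` is odd with square `e + f = 1`.
  obtain ⟨e, he, f, hf, hef⟩ := Submodule.mem_sup.1 ((Ideal.eq_top_iff_one _).1 hsup)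
  have hef0 : e * f = 0 := hzero _ (I.mul_mem_right _ he) (K.mul_mem_left _ hf)
  have hfe0 : f * e = 0 := hzero _ (I.mul_mem_left _ he) (K.mul_mem_right _ hf)
  have hfe : f = 1 - e := eq_sub_of_add_eq' hef
  have hcomm : ∀ x, e * x = x * e := fun x => by
    have h0 : e * x - x * e = 0 := hzero _
      (sub_mem (I.mul_mem_right _ he) (I.mul_mem_left _ he)) (by
        have : e * x - x * e = x * f - f * x := by rw [hfe]; noncomm_ring
        rw [this]
        exact sub_mem (K.mul_mem_left _ hf) (K.mul_mem_right _ hf))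
    exact sub_eq_zero.1 h0
  have hpar : A.parity e = f := by
    have h0 : A.parity e - f = 0 := hzero _ (by
        have : A.parity e - f = e - A.parity f := by
          have := congrArg A.parity hef
          rw [map_add, A.parity_one] at this
          rw [eq_sub_of_add_eq this, hfe]
          abel
        rw [this]
        exact sub_mem he hf)
      (sub_mem (by rw [hK, A.parity_parity]; exact he) hf)
    exact sub_eq_zero.1 h0
  refine ⟨e - f, ?_, ?_, fun x => ?_⟩
  · rw [mem_grading_iff, map_sub, hpar, ← hpar, A.parity_parity, sgn_one, neg_one_smul, neg_sub]
  · calc (e - f) * (e - f) = (e + f) * (e + f) - (e * f + f * e) - (e * f + f * e) := by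
          noncomm_ring
      _ = 1 := by rw [hef, hef0, hfe0]; simp
  · rw [hfe]
    have := hcomm x
    calc (e - (1 - e)) * x = e * x + e * x - x := by noncomm_ring
      _ = x * (e - (1 - e)) := by rw [this]; noncomm_ring

/-! ### Algebras with an odd central square root of one -/

/-- The even part of a graded algebra. -/
def even (A : GrAlg) : Subalgebra ℂ A.carrier :=
  AlgHom.equalizer (A.parityEquiv : A.carrier →ₐ[ℂ] A.carrier) (AlgHom.id ℂ A.carrier)

theorem mem_even_iff {A : GrAlg} {a : A.carrier} : a ∈ A.even ↔ A.parity a = a := Iff.rfl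

section Odd

variable {A : GrAlg} {z : A.carrier} (hz1 : z ∈ A.grading 1) (hzz : z * z = 1)
  (hz : ∀ x, z * x = x * z)

include hz1 in
theorem parity_of_odd : A.parity z = -z := by
  rw [A.parity_apply hz1, sgn_one, neg_one_smul]

include hz1 hzz in
-- The odd element `z` is invertible, so multiplication by it exchanges the even and the odd part;
-- the algebra is `A₀ ⊕ A₀ z`.
theorem exists_even_add_even_mul (x : A.carrier) : ∃ a b : A.even, x = a + b * z := by
  have hp := parity_of_odd hz1
  refine ⟨⟨(1 / 2 : ℂ) • (x + A.parity x), ?_⟩, ⟨(1 / 2 : ℂ) • (x - A.parity x) * z, ?_⟩, ?_⟩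
  · rw [mem_even_iff, map_smul, map_add, A.parity_parity, add_comm]
  · rw [mem_even_iff, A.parity_mul, map_smul, map_sub, A.parity_parity, hp, mul_neg, ← neg_mul,
      ← smul_neg, neg_sub]
  · change x = (1 / 2 : ℂ) • (x + A.parity x) + (1 / 2 : ℂ) • (x - A.parity x) * z * z
    rw [mul_assoc, hzz, mul_one, ← smul_add,
      show x + A.parity x + (x - A.parity x) = (2 : ℂ) • x by rw [two_smul]; abel, smul_smul]
    norm_num

include hz1 in
theorem parity_even_add_even_mul (a b : A.even) :
    A.parity ((a : A.carrier) + b * z) = a - b * z := by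
  rw [map_add, A.parity_mul, parity_of_odd hz1, mem_even_iff.1 a.2, mem_even_iff.1 b.2, mul_neg,
    sub_eq_add_neg]

include hz1 hzz in
theorem eq_zero_of_even_add_even_mul {a b : A.even} (h : (a : A.carrier) + b * z = 0) :
    a = 0 ∧ b = 0 := by
  have h' := congrArg A.parity h
  rw [parity_even_add_even_mul hz1, map_zero] at h'
  have ha : (a : A.carrier) = 0 := eq_neg_self_complex (by
    rw [sub_eq_zero] at h'
    rw [eq_neg_iff_add_eq_zero]
    nth_rewrite 2 [h']
    exact h)
  refine ⟨Subtype.ext ha, Subtype.ext ?_⟩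
  rw [ha, zero_add] at h
  have : (b : A.carrier) * z * z = 0 := by rw [h, zero_mul]
  rwa [mul_assoc, hzz, mul_one] at this

include hz1 hzz hz in
-- Because `z` is central with `z² = 1`, a two-sided ideal `J` of the even part extends to the
-- two-sided graded ideal `J + J z` of `A`, which is zero or everything; uniqueness of even
-- components recovers `J`.
theorem IsCentralSimple.isSimpleRing_even (hA : A.IsCentralSimple) : IsSimpleRing A.even := by
  obtain ⟨h1, h2, -⟩ := A.isCentralSimple_iff.1 hA
  refine isSimpleRing_iff_isTwoSided_imp.2 ⟨inferInstance, fun J hJ => ?_⟩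
  have hmul : ∀ a b c d : A.even, ((a : A.carrier) + b * z) * (c + d * z) =
      ((a * c + b * d : A.even) : A.carrier) + ((a * d + b * c : A.even) : A.carrier) * z := by
    intro a b c d
    push_cast
    calc ((a : A.carrier) + b * z) * (c + d * z)
        = a * c + a * d * z + b * (z * c) + b * (z * d) * z := by noncomm_ring
      _ = a * c + a * d * z + b * (c * z) + b * (d * z) * z := by rw [hz, hz]
      _ = a * c + b * d * (z * z) + (a * d + b * c) * z := by noncomm_ring
      _ = _ := by rw [hzz, mul_one]
  let I : Ideal A.carrier :=
    { carrier := {x | ∃ a ∈ J, ∃ b ∈ J, x = (a : A.carrier) + b * z}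
      add_mem' := by
        rintro _ _ ⟨a, ha, b, hb, rfl⟩ ⟨c, hc, d, hd, rfl⟩
        exact ⟨a + c, add_mem ha hc, b + d, add_mem hb hd, by push_cast; noncomm_ring⟩
      zero_mem' := ⟨0, zero_mem _, 0, zero_mem _, by simp⟩
      smul_mem' := by
        rintro y _ ⟨a, ha, b, hb, rfl⟩
        obtain ⟨c, d, rfl⟩ := exists_even_add_even_mul hz1 hzz y
        exact ⟨_, add_mem (J.mul_mem_left _ ha) (J.mul_mem_left _ hb), _,
          add_mem (J.mul_mem_left _ hb) (J.mul_mem_left _ ha), hmul c d a b⟩ }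
  have hI : ∀ x, x ∈ I ↔ ∃ a ∈ J, ∃ b ∈ J, x = (a : A.carrier) + b * z := fun _ => Iff.rfl
  have hIts : I.IsTwoSided := ⟨by
    rintro _ y ⟨a, ha, b, hb, rfl⟩
    obtain ⟨c, d, rfl⟩ := exists_even_add_even_mul hz1 hzz y
    exact ⟨_, add_mem (J.mul_mem_right _ ha) (J.mul_mem_right _ hb), _,
      add_mem (J.mul_mem_right _ ha) (J.mul_mem_right _ hb), hmul a b c d⟩⟩
  rcases h2 I hIts (by
    rintro _ ⟨a, ha, b, hb, rfl⟩
    refine ⟨a, ha, -b, neg_mem hb, ?_⟩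
    rw [parity_even_add_even_mul hz1]
    push_cast
    noncomm_ring) with h | h
  · left
    rw [eq_bot_iff]
    intro a ha
    have : (a : A.carrier) ∈ I := ⟨a, ha, 0, zero_mem _, by simp⟩
    rw [h, Ideal.mem_bot] at this
    exact Subtype.ext this
  · right
    obtain ⟨a, ha, b, hb, h'⟩ := (hI 1).1 (h ▸ trivial)
    have h0 : ((1 - a : A.even) : A.carrier) + ((-b : A.even) : A.carrier) * z = 0 := by
      push_cast
      rw [neg_mul, h']
      abel
    have := (eq_zero_of_even_add_even_mul hz1 hzz h0).1
    rw [Ideal.eq_top_iff_one, sub_eq_zero.1 this]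
    exact ha

include hz1 hzz hz in
-- The simple even part is a matrix algebra by Wedderburn, `z` generates a copy of the Clifford
-- algebra commuting with it, and `A = A₀ ⊕ A₀ z` says that multiplication of the two is bijective.
theorem IsCentralSimple.exists_iso_alg_tensor_cliff (hA : A.IsCentralSimple) :
    ∃ V : SSpace, Nonempty (Iso (V.alg.tensor cliff) A) := by
  have := hA.isSimpleRing_even hz1 hzz hz
  obtain ⟨n, hn, ⟨e⟩⟩ := exists_algEquiv_end A.even
  let V : SSpace :=
    { carrier := Fin n → ℂ
      -- With the trivial parity on `V` all of `End V` is even, matching the even part of `A`.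
      P := 1
      P_sq := one_mul 1
      nontriv := inferInstance }
  have hodd : ∀ f ∈ V.alg.grading 1, f = 0 := fun (f : Module.End ℂ (Fin n → ℂ)) hf => by
    have h : 1 * f = sgn 1 • (f * 1) := SSpace.P_mul_of_mem hf
    rw [one_mul, mul_one, sgn_one] at h
    exact eq_neg_self_complex (h.trans (neg_one_smul ℂ f))
  let f : Module.End ℂ (Fin n → ℂ) →ₐ[ℂ] A.carrier := A.even.val.comp e.symm
  have hf : ∀ a : Module.End ℂ (Fin n → ℂ), f a = (e.symm a : A.carrier) := fun _ => rfl
  have hf0 : ∀ a, f a ∈ A.grading 0 := fun a => by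
    rw [mem_grading_iff, sgn_zero, one_smul]
    exact mem_even_iff.1 (e.symm a).2
  refine ⟨V, ⟨Iso.ofAlgHoms (A := V.alg) (B := cliff) f (cliffHom z hzz) (fun i a ha => ?_)
    (cliffHom_mem z hzz hz1) (fun i j a ha (b : ℂ × ℂ) hb => ?_) ⟨?_, ?_⟩⟩⟩
  · rcases zmod_two_cases i with rfl | rfl
    · exact hf0 a
    · rw [hodd a ha]
      exact (map_zero f).symm ▸ zero_mem _
  · rcases zmod_two_cases i with rfl | rfl
    · rw [mul_zero, sgn_zero, one_smul, cliffHom_apply, add_mul, mul_add (f a), smul_mul_assoc,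
        smul_mul_assoc, mul_smul_comm, mul_smul_comm, one_mul, mul_one, hz]
    · rw [hodd a ha]
      simp only [map_zero, mul_zero, zero_mul, smul_zero]
  · refine (injective_iff_map_eq_zero _).2 fun x hx => ?_
    obtain ⟨a, b, rfl⟩ := exists_tmul_cliff x
    have h : (e.symm a : A.carrier) + (e.symm b : A.even) * z = 0 := by
      simpa [cliffHom_one, cliffHom_gen, hf] using hx
    obtain ⟨ha, hb⟩ := eq_zero_of_even_add_even_mul hz1 hzz h
    rw [map_eq_zero_iff _ e.symm.injective] at ha hb
    rw [ha, hb, TensorProduct.zero_tmul, TensorProduct.zero_tmul, add_zero]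
  · intro x
    obtain ⟨a, b, rfl⟩ := exists_even_add_even_mul hz1 hzz x
    refine ⟨e a ⊗ₜ ((1, 1) : ℂ × ℂ) + e b ⊗ₜ ((1, -1) : ℂ × ℂ), ?_⟩
    simp [cliffHom_one, cliffHom_gen, hf]

end Odd

/-- A central simple graded algebra is an endomorphism algebra or the tensor product of such an
algebra with the Clifford algebra of rank one. -/
theorem IsCentralSimple.exists_iso {A : GrAlg} (hA : A.IsCentralSimple) :
    (∃ V : SSpace, Nonempty (Iso A V.alg)) ∨
      ∃ V : SSpace, Nonempty (Iso A (V.alg.tensor cliff)) := by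
  by_cases h : IsSimpleRing A.carrier
  · exact Or.inl (exists_iso_alg_of_isSimpleRing A)
  · obtain ⟨z, hz1, hzz, hz⟩ := hA.exists_odd_central h
    obtain ⟨V, ⟨e⟩⟩ := hA.exists_iso_alg_tensor_cliff hz1 hzz hz
    exact Or.inr ⟨V, ⟨e.symm⟩⟩

/-! ### Closure of central simple graded algebras under tensor products -/

/-- `V ⊗ Cl ⊗ Cl` is an endomorphism algebra. -/
def algCliffCliff (V : SSpace) :
    Iso ((V.alg.tensor cliff).tensor cliff) (V.tensor plane).alg :=
  (Iso.assoc _ _ _).trans ((Iso.tensor (Iso.refl _) cliffSq).trans (SSpace.algTensor V plane))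

/-- Central simple graded algebras are the tensor factors of endomorphism algebras. -/
theorem isCentralSimple_iff_exists_tensor {A : GrAlg} :
    A.IsCentralSimple ↔ ∃ (B : GrAlg) (V : SSpace), Nonempty (Iso (A.tensor B) V.alg) := by
  constructor
  · intro hA
    rcases hA.exists_iso with ⟨V, ⟨e⟩⟩ | ⟨V, ⟨e⟩⟩
    · exact ⟨V.alg, V.tensor V, ⟨(Iso.tensor e (Iso.refl _)).trans (SSpace.algTensor V V)⟩⟩
    · exact ⟨cliff, V.tensor plane, ⟨(Iso.tensor e (Iso.refl _)).trans (algCliffCliff V)⟩⟩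
  · rintro ⟨B, V, ⟨e⟩⟩
    exact IsCentralSimple.of_tensor (V.alg_isCentralSimple.of_iso e.symm)

theorem cliff_isCentralSimple : cliff.IsCentralSimple :=
  isCentralSimple_iff_exists_tensor.2 ⟨cliff, plane, ⟨cliffSq⟩⟩

/-- If `A ⊗ A'` and `B ⊗ B'` are endomorphism algebras, so is `(A ⊗ B) ⊗ (B' ⊗ A')`, after
regrouping. -/
theorem IsCentralSimple.tensor {A B : GrAlg} (hA : A.IsCentralSimple) (hB : B.IsCentralSimple) :
    (A.tensor B).IsCentralSimple := by
  obtain ⟨A', V, ⟨e⟩⟩ := isCentralSimple_iff_exists_tensor.1 hA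
  obtain ⟨B', W, ⟨f⟩⟩ := isCentralSimple_iff_exists_tensor.1 hB
  refine isCentralSimple_iff_exists_tensor.2 ⟨B'.tensor A', V.tensor W, ⟨?_⟩⟩
  refine (Iso.assoc A B (B'.tensor A')).trans ?_
  refine (Iso.tensor (Iso.refl A) ((Iso.assoc B B' A').symm.trans
    ((Iso.tensor f (Iso.refl A')).trans (Iso.comm _ _)))).trans ?_
  exact (Iso.assoc A A' W.alg).symm.trans ((Iso.tensor e (Iso.refl _)).trans (SSpace.algTensor V W))

end GrAlg

/-! ### Semilinear automorphisms of endomorphism algebras are inner -/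

section Skolem

variable {d : Multiplicative (ZMod 2)} {V W : Type} [AddCommGroup V] [Module ℂ V] [AddCommGroup W]
  [Module ℂ W]

/-- Powers of complex conjugation as additive automorphisms. -/
def conjPowEquiv (d : Multiplicative (ZMod 2)) : ℂ ≃+ ℂ where
  toFun := conjPow d
  invFun := conjPow d
  left_inv := conjPow_conjPow d
  right_inv := conjPow_conjPow d
  map_add' := map_add _

theorem exists_semilinear (d : Multiplicative (ZMod 2)) (V : Type) [AddCommGroup V] [Module ℂ V]
    [FiniteDimensional ℂ V] : ∃ K : V ≃+ V, ∀ (c : ℂ) v, K (c • v) = conjPow d c • K v := by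
  let e := (Module.finBasis ℂ V).equivFun
  let k : (Fin (Module.finrank ℂ V) → ℂ) ≃+ (Fin (Module.finrank ℂ V) → ℂ) :=
    AddEquiv.piCongrRight fun _ => conjPowEquiv d
  refine ⟨e.toAddEquiv.trans (k.trans e.symm.toAddEquiv), fun c v => ?_⟩
  change e.symm (k (e (c • v))) = conjPow d c • e.symm (k (e v))
  rw [← map_smul e.symm, map_smul]
  congr 1
  funext i
  exact map_mul (conjPow d) c (e v i)

/-- Conjugation by a coordinatewise power of complex conjugation `K` has the same semilinearity as
`σ`, so composing the two gives a `ℂ`-linear automorphism, to which Skolem–Noether applies. -/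
theorem exists_semilinear_conj [FiniteDimensional ℂ V]
    (σ : Module.End ℂ V ≃+* Module.End ℂ V)
    (hσ : ∀ (c : ℂ) f, σ (c • f) = conjPow d c • σ f) :
    ∃ T : V ≃+ V, (∀ (c : ℂ) v, T (c • v) = conjPow d c • T v) ∧ ∀ f v, σ f (T v) = T (f v) := by
  obtain ⟨K, hK⟩ := exists_semilinear d V
  have hKs : ∀ (c : ℂ) f, conjSemi K hK (c • f) = conjPow d c • conjSemi K hK f :=
    fun c f => LinearMap.ext fun v => hK c _
  let ρ : Module.End ℂ V ≃ₐ[ℂ] Module.End ℂ V :=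
    AlgEquiv.ofRingEquiv (f := (conjSemi K hK).trans σ) fun c => by
      rw [Algebra.algebraMap_eq_smul_one, RingEquiv.trans_apply, hKs, hσ, conjPow_conjPow, map_one,
        map_one]
  obtain ⟨S, hS⟩ := ρ.eq_linearEquivConjAlgEquiv
  refine ⟨K.symm.trans S.toAddEquiv, fun c v => ?_, fun f v => ?_⟩
  · change S (K.symm (c • v)) = conjPow d c • S (K.symm v)
    rw [symm_semilinear hK, map_smul]
  · change σ f (S (K.symm v)) = S (K.symm (f v))
    obtain ⟨f, rfl⟩ := (conjSemi K hK).surjective f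
    have h := LinearMap.congr_fun (AlgEquiv.congr_fun hS f) (S (K.symm v))
    rw [LinearEquiv.conjAlgEquiv_apply] at h
    simp only [LinearMap.comp_apply, LinearEquiv.coe_coe, LinearEquiv.symm_apply_apply] at h
    rw [conjSemi_apply, AddEquiv.symm_apply_apply]
    exact h

/-- The semilinearities of `T` and `T'` cancel in `T⁻¹ T'`, which is therefore a linear map
commuting with all endomorphisms, hence a scalar. The hypothesis `h` says that `T` and `T'`
implement the same conjugation. This is the uniqueness half of Skolem–Noether, used below for every
scalar and every sign. -/
theorem eq_smul_of_conj_eq [Nontrivial V] {T T' : V ≃+ W}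
    (hT : ∀ (c : ℂ) v, T (c • v) = conjPow d c • T v)
    (hT' : ∀ (c : ℂ) v, T' (c • v) = conjPow d c • T' v)
    (h : ∀ (f : Module.End ℂ V) (f' : Module.End ℂ W), (∀ v, f' (T v) = T (f v)) →
      ∀ v, f' (T' v) = T' (f v)) : ∃ c : ℂ, c ≠ 0 ∧ ∀ v, T' v = c • T v := by
  let S : Module.End ℂ V :=
    { toFun v := T.symm (T' v)
      map_add' v w := by simp only [map_add]
      map_smul' c v := by
        rw [hT', symm_semilinear hT, conjPow_conjPow, RingHom.id_apply] }
  have hS : ∀ v, S v = T.symm (T' v) := fun _ => rfl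
  obtain ⟨c, hc⟩ := end_eq_smul_one (f := S) fun f => LinearMap.ext fun v => by
    rw [Module.End.mul_apply, Module.End.mul_apply, hS, hS]
    have := h f (conjSemi T hT f) (fun v => by rw [conjSemi_apply, AddEquiv.symm_apply_apply]) v
    rw [← this, conjSemi_apply, AddEquiv.symm_apply_apply]
  have key : ∀ v, T' v = conjPow d c • T v := fun v => by
    rw [← hT, ← AddEquiv.symm_apply_eq, ← hS, hc, LinearMap.smul_apply, Module.End.one_apply]
  refine ⟨conjPow d c, fun h0 => ?_, key⟩
  obtain ⟨v, hv⟩ := exists_ne (0 : V)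
  have := key v
  rw [h0, zero_smul, map_eq_zero_iff _ T'.injective] at this
  exact hv this

theorem exists_sgn_eq {c : ℂ} (h : c * c = 1) : ∃ d, c = sgn d := by
  rcases mul_self_eq_one_iff.1 h with rfl | rfl
  · exact ⟨0, sgn_zero.symm⟩
  · exact ⟨1, sgn_one.symm⟩

end Skolem

/-- A magnetic equivariant graded algebra that is an endomorphism algebra as a graded algebra is
the endomorphism algebra of a projective representation. -/
theorem exists_projRep (A : MagAlg φ) (V : SSpace) (e : GrAlg.Iso A.toGrAlg V.alg) :
    ∃ R : ProjRep φ, Nonempty (MagAlg.Iso A R.alg) := by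
  let E : A.carrier ≃ₐ[ℂ] Module.End ℂ V.carrier := e.toEquiv
  have hE : ∀ a, E (A.parity a) = V.P * (E a * V.P) := fun a =>
    (e.map_parity a).trans (V.alg_parity _)
  have key : ∀ g, ∃ T : V.carrier ≃+ V.carrier, (∀ (c : ℂ) v, T (c • v) = conjPow (φ g) c • T v) ∧
      ∀ a v, E (A.τ g a) (T v) = T (E a v) := fun g => by
    obtain ⟨T, hT, h⟩ := exists_semilinear_conj (d := φ g)
      ((E.symm.toRingEquiv.trans (A.τ g)).trans E.toRingEquiv) (fun c f => by
        change E (A.τ g (E.symm (c • f))) = conjPow (φ g) c • E (A.τ g (E.symm f))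
        rw [map_smul, A.τ_smul, map_smul])
    refine ⟨T, hT, fun a v => ?_⟩
    have := h (E a) v
    change E (A.τ g (E.symm (E a))) (T v) = T (E a v) at this
    rwa [AlgEquiv.symm_apply_apply] at this
  choose T hT hTE using key
  have hτ : ∀ g a, A.τ g (A.parity a) = A.parity (A.τ g a) := fun g a => by
    induction a using A.homogeneous_induction with
    | add x y hx hy => simp only [map_add, hx, hy]
    | hom i a ha => rw [A.parity_apply ha, A.parity_apply (A.τ_mem g i a ha), A.τ_smul, conjPow_sgn]
  have hconj : ∀ g f f', (∀ v, f' (T g v) = T g (f v)) → f' = E (A.τ g (E.symm f)) :=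
    fun g f f' h => LinearMap.ext fun v => by
      obtain ⟨v, rfl⟩ := (T g).surjective v
      rw [h, hTE, AlgEquiv.apply_symm_apply]
  -- The action preserves degrees, so `τ g` commutes with parity and `P T_g P` implements the same
  -- automorphism as `T_g`. The two differ by a scalar whose square is one because `P² = 1`.
  have hP : ∀ g, ∃ δ : ZMod 2, ∀ v, T g (V.P v) = sgn δ • V.P (T g v) := fun g => by
    let p : V.carrier ≃+ V.carrier := (V.pwEquiv 1).toAddEquiv
    have hp : ∀ v, p v = V.P v := fun v => by
      change V.pw 1 v = _
      rw [V.pw_one]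
    obtain ⟨c, -, hc⟩ := eq_smul_of_conj_eq (hT g) (T' := (p.trans (T g)).trans p)
      (fun c v => by
        simp only [AddEquiv.trans_apply, hp]
        rw [map_smul, hT, map_smul]) (fun f f' h v => by
        simp only [AddEquiv.trans_apply, hp]
        rw [hconj g f f' h]
        have h1 := hTE g (A.parity (E.symm f)) (V.P v)
        rw [hτ, hE, hE, AlgEquiv.apply_symm_apply] at h1
        simp only [Module.End.mul_apply, V.P_P] at h1
        rw [← h1, V.P_P])
    simp only [AddEquiv.trans_apply, hp] at hc
    have hc2 : c * c = 1 := by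
      obtain ⟨v, hv⟩ := exists_ne (0 : V.carrier)
      have h1 := hc (V.P v)
      rw [V.P_P] at h1
      have h2 : T g v = (c * c) • T g v := by
        rw [mul_smul, ← hc, ← map_smul, ← h1, V.P_P]
      have h0 : T g v ≠ 0 := fun h => hv ((map_eq_zero_iff _ (T g).injective).1 h)
      exact (smul_left_injective ℂ h0 (h2.symm.trans (one_smul ℂ _).symm))
    obtain ⟨δ, rfl⟩ := exists_sgn_eq hc2
    refine ⟨δ, fun v => ?_⟩
    rw [← map_smul, ← hc, V.P_P]
  choose δ hδ using hP
  -- `T_g T_h` and `T_{gh}` implement the same automorphism `τ (g * h)`.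
  have hmul : ∀ g h, ∃ c : ℂ, c ≠ 0 ∧ ∀ v, T g (T h v) = c • T (g * h) v := fun g h =>
    eq_smul_of_conj_eq (hT (g * h)) (T' := (T h).trans (T g)) (fun c v => by
      rw [AddEquiv.trans_apply, AddEquiv.trans_apply, hT, hT, map_mul, conjPow_mul]) (fun f f' h' v => by
      rw [AddEquiv.trans_apply, AddEquiv.trans_apply, hconj _ f f' h', map_mul, RingAut.mul_apply,
        hTE, hTE, AlgEquiv.apply_symm_apply])
  choose c hc0 hc using hmul
  -- Both sides of `T_g T_h = c T_{gh}` must commute with `P` up to the same sign.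
  have hδmul : ∀ g h, δ (g * h) = δ g + δ h := fun g h => by
    obtain ⟨v, hv⟩ := exists_ne (0 : V.carrier)
    have h1 := hc g h (V.P v)
    rw [hδ h, hT, conjPow_sgn, hδ g, smul_smul, hc, hδ (g * h), map_smul, smul_comm _ (c g h)] at h1
    have h2 := smul_right_injective _ (hc0 g h) h1
    have h0 : V.P (T (g * h) v) ≠ 0 := fun h => by
      have := congrArg V.P h
      rw [V.P_P, map_zero, map_eq_zero_iff _ (T _).injective] at this
      exact hv this
    refine sgn_injective ?_
    rw [sgn_add, mul_comm]
    exact (smul_left_injective ℂ h0 h2).symm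
  let R : ProjRep φ :=
    { toSSpace := V
      T := T
      T_smul := hT
      deg := AddMonoidHom.mk' (fun g => δ g.toMul) fun g h => hδmul g.toMul h.toMul
      T_P := hδ
      c := fun p => TwistedUnits.mk0 (c p.1 p.2) (hc0 p.1 p.2)
      T_mul := hc }
  refine ⟨R, ⟨⟨e, fun g a => ?_⟩⟩⟩
  exact ((R.conj_eq_iff g (E a) (E (A.τ g a))).2 fun v => hTE g a v).symm

namespace ProjRep

/-- Projective representations with isomorphic endomorphism algebras have the same degree
character and cohomologous cocycles. -/
theorem eq_of_iso {R S : ProjRep φ} (e : MagAlg.Iso R.alg S.alg) :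
    R.deg = S.deg ∧ groupCohomology.IsMulCoboundary₂ (fun p => S.c p / R.c p) := by
  let E : Module.End ℂ R.carrier ≃ₐ[ℂ] Module.End ℂ S.carrier := e.toEquiv
  have hEτ : ∀ g f, E (R.conj g f) = S.conj g (E f) := e.map_τ
  have hEP : ∀ f, E (R.P * (f * R.P)) = S.P * (E f * S.P) := fun f =>
    (congrArg E (R.toSSpace.alg_parity f)).symm.trans
      ((e.map_parity f).trans (S.toSSpace.alg_parity _))
  -- The isomorphism is conjugation by a linear `U`. It respects parity and the action only through
  -- conjugation, so `U` intertwines the parity operators up to a sign `δ`, and `T_g` with `S_g` up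
  -- to a scalar `x_g`.
  obtain ⟨U, hU⟩ := E.eq_linearEquivConjAlgEquiv
  have hU' : ∀ f v, E f (U v) = U (f v) := fun f v => by
    have h := LinearMap.congr_fun (AlgEquiv.congr_fun hU f) (U v)
    simpa [LinearEquiv.conjAlgEquiv_apply] using h
  have hUf : ∀ (f : Module.End ℂ R.carrier) (f' : Module.End ℂ S.carrier),
      (∀ v, f' (U v) = U (f v)) → f' = E f := fun f f' h => LinearMap.ext fun v => by
    obtain ⟨v, rfl⟩ := U.surjective v
    rw [h, hU']
  obtain ⟨δ, hδ⟩ : ∃ δ : ZMod 2, ∀ v, S.P (U v) = sgn δ • U (R.P v) := by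
    obtain ⟨κ, -, hκ⟩ := eq_smul_of_conj_eq (d := 1) (T := U.toAddEquiv)
      (T' := ((R.pwEquiv 1).toAddEquiv.trans U.toAddEquiv).trans (S.pwEquiv 1).toAddEquiv)
      (fun c v => by rw [conjPow_one]; exact map_smul U c v)
      (fun c v => by
        rw [conjPow_one]
        change S.pw 1 (U (R.pw 1 (c • v))) = c • S.pw 1 (U (R.pw 1 v))
        rw [map_smul, map_smul, map_smul])
      (fun f f' h v => by
        change f' (S.pw 1 (U (R.pw 1 v))) = S.pw 1 (U (R.pw 1 (f v)))
        rw [SSpace.pw_one, SSpace.pw_one, hUf f f' h]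
        have h1 := hU' (R.P * (f * R.P)) (R.P v)
        rw [hEP] at h1
        simp only [Module.End.mul_apply, SSpace.P_P] at h1
        rw [← h1, SSpace.P_P])
    have hκ' : ∀ v, S.P (U (R.P v)) = κ • U v := fun v => by
      have := hκ v
      change S.pw 1 (U (R.pw 1 v)) = κ • U v at this
      rwa [SSpace.pw_one, SSpace.pw_one] at this
    have hPU : ∀ v, S.P (U v) = κ • U (R.P v) := fun v => by
      rw [← hκ', SSpace.P_P]
    obtain ⟨v, hv⟩ := exists_ne (0 : R.carrier)
    have h1 : (κ * κ) • U v = U v := by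
      rw [mul_smul, ← hκ', ← map_smul, ← hPU, SSpace.P_P]
    have h0 : U v ≠ 0 := fun h => hv ((map_eq_zero_iff _ U.injective).1 h)
    obtain ⟨δ, rfl⟩ := exists_sgn_eq (smul_left_injective ℂ h0 (h1.trans (one_smul ℂ _).symm))
    exact ⟨δ, hPU⟩
  have hx : ∀ g, ∃ c : ℂ, c ≠ 0 ∧ ∀ v, S.T g (U v) = c • U (R.T g v) := fun g =>
    eq_smul_of_conj_eq (d := φ g) (T := (R.T g).trans U.toAddEquiv)
      (T' := U.toAddEquiv.trans (S.T g))
      (fun c v => by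
        change U (R.T g (c • v)) = conjPow (φ g) c • U (R.T g v)
        rw [R.T_smul, map_smul])
      (fun c v => by
        change S.T g (U (c • v)) = conjPow (φ g) c • S.T g (U v)
        rw [map_smul, S.T_smul])
      (fun f f' h v => by
        change f' (S.T g (U v)) = S.T g (U (f v))
        have hf' : f' = E (R.conj g f) := hUf _ _ fun v => by
          obtain ⟨v, rfl⟩ := (R.T g).surjective v
          rw [conj_apply_T]
          exact h v
        rw [hf', hEτ, conj_apply_T, hU'])
  choose x hx0 hx using hx
  have hUT0 : ∀ g v, v ≠ 0 → U (R.T g v) ≠ 0 := fun g v hv h => hv (by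
    rwa [map_eq_zero_iff _ U.injective, map_eq_zero_iff _ (R.T g).injective] at h)
  obtain ⟨v, hv⟩ := exists_ne (0 : R.carrier)
  have hPv : R.P v ≠ 0 := fun h => hv (by rw [← R.P_P v, h, map_zero])
  constructor
  · refine AddMonoidHom.ext fun g => sgn_injective ?_
    obtain ⟨g, rfl⟩ := Additive.ofMul.surjective g
    have h1 := S.T_P g (U v)
    rw [hδ, S.T_smul, conjPow_sgn, hx, hx, R.T_P, map_smul, map_smul, hδ] at h1
    have hPT : R.P (R.T g v) ≠ 0 := fun h => hv (by
      have := congrArg R.P h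
      rwa [R.P_P, map_zero, map_eq_zero_iff _ (R.T g).injective] at this)
    have h0 : U (R.P (R.T g v)) ≠ 0 := fun h => hPT ((map_eq_zero_iff _ U.injective).1 h)
    simp only [smul_smul] at h1
    have h2 := smul_left_injective ℂ h0 h1
    have h3 : (sgn δ * x g) * sgn (R.deg (Additive.ofMul g)) =
        (sgn δ * x g) * sgn (S.deg (Additive.ofMul g)) := by
      linear_combination h2
    exact mul_left_cancel₀ (mul_ne_zero (sgn_ne_zero _) (hx0 g)) h3
  -- The intertwining scalars form the cochain whose coboundary compares the two cocycles.
  · refine ⟨fun g => TwistedUnits.mk0 (x g) (hx0 g), fun g h => ?_⟩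
    have h1 := S.T_mul g h (U v)
    rw [hx, S.T_smul, hx, R.T_mul, hx, map_smul] at h1
    simp only [smul_smul] at h1
    have h2 := smul_left_injective ℂ (hUT0 (g * h) v hv) h1
    rw [eq_div_iff_mul_eq', mul_assoc, div_mul_eq_mul_div, div_eq_iff_eq_mul]
    refine TwistedUnits.val_injective ?_
    simp only [TwistedUnits.val_mul, TwistedUnits.val_smul, TwistedUnits.val_mk0]
    linear_combination h2

end ProjRep

/-! ### Splitting a super vector space -/

namespace SSpace

variable (V : SSpace)

/-- The homogeneous parts of a super vector space. -/
abbrev homPart (i : ZMod 2) : FDSpace where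
  carrier := LinearMap.ker (V.P - sgn i • (1 : Module.End ℂ V.carrier))

theorem mem_homPart_iff {i : ZMod 2} {v : V.carrier} :
    v ∈ LinearMap.ker (V.P - sgn i • (1 : Module.End ℂ V.carrier)) ↔ V.P v = sgn i • v := by
  rw [LinearMap.mem_ker, LinearMap.sub_apply, sub_eq_zero]
  rfl

theorem P_homPart {i : ZMod 2} (v : (V.homPart i).carrier) :
    V.P (v : V.carrier) = sgn i • (v : V.carrier) := V.mem_homPart_iff.1 v.2

theorem P_homPart_zero (v : (V.homPart 0).carrier) : V.P (v : V.carrier) = (v : V.carrier) :=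
  (V.P_homPart v).trans ((congrArg (· • (v : V.carrier)) sgn_zero).trans (one_smul ℂ _))

theorem P_homPart_one (v : (V.homPart 1).carrier) : V.P (v : V.carrier) = -(v : V.carrier) :=
  (V.P_homPart v).trans ((congrArg (· • (v : V.carrier)) sgn_one).trans (neg_one_smul ℂ _))

/-- The projection to a homogeneous part. -/
def homProj (i : ZMod 2) : V.carrier →ₗ[ℂ] (V.homPart i).carrier :=
  LinearMap.codRestrict _ ((1 / 2 : ℂ) • (1 + sgn i • V.P)) fun v => by
    rw [mem_homPart_iff]
    simp only [LinearMap.smul_apply, LinearMap.add_apply, Module.End.one_apply, map_smul, map_add,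
      V.P_P]
    rw [smul_comm (sgn i), smul_add (sgn i), smul_smul (sgn i), sgn_mul_self, one_smul, add_comm]

theorem coe_homProj (i : ZMod 2) (v : V.carrier) :
    (V.homProj i v : V.carrier) = (1 / 2 : ℂ) • (v + sgn i • V.P v) := rfl

/-- A super vector space is the sum of its homogeneous parts. -/
def split : V.carrier ≃ₗ[ℂ] (V.homPart 0).carrier × (V.homPart 1).carrier :=
  LinearEquiv.ofLinearMap ((V.homProj 0).prod (V.homProj 1))
    (LinearMap.coprod (Submodule.subtype _) (Submodule.subtype _))
    (LinearMap.ext fun v => by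
      have h0 := V.P_homPart_zero v.1
      have h1 := V.P_homPart_one v.2
      refine Prod.ext (Subtype.ext ?_) (Subtype.ext ?_)
      · change (V.homProj 0 ((v.1 : V.carrier) + (v.2 : V.carrier)) : V.carrier) = v.1
        rw [coe_homProj, map_add, h0, h1]
        generalize (v.1 : V.carrier) = x
        generalize (v.2 : V.carrier) = y
        rw [sgn_zero]
        module
      · change (V.homProj 1 ((v.1 : V.carrier) + (v.2 : V.carrier)) : V.carrier) = v.2
        rw [coe_homProj, map_add, h0, h1]
        generalize (v.1 : V.carrier) = x
        generalize (v.2 : V.carrier) = y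
        rw [sgn_one]
        module)
    (LinearMap.ext fun v => by
      change (V.homProj 0 v : V.carrier) + (V.homProj 1 v : V.carrier) = v
      rw [coe_homProj, coe_homProj, sgn_zero, sgn_one]
      module)

theorem split_symm_apply (v : (V.homPart 0).carrier × (V.homPart 1).carrier) :
    V.split.symm v = (v.1 : V.carrier) + (v.2 : V.carrier) := rfl

theorem split_P (v : V.carrier) : V.split (V.P v) = vparity _ _ (V.split v) := by
  obtain ⟨w, rfl⟩ := V.split.symm.surjective v
  rw [LinearEquiv.apply_symm_apply, ← LinearEquiv.eq_symm_apply, split_symm_apply, split_symm_apply,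
    map_add, P_homPart_zero, P_homPart_one]
  rfl

/-- The endomorphism algebra of a super vector space in terms of its homogeneous parts. -/
def splitIso : GrAlg.Iso V.alg (GrAlg.endo (V.homPart 0) (V.homPart 1)) where
  toEquiv := V.split.conjAlgEquiv ℂ
  map_mem i (f : Module.End ℂ V.carrier) hf := by
    refine (mem_endGrading_iff _ _ i _).2 (LinearMap.ext fun v => ?_)
    obtain ⟨v, rfl⟩ := V.split.surjective v
    have h := LinearMap.congr_fun (P_mul_of_mem hf) (V.P v)
    rw [Module.End.mul_apply, LinearMap.smul_apply, Module.End.mul_apply, V.P_P] at h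
    change vparity _ _ (V.split (f (V.split.symm (vparity _ _ (V.split v))))) =
      sgn i • V.split (f (V.split.symm (V.split v)))
    have h1 : V.split.symm (vparity _ _ (V.split v)) = V.P v :=
      V.split.symm_apply_eq.2 (V.split_P v).symm
    rw [← split_P, LinearEquiv.symm_apply_apply, h1, h, map_smul]

end SSpace

/-! ### Trivial algebras -/

/-- A magnetic equivariant graded algebra is trivial if it is the endomorphism algebra of a pair of
magnetic representations. -/
def MagAlg.IsTrivial (A : MagAlg φ) : Prop :=
  ∃ V₀ V₁ : MagRep φ, Nontrivial (V₀.carrier × V₁.carrier) ∧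
    Nonempty (MagAlg.Iso A (MagAlg.endo V₀ V₁))

/-- The sum of two magnetic representations as a projective representation. -/
def MagRep.sum (V₀ V₁ : MagRep φ) (h : Nontrivial (V₀.carrier × V₁.carrier)) : ProjRep φ where
  carrier := V₀.carrier × V₁.carrier
  P := vparity V₀.carrier V₁.carrier
  P_sq := LinearMap.ext (vparity_vparity _ _)
  nontriv := h
  T g :=
    { toFun := MagAlg.sumMap V₀ V₁ g
      invFun := MagAlg.sumMap V₀ V₁ g⁻¹
      left_inv v := by rw [← MagAlg.sumMap_mul, inv_mul_cancel, MagAlg.sumMap_one]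
      right_inv v := by rw [← MagAlg.sumMap_mul, mul_inv_cancel, MagAlg.sumMap_one]
      map_add' := map_add _ }
  T_smul g := map_smulₛₗ (MagAlg.sumMap V₀ V₁ g)
  deg := 0
  T_P g v := by
    rw [AddMonoidHom.zero_apply, sgn_zero, one_smul]
    change MagAlg.sumMap V₀ V₁ g (vparity _ _ v) = vparity _ _ (MagAlg.sumMap V₀ V₁ g v)
    simp [vparity, MagAlg.sumMap]
  c := 1
  T_mul g h v := by
    rw [Pi.one_apply, TwistedUnits.val_one, one_smul]
    exact (MagAlg.sumMap_mul V₀ V₁ g h v).symm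

/-- The endomorphism algebra of a sum of magnetic representations. -/
def MagRep.sumIso (V₀ V₁ : MagRep φ) (h : Nontrivial (V₀.carrier × V₁.carrier)) :
    MagAlg.Iso (MagAlg.endo V₀ V₁) (MagRep.sum V₀ V₁ h).alg where
  toEquiv := AlgEquiv.refl
  map_mem i (f : Module.End ℂ (V₀.carrier × V₁.carrier)) hf := by
    refine SSpace.mem_alg_iff.2 ?_
    have h1 : vparity _ _ * f * vparity _ _ = sgn i • f := (mem_endGrading_iff _ _ i f).1 hf
    have h2 : vparity V₀.carrier V₁.carrier * vparity V₀.carrier V₁.carrier = 1 :=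
      LinearMap.ext (vparity_vparity _ _)
    have h3 : vparity _ _ * f = sgn i • (f * vparity _ _) := by
      rw [← smul_mul_assoc, ← h1, mul_assoc, mul_assoc, h2, mul_one]
    exact h3
  map_τ g f := rfl

namespace ProjRep

variable (R : ProjRep φ)

theorem homPart_T (h : R.deg = 0) (g : G) (i : ZMod 2) (v : (R.homPart i).carrier) :
    R.T g (v : R.carrier) ∈ LinearMap.ker (R.P - sgn i • (1 : Module.End ℂ R.carrier)) := by
  rw [SSpace.mem_homPart_iff]
  have h1 := R.T_P g v
  rw [h, AddMonoidHom.zero_apply, sgn_zero, one_smul] at h1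
  rw [← h1, R.P_homPart, R.T_smul, conjPow_sgn]

/-- The homogeneous parts of a linear representation. -/
def homRep (h : R.deg = 0) (hc : R.c = 1) (i : ZMod 2) : MagRep φ where
  toFDSpace := R.homPart i
  ρ :=
    { toFun g :=
        { toFun v := ⟨R.T g (v : R.carrier), R.homPart_T h g i v⟩
          map_zero' := Subtype.ext (map_zero (R.T g))
          map_add' v w := Subtype.ext (map_add (R.T g) _ _) }
      map_one' := AddMonoidHom.ext fun v => Subtype.ext ((R.T 1).injective (by
        have := R.T_mul 1 1 v
        rw [hc, Pi.one_apply, TwistedUnits.val_one, one_smul, mul_one] at this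
        exact this))
      map_mul' g g' := AddMonoidHom.ext fun v => Subtype.ext (by
        have := R.T_mul g g' v
        rw [hc, Pi.one_apply, TwistedUnits.val_one, one_smul] at this
        exact this.symm) }
  ρ_smul g c v := Subtype.ext (R.T_smul g c _)

/-- With trivial cocycle the operators form an honest magnetic representation, and in degree zero
they commute with `P`, so both eigenspaces of `P` are subrepresentations. -/
theorem isTrivial_of_eq_one (h : R.deg = 0) (hc : R.c = 1) : R.alg.IsTrivial := by
  have hT : ∀ g v, R.split (R.T g v) =
      MagAlg.sumMap (R.homRep h hc 0) (R.homRep h hc 1) g (R.split v) := fun g v => by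
    obtain ⟨w, rfl⟩ := R.split.symm.surjective v
    refine (R.split.eq_symm_apply.1 ?_).trans
      (congrArg (MagAlg.sumMap (R.homRep h hc 0) (R.homRep h hc 1) g)
        (R.split.apply_symm_apply w)).symm
    rw [SSpace.split_symm_apply, map_add]
    rfl
  refine ⟨R.homRep h hc 0, R.homRep h hc 1, R.split.symm.toEquiv.nontrivial,
    ⟨⟨R.splitIso, fun g (f : Module.End ℂ R.carrier) => ?_⟩⟩⟩
  refine LinearMap.ext fun v => ?_
  change R.split (R.T g (f ((R.T g).symm (R.split.symm v)))) =
    MagAlg.sumMap (R.homRep h hc 0) (R.homRep h hc 1) g (R.split (f (R.split.symm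
      (MagAlg.sumMap (R.homRep h hc 0) (R.homRep h hc 1) g⁻¹ v))))
  refine (hT _ _).trans ?_
  refine congrArg (fun w => MagAlg.sumMap (R.homRep h hc 0) (R.homRep h hc 1) g (R.split (f w))) ?_
  refine (R.T g).symm_apply_eq.2 (R.split.injective ?_)
  refine Eq.trans ?_ (hT _ _).symm
  refine (R.split.apply_symm_apply v).trans ?_
  refine Eq.trans ?_ (congrArg (MagAlg.sumMap (R.homRep h hc 0) (R.homRep h hc 1) g)
    (R.split.apply_symm_apply _)).symm
  have h1 := MagAlg.sumMap_mul (R.homRep h hc 0) (R.homRep h hc 1) g g⁻¹ v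
  rw [mul_inv_cancel, MagAlg.sumMap_one] at h1
  exact h1

/-- Rescaling the operators of a projective representation. -/
def rescale (x : G → TwistedUnits φ) : ProjRep φ where
  toSSpace := R.toSSpace
  T g := (R.T g).trans
    (DistribMulAction.toAddEquiv R.carrier (Units.mk0 _ (TwistedUnits.val_ne_zero (x g))))
  T_smul g c v := by
    change (x g).val • R.T g (c • v) = conjPow (φ g) c • (x g).val • R.T g v
    rw [R.T_smul, smul_comm]
  deg := R.deg
  T_P g v := by
    change (x g).val • R.T g (R.P v) = _ • R.P ((x g).val • R.T g v)
    rw [R.T_P, map_smul, smul_comm]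
  c p := R.c p * (p.1 • x p.2 / x (p.1 * p.2) * x p.1)
  T_mul g h v := by
    change (x g).val • R.T g ((x h).val • R.T h v) = _ • (x (g * h)).val • R.T (g * h) v
    rw [R.T_smul, R.T_mul, smul_smul, smul_smul, smul_smul, ← TwistedUnits.val_smul,
      ← TwistedUnits.val_mul, ← TwistedUnits.val_mul, ← TwistedUnits.val_mul]
    congr 2
    rw [mul_assoc (R.c (g, h)), mul_right_comm (g • x h / x (g * h)), div_mul_cancel, mul_comm (R.c _)]
    congr 1
    exact mul_comm _ _

/-- Rescaling does not change the endomorphism algebra. -/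
def rescaleIso (x : G → TwistedUnits φ) : MagAlg.Iso R.alg (R.rescale x).alg where
  toEquiv := AlgEquiv.refl
  map_mem _ _ h := h
  map_τ g (f : Module.End ℂ R.carrier) := by
    refine Eq.symm (((R.rescale x).conj_eq_iff g f (R.conj g f)).2 fun (v : R.carrier) => ?_)
    change R.conj g f ((x g).val • R.T g v) = (x g).val • R.T g (f v)
    rw [map_smul, conj_apply_T]

/-- Dividing each `T_g` by the value of a trivializing cochain kills the cocycle and leaves all
conjugations unchanged. -/
theorem isTrivial_of_isMulCoboundary (h : R.deg = 0) (hc : groupCohomology.IsMulCoboundary₂ R.c) :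
    R.alg.IsTrivial := by
  obtain ⟨x, hx⟩ := hc
  obtain ⟨V₀, V₁, hV, ⟨e⟩⟩ := (R.rescale x⁻¹).isTrivial_of_eq_one h (funext fun p => by
    change R.c p * (p.1 • (x p.2)⁻¹ / (x (p.1 * p.2))⁻¹ * (x p.1)⁻¹) = 1
    rw [← hx, smul_inv']
    simp only [div_eq_mul_inv, inv_inv]
    rw [mul_assoc (p.1 • x p.2), mul_assoc (p.1 • x p.2)⁻¹]
    rw [mul_mul_mul_comm, mul_inv_cancel, one_mul, mul_mul_mul_comm, inv_mul_cancel, one_mul,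
      mul_inv_cancel])
  exact ⟨V₀, V₁, hV, ⟨(R.rescaleIso x⁻¹).trans e⟩⟩

theorem hasDegreeCharacter {A : MagAlg φ} (e : MagAlg.Iso A R.alg) :
    A.HasDegreeCharacter R.deg := by
  refine ⟨R.homPart 0, R.homPart 1, e.toIso.trans R.splitIso, fun g =>
    ⟨(R.split.symm.toAddEquiv.trans (R.T g)).trans R.split.toAddEquiv, fun c v => ?_,
      fun i v hv => ?_, fun a v => ?_⟩⟩
  · change R.split (R.T g (R.split.symm (c • v))) = conjPow (φ g) c • R.split (R.T g (R.split.symm v))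
    rw [map_smul, R.T_smul, map_smul]
  · rw [mem_part_iff] at hv ⊢
    change vparity _ _ (R.split (R.T g (R.split.symm v))) =
      sgn (i + R.deg (Additive.ofMul g)) • R.split (R.T g (R.split.symm v))
    have h1 : R.P (R.split.symm v) = sgn i • R.split.symm v := by
      rw [← R.split.injective.eq_iff, R.split_P, map_smul, LinearEquiv.apply_symm_apply, hv]
    have h2 := R.T_P g (R.split.symm v)
    rw [h1, R.T_smul, conjPow_sgn] at h2
    rw [← R.split_P, ← map_smul, add_comm, sgn_add, mul_smul, h2, smul_smul, sgn_mul_self, one_smul]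
  · let E : A.carrier → Module.End ℂ R.carrier := e.toEquiv
    have hE : E (A.τ g a) = R.conj g (E a) := e.map_τ g a
    change R.split (E (A.τ g a) (R.split.symm (R.split (R.T g (R.split.symm v))))) =
      R.split (R.T g (R.split.symm (R.split (E a (R.split.symm v)))))
    rw [LinearEquiv.symm_apply_apply, LinearEquiv.symm_apply_apply, hE, R.conj_apply_T]

end ProjRep

/-! ### Examples of projective representations -/

/-- The twisted regular representation of a cocycle. -/
def twistedRegular [Finite G] (f : G × G → TwistedUnits φ)
    (hf : groupCohomology.IsMulCocycle₂ f) : ProjRep φ where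
  carrier := G → ℂ
  P := 1
  P_sq := one_mul 1
  nontriv := inferInstance
  T g :=
    -- On the standard basis this is `T_g δ_y = f(g, y) δ_{gy}`, extended semilinearly.
    { toFun v x := (f (g, g⁻¹ * x)).val * conjPow (φ g) (v (g⁻¹ * x))
      invFun w y := conjPow (φ g) ((f (g, y)).val⁻¹ * w (g * y))
      left_inv v := funext fun y => by
        simp only [inv_mul_cancel_left]
        rw [inv_mul_cancel_left₀ (TwistedUnits.val_ne_zero _), conjPow_conjPow]
      right_inv w := funext fun x => by
        simp only [mul_inv_cancel_left]
        rw [conjPow_conjPow, mul_inv_cancel_left₀ (TwistedUnits.val_ne_zero _)]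
      map_add' v w := funext fun x => by
        simp only [Pi.add_apply, map_add, mul_add] }
  T_smul g c v := funext fun x => by
    change _ * conjPow (φ g) (c * _) = conjPow (φ g) c * (_ * _)
    rw [map_mul, mul_left_comm]
  deg := 0
  T_P g v := by
    rw [AddMonoidHom.zero_apply, sgn_zero, one_smul]
    rfl
  c := f
  T_mul g h v := funext fun x => by
    change (f (g, g⁻¹ * x)).val * conjPow (φ g) ((f (h, h⁻¹ * (g⁻¹ * x))).val *
      conjPow (φ h) (v (h⁻¹ * (g⁻¹ * x)))) = (f (g, h)).val * ((f (g * h, (g * h)⁻¹ * x)).val *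
        conjPow (φ (g * h)) (v ((g * h)⁻¹ * x)))
    have h1 := hf g h ((g * h)⁻¹ * x)
    rw [map_mul, map_mul, conjPow_mul, mul_inv_rev, mul_assoc h⁻¹, ← mul_assoc, ← mul_assoc (f (g, h)).val,
      ← TwistedUnits.val_smul, ← TwistedUnits.val_mul, ← TwistedUnits.val_mul]
    rw [mul_inv_rev, mul_assoc h⁻¹, mul_inv_cancel_left] at h1
    rw [mul_comm (f (g, h)), h1, mul_comm (f (g, g⁻¹ * x))]

/-- The powers of the swap of `ℂ × ℂ`. -/
def swapPow (d : ZMod 2) : (ℂ × ℂ) ≃ₗ[ℂ] (ℂ × ℂ) :=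
  if d = 0 then LinearEquiv.refl ℂ _ else LinearEquiv.prodComm ℂ ℂ ℂ

theorem swapPow_zero (v : ℂ × ℂ) : swapPow 0 v = v := rfl

theorem swapPow_one (v : ℂ × ℂ) : swapPow 1 v = (v.2, v.1) := rfl

theorem swapPow_add (d e : ZMod 2) (v : ℂ × ℂ) : swapPow (d + e) v = swapPow d (swapPow e v) := by
  have h : (1 : ZMod 2) + 1 = 0 := by decide
  rcases zmod_two_cases d with rfl | rfl <;> rcases zmod_two_cases e with rfl | rfl <;>
    simp [swapPow_zero, swapPow_one, h]

/-- Complex conjugation on `ℂ × ℂ`. -/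
def conjProd (d : Multiplicative (ZMod 2)) : (ℂ × ℂ) ≃+ (ℂ × ℂ) :=
  AddEquiv.prodCongr (conjPowEquiv d) (conjPowEquiv d)

theorem conjProd_apply (d : Multiplicative (ZMod 2)) (v : ℂ × ℂ) :
    conjProd d v = (conjPow d v.1, conjPow d v.2) := rfl

theorem conjProd_mul (d e : Multiplicative (ZMod 2)) (v : ℂ × ℂ) :
    conjProd (d * e) v = conjProd d (conjProd e v) := by
  simp only [conjProd_apply, conjPow_mul]

theorem swapPow_conjProd (d : ZMod 2) (e : Multiplicative (ZMod 2)) (v : ℂ × ℂ) :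
    swapPow d (conjProd e v) = conjProd e (swapPow d v) := by
  rcases zmod_two_cases d with rfl | rfl <;> rfl

/-- The magnetic representation on `ℂ ⊕ ℂ` whose operators have degree `χ`. -/
abbrev swapRep (χ : Additive G →+ ZMod 2) : ProjRep φ where
  toSSpace := plane
  T g := (conjProd (φ g)).trans (swapPow (χ (Additive.ofMul g))).toAddEquiv
  T_smul g c v := by
    change swapPow _ (conjProd (φ g) (c • v)) = conjPow (φ g) c • swapPow _ (conjProd (φ g) v)
    rw [← map_smul]
    congr 1
    exact Prod.ext (map_mul (conjPow (φ g)) c v.1) (map_mul (conjPow (φ g)) c v.2)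
  deg := χ
  T_P g v := by
    change swapPow _ (conjProd (φ g) (v.1, -v.2)) =
      sgn _ • plane.P (swapPow _ (conjProd (φ g) v))
    rcases zmod_two_cases (χ (Additive.ofMul g)) with h | h
    · rw [h, swapPow_zero, swapPow_zero, sgn_zero, one_smul, plane_P_apply, conjProd_apply,
        conjProd_apply, map_neg]
    · rw [h, swapPow_one, swapPow_one, sgn_one, neg_one_smul, plane_P_apply, conjProd_apply,
        conjProd_apply, map_neg, Prod.neg_mk, neg_neg]
  -- The swap is an involution commuting with coordinatewise conjugation, so the operators compose
  -- without any scalar.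
  c := 1
  T_mul g h v := by
    rw [Pi.one_apply, TwistedUnits.val_one, one_smul]
    change swapPow _ (conjProd (φ g) (swapPow _ (conjProd (φ h) v))) =
      swapPow _ (conjProd (φ (g * h)) v)
    rw [← swapPow_conjProd, ← conjProd_mul, ← swapPow_add, ← map_add, ← map_mul, ofMul_mul]

/-- The Clifford algebra of rank one, on which the group acts by powers of complex conjugation. -/
abbrev cliffMag (φ : G →* Multiplicative (ZMod 2)) : MagAlg φ where
  toGrAlg := cliff
  τ :=
    { toFun g :=
        { conjProd (φ g) with
          map_mul' := fun u v => Prod.ext (map_mul (conjPow (φ g)) u.1 v.1)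
            (map_mul (conjPow (φ g)) u.2 v.2) }
      map_one' := RingEquiv.ext fun v => by
        change conjProd (φ 1) v = v
        rw [map_one, conjProd_apply, conjPow_one, conjPow_one]
      map_mul' g h := RingEquiv.ext fun v => by
        change conjProd (φ (g * h)) v = conjProd (φ g) (conjProd (φ h) v)
        rw [map_mul, conjProd_mul] }
  τ_smul g c v := Prod.ext (map_mul (conjPow (φ g)) c v.1) (map_mul (conjPow (φ g)) c v.2)
  τ_mem g i (v : ℂ × ℂ) hv := by
    refine mem_cliff_iff.2 ?_
    change conjPow (φ g) v.2 = sgn i * conjPow (φ g) v.1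
    rw [mem_cliff_iff.1 hv, map_mul, conjPow_sgn]

/-- The homomorphism `φ`, written additively. -/
def addHom (φ : G →* Multiplicative (ZMod 2)) : Additive G →+ ZMod 2 := MonoidHom.toAdditiveLeft φ

theorem conj_pauliX (g : G) : (swapRep (φ := φ) (addHom φ)).conj g pauliX = pauliX := by
  refine ((swapRep (φ := φ) (addHom φ)).conj_eq_iff g _ _).2 fun v => ?_
  change pauliX (swapPow _ (conjProd (φ g) v)) = swapPow _ (conjProd (φ g) (pauliX v))
  rcases zmod_two_cases (addHom φ (Additive.ofMul g)) with h | h <;> rw [h] <;> rfl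

/-- The entries of `Y` are `± i`, so complex conjugation negates it; conjugation by the swap, which
is `X`, negates it again. The two cancel exactly because the swap occurs for the antilinear
elements. Hence `Cl ⊗ Cl` has degree character `φ`. -/
theorem conj_pauliY (g : G) : (swapRep (φ := φ) (addHom φ)).conj g pauliY = pauliY := by
  refine ((swapRep (φ := φ) (addHom φ)).conj_eq_iff g _ _).2 fun v => ?_
  change pauliY (swapPow _ (conjProd (φ g) v)) = swapPow _ (conjProd (φ g) (pauliY v))
  rcases zmod_two_cases (addHom φ (Additive.ofMul g)) with h | h
  · have h' : φ g = 1 := h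
    rw [h, h', swapPow_zero, swapPow_zero]
    simp only [conjProd_apply, conjPow_one]
  · have h' : φ g = Multiplicative.ofAdd 1 := h
    have h1 : (Multiplicative.ofAdd (1 : ZMod 2)) ≠ 1 := by decide
    rw [h, h', swapPow_one, swapPow_one, conjProd_apply, conjProd_apply, pauliY_apply,
      pauliY_apply]
    simp [conjPow, h1]

theorem conj_cliffHom (R : ProjRep φ) (g : G) (z : Module.End ℂ R.carrier) (hz : z * z = 1)
    (h : R.conj g z = z) (u : ℂ × ℂ) :
    R.conj g (cliffHom z hz u) = cliffHom z hz (conjProd (φ g) u) := by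
  rw [cliffHom_apply, cliffHom_apply, map_add, R.conj_smul, R.conj_smul, map_one, h, conjProd_apply,
    map_mul, map_mul, map_add, map_sub]
  simp [map_ofNat (conjPow (φ g)) 2]

/-- The tensor square of the Clifford algebra of rank one. -/
def cliffMagSq (φ : G →* Multiplicative (ZMod 2)) :
    MagAlg.Iso ((cliffMag φ).tensor (cliffMag φ)) (swapRep (φ := φ) (addHom φ)).alg :=
  MagAlg.Iso.ofTensor (C := (swapRep (addHom φ)).alg) cliffSq (fun g i j a _ b _ => by
    change cliffHom pauliX pauliX_sq (conjProd (φ g) a) * cliffHom pauliY pauliY_sq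
      (conjProd (φ g) b) = (swapRep (addHom φ)).conj g
        (cliffHom pauliX pauliX_sq a * cliffHom pauliY pauliY_sq b)
    refine Eq.symm ((map_mul ((swapRep (φ := φ) (addHom φ)).conj g) _ _).trans ?_)
    congr 1
    · exact (conj_cliffHom (swapRep (addHom φ)) g pauliX pauliX_sq (conj_pauliX g) a)
    · exact (conj_cliffHom (swapRep (addHom φ)) g pauliY pauliY_sq (conj_pauliY g) b))

theorem ProjRep.alg_isCentralSimple (R : ProjRep φ) : R.alg.toGrAlg.IsCentralSimple :=
  R.toSSpace.alg_isCentralSimple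

/-- A projective endomorphism algebra in degree zero is the endomorphism algebra of a projective
representation of degree zero with the same cocycle. -/
theorem MagAlg.IsProjectiveEnd.exists_projRep {A : MagAlg φ} (hA : A.toGrAlg.IsCentralSimple)
    {f : G × G → TwistedUnits φ} (h : A.IsProjectiveEnd f) :
    ∃ R : ProjRep φ, R.deg = 0 ∧ R.c = f ∧ Nonempty (MagAlg.Iso A R.alg) := by
  obtain ⟨V, T, θ, h1, h2, h3, h4⟩ := h
  have hV : Nontrivial V.carrier := by
    have := hA.nontrivial
    by_contra hV
    rw [not_nontrivial_iff_subsingleton] at hV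
    have h0 : θ 1 = θ 0 := LinearMap.ext fun v => Subsingleton.elim _ _
    exact one_ne_zero (θ.injective h0)
  let R : ProjRep φ :=
    { toFDSpace := V
      P := 1
      P_sq := one_mul 1
      nontriv := hV
      T := T
      T_smul := h1
      deg := 0
      T_P := fun g v => by
        rw [AddMonoidHom.zero_apply, sgn_zero, one_smul]
        rfl
      c := f
      T_mul := h2 }
  refine ⟨R, rfl, rfl, ⟨⟨GrAlg.Iso.ofParity (B := R.toSSpace.alg) θ fun a => ?_, fun g a => ?_⟩⟩⟩
  · have ha : a ∈ A.grading 0 := h3 ▸ Submodule.mem_top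
    rw [A.parity_apply ha, sgn_zero, one_smul, SSpace.alg_parity]
    change θ a = 1 * (θ a * 1)
    rw [one_mul, mul_one]
  · exact ((R.conj_eq_iff g (θ a) _).2 fun v => h4 g a v).symm

theorem twistedRegular_isProjectiveEnd [Finite G] (f : G × G → TwistedUnits φ)
    (hf : groupCohomology.IsMulCocycle₂ f) : (twistedRegular f hf).alg.IsProjectiveEnd f := by
  refine ⟨(twistedRegular f hf).toFDSpace, (twistedRegular f hf).T, AlgEquiv.refl,
    (twistedRegular f hf).T_smul, (twistedRegular f hf).T_mul, ?_, fun g a v =>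
      (twistedRegular f hf).conj_apply_T g a v⟩
  rw [eq_top_iff]
  intro a _
  refine SSpace.mem_alg_iff.2 ?_
  rw [sgn_zero, one_smul]
  change 1 * a = a * 1
  rw [one_mul, mul_one]

/-! ### Isomorphism classes -/

namespace MagAlg

/-- Isomorphism as an equivalence relation. -/
def isoSetoid (φ : G →* Multiplicative (ZMod 2)) : Setoid (MagAlg φ) where
  r A B := Nonempty (Iso A B)
  iseqv := ⟨fun A => ⟨Iso.refl A⟩, fun ⟨e⟩ => ⟨e.symm⟩, fun ⟨e⟩ ⟨f⟩ => ⟨e.trans f⟩⟩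

/-- Isomorphism classes of magnetic equivariant graded algebras. -/
def IsoClass (φ : G →* Multiplicative (ZMod 2)) : Type 1 := Quotient (isoSetoid φ)

/-- The isomorphism class of a magnetic equivariant graded algebra. -/
def isoClass (A : MagAlg φ) : IsoClass φ := Quotient.mk (isoSetoid φ) A

theorem isoClass_eq_iff {A B : MagAlg φ} : A.isoClass = B.isoClass ↔ Nonempty (Iso A B) :=
  Quotient.eq (r := isoSetoid φ)

/-- On isomorphism classes, similarity is equality up to multiplication by trivial classes in a
commutative semigroup, so its formal properties reduce to rewriting. -/
instance : CommSemigroup (IsoClass φ) where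
  mul := Quotient.map₂ tensor fun _ _ ⟨e⟩ _ _ ⟨f⟩ => ⟨e.tensor f⟩
  mul_assoc := by
    rintro ⟨A⟩ ⟨B⟩ ⟨C⟩
    exact Quotient.sound (s := isoSetoid φ) ⟨Iso.assoc A B C⟩
  mul_comm := by
    rintro ⟨A⟩ ⟨B⟩
    exact Quotient.sound (s := isoSetoid φ) ⟨Iso.comm A B⟩

theorem isoClass_tensor (A B : MagAlg φ) :
    (A.tensor B).isoClass = A.isoClass * B.isoClass := rfl

theorem IsTrivial.of_iso {A B : MagAlg φ} (hA : A.IsTrivial) (e : Iso A B) : B.IsTrivial := by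
  obtain ⟨V₀, V₁, h, ⟨f⟩⟩ := hA
  exact ⟨V₀, V₁, h, ⟨e.symm.trans f⟩⟩

theorem IsTrivial.exists_projRep {A : MagAlg φ} (hA : A.IsTrivial) :
    ∃ R : ProjRep φ, R.deg = 0 ∧ R.c = 1 ∧ Nonempty (Iso A R.alg) := by
  obtain ⟨V₀, V₁, h, ⟨f⟩⟩ := hA
  exact ⟨V₀.sum V₁ h, rfl, rfl, ⟨f.trans (V₀.sumIso V₁ h)⟩⟩

/-- Degree zero makes the Koszul sign in the product cocycle disappear, so trivial degree and
trivial cocycle survive a tensor product. -/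
theorem IsTrivial.tensor {A B : MagAlg φ} (hA : A.IsTrivial) (hB : B.IsTrivial) :
    (A.tensor B).IsTrivial := by
  obtain ⟨R, hR, hRc, ⟨e⟩⟩ := hA.exists_projRep
  obtain ⟨S, hS, hSc, ⟨f⟩⟩ := hB.exists_projRep
  refine ((R.tensor S).isTrivial_of_eq_one ?_ ?_).of_iso
    ((e.tensor f).trans (R.algTensor S)).symm
  · rw [ProjRep.tensor_deg, hR, hS, add_zero]
  · funext p
    rw [ProjRep.tensor_c, hRc, hSc, hR]
    simp [TwistedUnits.sign_zero]

theorem isTrivial_swapRep (φ : G →* Multiplicative (ZMod 2)) :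
    (swapRep (φ := φ) 0).alg.IsTrivial :=
  (swapRep 0).isTrivial_of_eq_one rfl rfl

end MagAlg

/-! ### The magnetic equivariant graded Brauer group -/

namespace MECSGA

open MagAlg

theorem similar_iff {A B : MECSGA φ} : A.Similar B ↔ ∃ E F : MagAlg φ, E.IsTrivial ∧ F.IsTrivial ∧
    A.1.isoClass * E.isoClass = B.1.isoClass * F.isoClass := by
  constructor
  · rintro ⟨V₀, V₁, W₀, W₁, hV, hW, e⟩
    exact ⟨_, _, ⟨V₀, V₁, hV, ⟨MagAlg.Iso.refl _⟩⟩, ⟨W₀, W₁, hW, ⟨MagAlg.Iso.refl _⟩⟩,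
      isoClass_eq_iff.2 e⟩
  · rintro ⟨E, F, ⟨V₀, V₁, hV, hE⟩, ⟨W₀, W₁, hW, hF⟩, h⟩
    rw [isoClass_eq_iff.2 hE, isoClass_eq_iff.2 hF] at h
    exact ⟨V₀, V₁, W₀, W₁, hV, hW, isoClass_eq_iff.1 h⟩

theorem similar_equivalence (φ : G →* Multiplicative (ZMod 2)) :
    Equivalence (Similar (φ := φ)) where
  refl A := similar_iff.2 ⟨_, _, isTrivial_swapRep φ, isTrivial_swapRep φ, rfl⟩
  symm h := by
    obtain ⟨E, F, hE, hF, h⟩ := similar_iff.1 h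
    exact similar_iff.2 ⟨F, E, hF, hE, h.symm⟩
  trans {A B C} h h' := by
    obtain ⟨E, F, hE, hF, h⟩ := similar_iff.1 h
    obtain ⟨E', F', hE', hF', h'⟩ := similar_iff.1 h'
    refine similar_iff.2 ⟨E.tensor E', F'.tensor F, hE.tensor hE', hF'.tensor hF, ?_⟩
    rw [isoClass_tensor, isoClass_tensor, ← mul_assoc, ← mul_assoc, h, ← h', mul_right_comm]

theorem Similar.of_iso {A B : MECSGA φ} (e : MagAlg.Iso A.1 B.1) : A.Similar B :=
  similar_iff.2 ⟨_, _, isTrivial_swapRep φ, isTrivial_swapRep φ, by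
    rw [isoClass_eq_iff.2 ⟨e⟩]⟩

/-- The graded tensor product of magnetic equivariant central simple graded algebras. -/
def tensor (A B : MECSGA φ) : MECSGA φ := ⟨A.1.tensor B.1, A.2.tensor B.2⟩

theorem Similar.tensor_left (A : MECSGA φ) {B C : MECSGA φ} (h : B.Similar C) :
    (A.tensor B).Similar (A.tensor C) := by
  obtain ⟨E, F, hE, hF, h⟩ := similar_iff.1 h
  refine similar_iff.2 ⟨E, F, hE, hF, ?_⟩
  change A.1.isoClass * B.1.isoClass * _ = A.1.isoClass * C.1.isoClass * _
  rw [mul_assoc, h, mul_assoc]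

theorem tensor_comm_similar (A B : MECSGA φ) : (A.tensor B).Similar (B.tensor A) :=
  Similar.of_iso (MagAlg.Iso.comm _ _)

/-- The central simple graded algebra of a projective representation. -/
def ofRep (R : ProjRep φ) : MECSGA φ := ⟨R.alg, R.alg_isCentralSimple⟩

theorem tensor_trivial_similar (A : MECSGA φ) {B : MECSGA φ} (hB : B.1.IsTrivial) :
    (A.tensor B).Similar A := by
  refine similar_iff.2 ⟨_, _, isTrivial_swapRep φ, hB.tensor (isTrivial_swapRep φ), ?_⟩
  exact mul_assoc A.1.isoClass B.1.isoClass _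

/-- Tensoring with `Cl` moves an algebra of Clifford type into the endomorphism case, where
`exists_projRep` applies; in the other case a trivial algebra serves as the second factor. -/
theorem exists_tensor_iso_projRep (A : MECSGA φ) :
    ∃ (B : MECSGA φ) (R : ProjRep φ), Nonempty (MagAlg.Iso (A.tensor B).1 R.alg) := by
  rcases A.2.exists_iso with ⟨V, ⟨e⟩⟩ | ⟨V, ⟨e⟩⟩
  · obtain ⟨R, ⟨f⟩⟩ := exists_projRep A.1 V e
    exact ⟨ofRep (swapRep 0), R.tensor (swapRep 0),
      ⟨(f.tensor (MagAlg.Iso.refl _)).trans (R.algTensor _)⟩⟩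
  · obtain ⟨R, h⟩ := exists_projRep (A.1.tensor (cliffMag φ)) (V.tensor plane)
      ((GrAlg.Iso.tensor e (GrAlg.Iso.refl cliff)).trans (GrAlg.algCliffCliff V))
    exact ⟨⟨cliffMag φ, GrAlg.cliff_isCentralSimple⟩, R, h⟩

end MECSGA

/-! ### Inverse classes -/

theorem isMulCocycle₂_inv {f : G × G → TwistedUnits φ} (hf : groupCohomology.IsMulCocycle₂ f) :
    groupCohomology.IsMulCocycle₂ f⁻¹ := fun g h k => by
  simp only [Pi.inv_apply, smul_inv', ← mul_inv, hf g h k]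

/-- A projective representation whose tensor product with `R` is trivial. -/
def ProjRep.dual [Finite G] (R : ProjRep φ) : ProjRep φ :=
  -- `swapRep` cancels the degree of `R`; the twisted regular representation of the inverse cocycle
  -- then cancels what remains, including the sign created by the first tensor product.
  (swapRep R.deg).tensor
    (twistedRegular (R.tensor (swapRep R.deg)).c⁻¹ (isMulCocycle₂_inv (ProjRep.isMulCocycle₂ _)))

theorem ProjRep.dual_deg [Finite G] (R : ProjRep φ) : R.dual.deg = R.deg := add_zero R.deg

theorem ProjRep.dual_c [Finite G] (R : ProjRep φ) (p : G × G) : R.dual.c p = (R.c p)⁻¹ *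
    TwistedUnits.sign (R.deg (Additive.ofMul p.1) * R.deg (Additive.ofMul p.2)) := by
  change 1 * (R.c p * 1 * TwistedUnits.sign (R.deg (Additive.ofMul p.1) *
    R.deg (Additive.ofMul p.2)))⁻¹ * TwistedUnits.sign (R.deg (Additive.ofMul p.1) * 0) = _
  rw [one_mul, mul_one, mul_zero, TwistedUnits.sign_zero, mul_one, mul_inv, TwistedUnits.sign_inv]

namespace MECSGA

theorem exists_tensor_isTrivial [Finite G] (A : MECSGA φ) :
    ∃ B : MECSGA φ, (A.tensor B).1.IsTrivial := by
  obtain ⟨B, R, ⟨e⟩⟩ := A.exists_tensor_iso_projRep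
  refine ⟨B.tensor (ofRep R.dual), ?_⟩
  refine ((R.tensor R.dual).isTrivial_of_eq_one ?_ (funext fun p => ?_)).of_iso
    (((MagAlg.Iso.assoc A.1 B.1 R.dual.alg).symm.trans
      (e.tensor (MagAlg.Iso.refl _))).trans (R.algTensor R.dual)).symm
  · rw [ProjRep.tensor_deg, R.dual_deg]
    exact AddMonoidHom.ext fun g => CharTwo.add_self_eq_zero _
  · rw [ProjRep.tensor_c, R.dual_c, R.dual_deg, mul_inv_cancel_left, TwistedUnits.sign_mul_self]
    rfl

end MECSGA

namespace GrBr

open MECSGA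

theorem mk_eq_iff {A B : MECSGA φ} : mk A = mk B ↔ A.Similar B :=
  (similar_equivalence φ).quot_mk_eq_iff A B

theorem mk_eq_of_iso {A B : MECSGA φ} (e : MagAlg.Iso A.1 B.1) : mk A = mk B :=
  Quot.sound (Similar.of_iso e)

end GrBr

/-- The class of a trivial algebra. -/
local instance GrBr.zero : Zero (GrBr φ) := ⟨GrBr.mk (MECSGA.ofRep (swapRep 0))⟩

/-- The addition induced by the graded tensor product. -/
local instance GrBr.add : Add (GrBr φ) :=
  ⟨Quot.map₂ MECSGA.tensor (fun A _ _ h => h.tensor_left A) (fun A B C h =>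
    (MECSGA.similar_equivalence φ).trans (MECSGA.tensor_comm_similar A C)
      ((MECSGA.similar_equivalence φ).trans (h.tensor_left C) (MECSGA.tensor_comm_similar C B)))⟩

namespace GrBr

open MECSGA

theorem mk_eq_zero_of_isTrivial {A : MECSGA φ} (hA : A.1.IsTrivial) : mk A = 0 :=
  mk_eq_iff.2 (similar_iff.2 ⟨_, _, MagAlg.isTrivial_swapRep φ, hA, mul_comm _ _⟩)

theorem exists_add_eq_zero [Finite G] (x : GrBr φ) : ∃ y : GrBr φ, y + x = 0 := by
  obtain ⟨A, rfl⟩ := Quot.exists_rep x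
  obtain ⟨B, hB⟩ := A.exists_tensor_isTrivial
  exact ⟨mk B, (mk_eq_iff.2 (tensor_comm_similar B A)).trans (mk_eq_zero_of_isTrivial hB)⟩

end GrBr

/-- A choice of inverses. -/
local instance GrBr.neg [Finite G] : Neg (GrBr φ) := ⟨fun x => (GrBr.exists_add_eq_zero x).choose⟩

/-- The magnetic equivariant graded Brauer group. -/
local instance GrBr.addCommGroup [Finite G] : AddCommGroup (GrBr φ) where
  add_assoc := by
    rintro ⟨A⟩ ⟨B⟩ ⟨C⟩
    exact GrBr.mk_eq_of_iso (MagAlg.Iso.assoc _ _ _)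
  zero_add := by
    rintro ⟨A⟩
    exact (GrBr.mk_eq_iff.2 (MECSGA.tensor_comm_similar (MECSGA.ofRep (swapRep 0)) A)).trans
      (GrBr.mk_eq_iff.2 (MECSGA.tensor_trivial_similar A (MagAlg.isTrivial_swapRep φ)))
  add_zero := by
    rintro ⟨A⟩
    exact GrBr.mk_eq_iff.2 (MECSGA.tensor_trivial_similar A (MagAlg.isTrivial_swapRep φ))
  add_comm := by
    rintro ⟨A⟩ ⟨B⟩
    exact GrBr.mk_eq_iff.2 (MECSGA.tensor_comm_similar A B)
  nsmul := nsmulRec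
  zsmul := zsmulRec
  neg_add_cancel x := (GrBr.exists_add_eq_zero x).choose_spec

namespace GrBr

theorem isTensorAddition [Finite G] (φ : G →* Multiplicative (ZMod 2)) :
    IsTensorAddition φ := fun A B => ⟨A.2.tensor B.2, rfl⟩

end GrBr

/-! ### The graded Brauer group of the complex numbers -/

/-- A graded algebra as an equivariant graded algebra for the trivial group. -/
def GrAlg.toMag (A : GrAlg) : MagAlg (1 : Unit →* Multiplicative (ZMod 2)) where
  toGrAlg := A
  τ := 1
  τ_smul _ c a := by
    rw [MonoidHom.one_apply, MonoidHom.one_apply, conjPow_one]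
    rfl
  τ_mem _ _ _ h := h

/-- A vector space as a representation of the trivial group. -/
def FDSpace.toMag (V : FDSpace) : MagRep (1 : Unit →* Multiplicative (ZMod 2)) where
  toFDSpace := V
  ρ := 1
  ρ_smul _ c a := by
    rw [MonoidHom.one_apply, MonoidHom.one_apply, conjPow_one]
    rfl

/-- Isomorphisms of graded algebras are equivariant for the trivial group. -/
def GrAlg.Iso.toMag {A B : MagAlg (1 : Unit →* Multiplicative (ZMod 2))}
    (e : GrAlg.Iso A.toGrAlg B.toGrAlg) : MagAlg.Iso A B where
  toIso := e
  map_τ g a := by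
    have hA : A.τ g = 1 := map_one A.τ
    have hB : B.τ g = 1 := map_one B.τ
    rw [hA, hB]
    rfl

/-- A central simple graded algebra as an equivariant one for the trivial group. -/
def CSGA.toMag (A : CSGA) : MECSGA (1 : Unit →* Multiplicative (ZMod 2)) := ⟨A.1.toMag, A.2⟩

theorem MECSGA.Similar.forget {A B : MECSGA φ} (h : A.Similar B) : A.forget.Similar B.forget := by
  obtain ⟨V₀, V₁, W₀, W₁, hV, hW, ⟨e⟩⟩ := h
  exact ⟨_, _, _, _, hV, hW, ⟨e.toIso⟩⟩

theorem MECSGA.Similar.of_forget {A B : MECSGA (1 : Unit →* Multiplicative (ZMod 2))}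
    (h : A.forget.Similar B.forget) : A.Similar B := by
  obtain ⟨V₀, V₁, W₀, W₁, hV, hW, ⟨e⟩⟩ := h
  exact ⟨V₀.toMag, V₁.toMag, W₀.toMag, W₁.toMag, hV, hW, ⟨GrAlg.Iso.toMag e⟩⟩

/-- For the trivial group equivariance is automatic, so the ungraded-action theory over `ℂ` is a
special case of the equivariant one and inherits its group structure. -/
theorem CSGA.similar_iff {A B : CSGA} : A.Similar B ↔ A.toMag.Similar B.toMag :=
  ⟨fun h => MECSGA.Similar.of_forget h, fun h => h.forget⟩

theorem CSGA.similar_equivalence : Equivalence CSGA.Similar where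
  refl _ := similar_iff.2 ((MECSGA.similar_equivalence _).refl _)
  symm h := similar_iff.2 ((MECSGA.similar_equivalence _).symm (similar_iff.1 h))
  trans h h' := similar_iff.2
    ((MECSGA.similar_equivalence _).trans (similar_iff.1 h) (similar_iff.1 h'))

namespace GrBrC

/-- The graded Brauer group as the equivariant one for the trivial group. -/
def equivMag : GrBrC ≃ GrBr (1 : Unit →* Multiplicative (ZMod 2)) where
  toFun := Quot.map CSGA.toMag fun _ _ => CSGA.similar_iff.1
  invFun := Quot.map MECSGA.forget fun _ _ => MECSGA.Similar.forget
  left_inv := by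
    rintro ⟨A⟩
    rfl
  right_inv := by
    rintro ⟨A⟩
    exact GrBr.mk_eq_of_iso (GrAlg.Iso.toMag (GrAlg.Iso.refl A.1.toGrAlg))

end GrBrC

/-- The graded Brauer group of the complex numbers. -/
local instance GrBrC.addCommGroup : AddCommGroup GrBrC := GrBrC.equivMag.addCommGroup

/-- The graded tensor product of central simple graded algebras. -/
def CSGA.tensor (A B : CSGA) : CSGA := ⟨A.1.tensor B.1, A.2.tensor B.2⟩

namespace GrBrC

theorem isTensorAddition : IsTensorAddition := fun A B => ⟨A.2.tensor B.2, rfl⟩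

theorem mk_eq_iff {A B : CSGA} : mk A = mk B ↔ A.Similar B :=
  CSGA.similar_equivalence.quot_mk_eq_iff A B

theorem mk_eq_of_iso {A B : CSGA} (e : GrAlg.Iso A.1 B.1) : mk A = mk B :=
  equivMag.injective (GrBr.mk_eq_of_iso (A := A.toMag) (B := B.toMag) (GrAlg.Iso.toMag e))

theorem mk_alg (V : SSpace) : mk ⟨V.alg, V.alg_isCentralSimple⟩ = 0 :=
  equivMag.injective (GrBr.mk_eq_zero_of_isTrivial
    (A := CSGA.toMag ⟨V.alg, V.alg_isCentralSimple⟩)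
    ⟨(V.homPart 0).toMag, (V.homPart 1).toMag, V.split.symm.toEquiv.nontrivial,
      ⟨GrAlg.Iso.toMag V.splitIso⟩⟩)

/-- The class of the Clifford algebra of rank one. -/
def cliffClass : GrBrC := mk ⟨cliff, GrAlg.cliff_isCentralSimple⟩

theorem mk_cases (A : CSGA) : (∃ V : SSpace, Nonempty (GrAlg.Iso A.1 V.alg)) ∨
    mk A = cliffClass := by
  rcases A.2.exists_iso with h | ⟨V, ⟨e⟩⟩
  · exact Or.inl h
  · refine Or.inr ?_
    have h : mk A = mk ⟨V.alg, V.alg_isCentralSimple⟩ + cliffClass :=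
      mk_eq_of_iso (B := CSGA.tensor ⟨V.alg, V.alg_isCentralSimple⟩
        ⟨cliff, GrAlg.cliff_isCentralSimple⟩) e
    rw [h, mk_alg, zero_add]

theorem eq_zero_or (x : GrBrC) : x = 0 ∨ x = cliffClass := by
  obtain ⟨A, rfl⟩ := Quot.exists_rep x
  refine (mk_cases A).imp ?_ id
  rintro ⟨V, ⟨e⟩⟩
  exact (mk_eq_of_iso (B := ⟨V.alg, V.alg_isCentralSimple⟩) e).trans (mk_alg V)

theorem cliffClass_add_self : cliffClass + cliffClass = 0 :=
  (mk_eq_of_iso (A := CSGA.tensor ⟨cliff, GrAlg.cliff_isCentralSimple⟩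
    ⟨cliff, GrAlg.cliff_isCentralSimple⟩) (B := ⟨plane.alg, plane.alg_isCentralSimple⟩)
    cliffSq).trans (mk_alg plane)

theorem _root_.MagBrauer.GrAlg.finrank_tensor (A B : GrAlg) :
    Module.finrank ℂ (A.tensor B).carrier =
      Module.finrank ℂ A.carrier * Module.finrank ℂ B.carrier :=
  (A.tens B).finrank_eq.symm.trans Module.finrank_tensorProduct

theorem _root_.MagBrauer.GrAlg.finrank_endo (V₀ V₁ : FDSpace) :
    Module.finrank ℂ (GrAlg.endo V₀ V₁).carrier =
      Module.finrank ℂ (V₀.carrier × V₁.carrier) ^ 2 :=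
  (Module.finrank_linearMap ℂ ℂ _ _).trans (sq _).symm

/-- Dimensions: similarity to an endomorphism algebra would give `2 n² = 4 m²` with `n` and `m`
nonzero, and the 2-adic valuations of the two sides have different parity. -/
theorem cliffClass_ne_zero : cliffClass ≠ 0 := by
  rw [← mk_alg plane]
  intro h
  obtain ⟨V₀, V₁, W₀, W₁, hV, hW, ⟨e⟩⟩ := mk_eq_iff.1 h
  have h1 := e.toEquiv.toLinearEquiv.finrank_eq
  rw [GrAlg.finrank_tensor, GrAlg.finrank_tensor, GrAlg.finrank_endo, GrAlg.finrank_endo] at h1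
  have h2 : Module.finrank ℂ cliff.carrier = 2 := by
    change Module.finrank ℂ (ℂ × ℂ) = 2
    simp
  have h3 : Module.finrank ℂ plane.alg.carrier = 4 := by
    change Module.finrank ℂ (Module.End ℂ (ℂ × ℂ)) = 4
    rw [Module.finrank_linearMap]
    simp
  have hn : Module.finrank ℂ (V₀.carrier × V₁.carrier) ≠ 0 := Module.finrank_pos.ne'
  have hm : Module.finrank ℂ (W₀.carrier × W₁.carrier) ≠ 0 := Module.finrank_pos.ne'
  change Module.finrank ℂ cliff.carrier * _ = Module.finrank ℂ plane.alg.carrier * _ at h1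
  rw [h2, h3] at h1
  have h4 := congrArg (padicValNat 2) h1
  rw [show 4 = 2 ^ 2 by norm_num, padicValNat.mul two_ne_zero (pow_ne_zero 2 hn),
    padicValNat.mul (by norm_num) (pow_ne_zero 2 hm), padicValNat.pow, padicValNat.pow,
    padicValNat.pow, padicValNat.self one_lt_two] at h4
  omega

theorem _root_.MagBrauer.nonempty_addEquiv_zmod {A : Type*} [AddCommGroup A] {n : ℕ} {a : A}
    (ha : addOrderOf a = n) (h : ∀ x, x ∈ AddSubgroup.zmultiples a) : Nonempty (A ≃+ ZMod n) := by
  have hc : IsAddCyclic A := ⟨⟨a, h⟩⟩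
  have hn : Nat.card A = n := by
    rw [← ha, ← Nat.card_zmultiples, (AddSubgroup.eq_top_iff' _).2 h, AddSubgroup.card_top]
  subst hn
  exact ⟨(zmodAddCyclicAddEquiv hc).symm⟩

theorem nonempty_addEquiv : Nonempty (GrBrC ≃+ ZMod 2) := by
  refine nonempty_addEquiv_zmod (a := cliffClass)
    (addOrderOf_eq_prime ((two_nsmul _).trans cliffClass_add_self) cliffClass_ne_zero) fun x => ?_
  rcases eq_zero_or x with rfl | rfl
  · exact zero_mem _
  · exact AddSubgroup.mem_zmultiples _

/-- Class zero makes the algebra itself, and not just a stabilization of it, an endomorphism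
algebra: the only alternative in the classification has the nonzero class of `Cl`. -/
theorem mk_eq_zero_iff {A : CSGA} : mk A = 0 ↔ ∃ V : SSpace, Nonempty (GrAlg.Iso A.1 V.alg) := by
  refine ⟨fun h => (mk_cases A).resolve_right fun h' => cliffClass_ne_zero (h'.symm.trans h), ?_⟩
  rintro ⟨V, ⟨e⟩⟩
  exact (mk_eq_of_iso (B := ⟨V.alg, V.alg_isCentralSimple⟩) e).trans (mk_alg V)

end GrBrC

open groupCohomology

/-! ### Classes of projective representations -/

namespace GrBr

/-- The class of the endomorphism algebra of a projective representation. -/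
def ofRep (R : ProjRep φ) : GrBr φ := mk (MECSGA.ofRep R)

theorem ofRep_add (R S : ProjRep φ) : ofRep R + ofRep S = ofRep (R.tensor S) :=
  mk_eq_of_iso (A := (MECSGA.ofRep R).tensor (MECSGA.ofRep S)) (B := MECSGA.ofRep (R.tensor S))
    (R.algTensor S)

theorem mk_eq_ofRep {A : MECSGA φ} {R : ProjRep φ} (e : MagAlg.Iso A.1 R.alg) : mk A = ofRep R :=
  mk_eq_of_iso (B := MECSGA.ofRep R) e

theorem ofRep_eq_zero {R : ProjRep φ} (h : R.deg = 0) (hc : IsMulCoboundary₂ R.c) : ofRep R = 0 :=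
  mk_eq_zero_of_isTrivial (A := MECSGA.ofRep R) (R.isTrivial_of_isMulCoboundary h hc)

/-- Degree and cohomology class form a complete invariant. Trivial tensor factors change neither, so
similarity reduces to `ProjRep.eq_of_iso`; conversely, equal invariants make both classes inverse to
that of `R.dual`. -/
theorem ofRep_eq_iff [Finite G] {R S : ProjRep φ} :
    ofRep R = ofRep S ↔ R.deg = S.deg ∧ IsMulCoboundary₂ (fun p => S.c p / R.c p) := by
  constructor
  · intro h
    obtain ⟨E, F, hE, hF, h⟩ := MECSGA.similar_iff.1 (mk_eq_iff.1 h)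
    obtain ⟨M, hM, hMc, ⟨e⟩⟩ := hE.exists_projRep
    obtain ⟨N, hN, hNc, ⟨f⟩⟩ := hF.exists_projRep
    obtain ⟨i⟩ := MagAlg.isoClass_eq_iff.1 h
    have h1 := ProjRep.eq_of_iso (R := R.tensor M) (S := S.tensor N)
      ((((MagAlg.Iso.refl R.alg).tensor e).trans (R.algTensor M)).symm.trans
        (i.trans (((MagAlg.Iso.refl S.alg).tensor f).trans (S.algTensor N))))
    simp only [hM, hN, hMc, hNc, AddMonoidHom.zero_apply,
      Pi.one_apply, mul_zero, TwistedUnits.sign_zero, mul_one, add_zero] at h1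
    exact h1
  · rintro ⟨h, x, hx⟩
    have key : ∀ Q : ProjRep φ, Q.deg = R.deg → IsMulCoboundary₂ (fun p => Q.c p / R.c p) →
        ofRep Q + ofRep R.dual = 0 := fun Q hQ hc => by
      rw [ofRep_add]
      refine ofRep_eq_zero ?_ ?_
      · rw [ProjRep.tensor_deg, R.dual_deg, hQ]
        exact AddMonoidHom.ext fun g => CharTwo.add_self_eq_zero _
      · convert hc using 1
        funext p
        rw [ProjRep.tensor_c, R.dual_c, R.dual_deg, hQ, ← mul_assoc, mul_assoc,
          TwistedUnits.sign_mul_self, mul_one, div_eq_mul_inv]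
    exact add_right_cancel ((key R rfl ⟨1, fun g h => by simp⟩).trans
      (key S h.symm ⟨x, hx⟩).symm)

theorem ofRep_twistedRegular [Finite G] (R : ProjRep φ) (h : R.deg = 0) :
    ofRep (twistedRegular R.c R.isMulCocycle₂) = ofRep R :=
  ofRep_eq_iff.2 ⟨h.symm, 1, fun g h => by
    change _ = R.c (g, h) / R.c (g, h)
    simp⟩

theorem zero_eq_ofRep [Finite G] : (0 : GrBr φ) = ofRep (swapRep 0) := rfl

/-! ### Forgetting the group action -/

/-- Forgetting the group action. -/
def forget [Finite G] : GrBr φ →+ GrBrC :=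
  AddMonoidHom.mk' (Quot.map MECSGA.forget fun _ _ => MECSGA.Similar.forget) (by
    rintro ⟨A⟩ ⟨B⟩
    rfl)

theorem forget_mk [Finite G] (A : MECSGA φ) : forget (mk A) = GrBrC.mk A.forget := rfl

/-- The class of the Clifford algebra of rank one. -/
def cliffClass (φ : G →* Multiplicative (ZMod 2)) : GrBr φ :=
  mk ⟨cliffMag φ, GrAlg.cliff_isCentralSimple⟩

theorem forget_cliffClass [Finite G] : forget (cliffClass φ) = GrBrC.cliffClass := rfl

theorem cliffClass_add_self [Finite G] :
    cliffClass φ + cliffClass φ = ofRep (swapRep (addHom φ)) :=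
  mk_eq_ofRep (A := MECSGA.tensor ⟨cliffMag φ, GrAlg.cliff_isCentralSimple⟩
    ⟨cliffMag φ, GrAlg.cliff_isCentralSimple⟩) (cliffMagSq φ)

theorem forget_surjective [Finite G] : Function.Surjective (forget (φ := φ)) := fun x => by
  rcases GrBrC.eq_zero_or x with rfl | rfl
  · exact ⟨0, map_zero _⟩
  · exact ⟨_, forget_cliffClass⟩

theorem exists_iso_of_mem_ker [Finite G] {A : MECSGA φ} (h : mk A ∈ (forget (φ := φ)).ker) :
    ∃ R : ProjRep φ, Nonempty (MagAlg.Iso A.1 R.alg) := by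
  obtain ⟨V, ⟨e⟩⟩ := GrBrC.mk_eq_zero_iff.1 ((forget_mk A).symm.trans h)
  exact exists_projRep A.1 V e

theorem ofRep_mem_ker [Finite G] (R : ProjRep φ) : ofRep R ∈ (forget (φ := φ)).ker :=
  GrBrC.mk_eq_zero_iff.2 ⟨R.toSSpace, ⟨GrAlg.Iso.refl _⟩⟩

theorem exists_eq_ofRep [Finite G] (x : (forget (φ := φ)).ker) : ∃ R : ProjRep φ, x = ofRep R := by
  obtain ⟨x, hx⟩ := x
  obtain ⟨A, rfl⟩ := Quot.exists_rep x
  obtain ⟨R, ⟨e⟩⟩ := exists_iso_of_mem_ker hx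
  exact ⟨R, mk_eq_ofRep e⟩

/-- A section would send the generator to `[Cl] + [R]` for some `R`. Its double has degree `φ + 2
deg R = φ`, which is nonzero since `φ` is surjective, yet that double must vanish. -/
theorem not_exists_section_forget [Finite G] (hφ : Function.Surjective φ) :
    ¬ ∃ s : GrBrC →+ GrBr φ, forget.comp s = AddMonoidHom.id GrBrC := by
  rintro ⟨s, hs⟩
  have h1 : forget (s GrBrC.cliffClass) = GrBrC.cliffClass := DFunLike.congr_fun hs _
  have h2 : s GrBrC.cliffClass + s GrBrC.cliffClass = 0 := by
    rw [← map_add, GrBrC.cliffClass_add_self, map_zero]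
  have h3 : s GrBrC.cliffClass - cliffClass φ ∈ (forget (φ := φ)).ker := by
    rw [AddMonoidHom.mem_ker, map_sub, h1, forget_cliffClass, sub_self]
  obtain ⟨R, hR⟩ := exists_eq_ofRep ⟨_, h3⟩
  rw [sub_eq_iff_eq_add.1 hR, add_add_add_comm, cliffClass_add_self, ofRep_add, ofRep_add,
    zero_eq_ofRep, ofRep_eq_iff] at h2
  obtain ⟨g, hg⟩ := hφ (Multiplicative.ofAdd 1)
  have h4 := DFunLike.congr_fun h2.1 (Additive.ofMul g)
  rw [ProjRep.tensor_deg, ProjRep.tensor_deg, AddMonoidHom.add_apply, AddMonoidHom.add_apply,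
    CharTwo.add_self_eq_zero, zero_add] at h4
  change Multiplicative.toAdd (φ g) = 0 at h4
  rw [hg] at h4
  exact one_ne_zero h4

/-! ### The degree character -/

/-- The degree character of the class of a projective representation. -/
def degree [Finite G] : (forget (φ := φ)).ker →+ (Additive G →+ ZMod 2) :=
  -- The choice of representative is harmless, because `ofRep_eq_iff` makes the degree an invariant
  -- of the class.
  AddMonoidHom.mk' (fun x => (exists_eq_ofRep x).choose.deg) fun x y => by
    have h := (congrArg₂ (· + ·) (exists_eq_ofRep x).choose_spec
      (exists_eq_ofRep y).choose_spec).trans (ofRep_add _ _)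
    exact (ofRep_eq_iff.1 ((exists_eq_ofRep (x + y)).choose_spec.symm.trans h)).1

theorem degree_eq [Finite G] {x : (forget (φ := φ)).ker} {R : ProjRep φ} (h : x = ofRep R) :
    degree x = R.deg :=
  (ofRep_eq_iff.1 ((exists_eq_ofRep x).choose_spec.symm.trans h)).1

theorem degree_surjective [Finite G] : Function.Surjective (degree (φ := φ)) := fun χ =>
  ⟨⟨_, ofRep_mem_ker (swapRep χ)⟩, degree_eq (R := swapRep χ) rfl⟩

theorem hasDegreeCharacter_degree [Finite G] (A : MECSGA φ) (hA : mk A ∈ (forget (φ := φ)).ker) :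
    A.1.HasDegreeCharacter (degree ⟨mk A, hA⟩) := by
  obtain ⟨R, ⟨e⟩⟩ := exists_iso_of_mem_ker hA
  rw [degree_eq (R := R) (mk_eq_ofRep e)]
  exact R.hasDegreeCharacter e

end GrBr

/-! ### The second cohomology group -/

namespace H2

theorem exists_eq_mk (x : H2 φ) : ∃ (f : G × G → TwistedUnits φ) (hf : IsMulCocycle₂ f),
    x = H2.mk f hf := by
  induction x using H2_induction_on with
  | h x => exact ⟨Additive.toMul ∘ x.1, isMulCocycle₂_of_mem_cocycles₂ _ x.2, rfl⟩

theorem isMulCocycle₂_mul {f f' : G × G → TwistedUnits φ} (hf : IsMulCocycle₂ f)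
    (hf' : IsMulCocycle₂ f') : IsMulCocycle₂ (f * f') := fun g h k => by
  simp only [Pi.mul_apply, smul_mul']
  rw [mul_mul_mul_comm, hf, hf', mul_mul_mul_comm]

theorem mk_add_mk {f f' : G × G → TwistedUnits φ} (hf : IsMulCocycle₂ f)
    (hf' : IsMulCocycle₂ f') : H2.mk f hf + H2.mk f' hf' = H2.mk (f * f') (isMulCocycle₂_mul hf hf') :=
  (map_add (H2π (unitsRep φ)).hom _ _).symm

theorem mk_eq_iff {f f' : G × G → TwistedUnits φ} {hf : IsMulCocycle₂ f} {hf' : IsMulCocycle₂ f'} :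
    H2.mk f hf = H2.mk f' hf' ↔ IsMulCoboundary₂ (fun p => f' p / f p) := by
  rw [eq_comm]
  refine (H2π_eq_iff _ _).trans ⟨fun h => isMulCoboundary₂_of_mem_coboundaries₂ _ h, fun h => ?_⟩
  exact (coboundariesOfIsMulCoboundary₂ h).2

end H2

namespace GrBr

/-- The class of the twisted group algebra of a cohomology class. -/
def ofH2 [Finite G] : H2 φ →+ (forget (φ := φ)).ker :=
  AddMonoidHom.mk' (fun x => ⟨ofRep (twistedRegular (H2.exists_eq_mk x).choose
      (H2.exists_eq_mk x).choose_spec.choose), ofRep_mem_ker _⟩) fun x y => Subtype.ext (by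
    refine Eq.trans ?_ (ofRep_add _ _).symm
    refine ofRep_eq_iff.2 ⟨(add_zero 0).symm, ?_⟩
    have h := (H2.exists_eq_mk (x + y)).choose_spec.choose_spec
    have h' := congrArg₂ (· + ·) (H2.exists_eq_mk x).choose_spec.choose_spec
      (H2.exists_eq_mk y).choose_spec.choose_spec
    have h2 := H2.mk_eq_iff.1 (h.symm.trans (h'.trans (H2.mk_add_mk _ _)))
    convert h2 using 3 with p
    rw [ProjRep.tensor_c]
    change _ * _ * TwistedUnits.sign (0 * 0) = _
    rw [mul_zero, TwistedUnits.sign_zero, mul_one]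
    all_goals rfl)

theorem ofH2_mk [Finite G] (f : G × G → TwistedUnits φ) (hf : IsMulCocycle₂ f) :
    (ofH2 (H2.mk f hf) : GrBr φ) = ofRep (twistedRegular f hf) :=
  ofRep_eq_iff.2 ⟨rfl, H2.mk_eq_iff.1 (H2.exists_eq_mk (H2.mk f hf)).choose_spec.choose_spec.symm⟩

/-- Any projective endomorphism algebra with cocycle `f` has the same complete invariant, degree
zero and the class of `f`, as the twisted regular representation. -/
theorem ofH2_mk_of_isProjectiveEnd [Finite G] (f : G × G → TwistedUnits φ) (hf : IsMulCocycle₂ f)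
    (A : MECSGA φ) (hA : A.1.IsProjectiveEnd f) : (ofH2 (H2.mk f hf) : GrBr φ) = mk A := by
  obtain ⟨R, hR, rfl, ⟨e⟩⟩ := hA.exists_projRep A.2
  rw [ofH2_mk, mk_eq_ofRep e, ofRep_twistedRegular R hR]

theorem ofH2_injective [Finite G] : Function.Injective (ofH2 (φ := φ)) := fun x y h => by
  obtain ⟨f, hf, rfl⟩ := H2.exists_eq_mk x
  obtain ⟨f', hf', rfl⟩ := H2.exists_eq_mk y
  have h := congrArg Subtype.val h
  rw [ofH2_mk, ofH2_mk] at h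
  exact H2.mk_eq_iff.2 (ofRep_eq_iff.1 h).2

/-- A class of degree zero is determined by its cocycle, and the twisted regular representation
realizes that cocycle. -/
theorem exact_ofH2_degree [Finite G] : Function.Exact (ofH2 (φ := φ)) degree := fun x => by
  constructor
  · intro h
    obtain ⟨R, hR⟩ := exists_eq_ofRep x
    rw [degree_eq hR] at h
    refine ⟨H2.mk R.c R.isMulCocycle₂, Subtype.ext ?_⟩
    rw [ofH2_mk, ofRep_twistedRegular R h, hR]
  · rintro ⟨y, rfl⟩
    obtain ⟨f, hf, rfl⟩ := H2.exists_eq_mk y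
    exact degree_eq (ofH2_mk f hf)

end GrBr

/-! ### The group of order two -/

section OrderTwo

variable {s : G}

theorem exists_eq_one_or (hφ : Function.Bijective φ) :
    ∃ s : G, (∀ g, g = 1 ∨ g = s) ∧ φ s = Multiplicative.ofAdd 1 := by
  obtain ⟨s, hs⟩ := hφ.2 (Multiplicative.ofAdd 1)
  refine ⟨s, fun g => ?_, hs⟩
  rcases zmod_two_cases (Multiplicative.toAdd (φ g)) with h | h
  · exact Or.inl (hφ.1 ((map_one φ).symm ▸ h))
  · exact Or.inr (hφ.1 (hs.symm ▸ h))

theorem conjPow_eq_star (hφs : φ s = Multiplicative.ofAdd 1) (z : ℂ) :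
    conjPow (φ s) z = starRingEnd ℂ z := by
  rw [hφs, conjPow, if_neg (by decide)]

theorem ne_one_of_map_eq (hφs : φ s = Multiplicative.ofAdd 1) : s ≠ 1 := by
  rintro rfl
  rw [map_one] at hφs
  exact absurd hφs (by decide)

theorem mul_self_eq_one (hs : ∀ g, g = 1 ∨ g = s) (hφs : φ s = Multiplicative.ofAdd 1) :
    s * s = 1 :=
  (hs (s * s)).resolve_right fun h => ne_one_of_map_eq hφs (mul_eq_left.1 h)

/-- The real number `f(1, 1) f(s, s)` attached to a cocycle. -/
def cocycleInvariant (s : G) (f : G × G → TwistedUnits φ) : ℂ := (f (1, 1)).val * (f (s, s)).val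

/-- The cocycle identity at `(s, s, s)` says that the product is fixed by complex conjugation. The
factor `f(1, 1)` accounts for cocycles that are not normalized. -/
theorem exists_cocycleInvariant_eq (hs : ∀ g, g = 1 ∨ g = s) (hφs : φ s = Multiplicative.ofAdd 1)
    {f : G × G → TwistedUnits φ} (hf : IsMulCocycle₂ f) :
    ∃ r : ℝ, r ≠ 0 ∧ cocycleInvariant s f = r := by
  have h := congrArg TwistedUnits.val (hf s s s)
  rw [mul_self_eq_one hs hφs, map_one_fst_of_isMulCocycle₂ hf s, map_one_snd_of_isMulCocycle₂ hf s,
    TwistedUnits.val_mul, TwistedUnits.val_mul, TwistedUnits.val_smul, TwistedUnits.val_smul,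
    conjPow_eq_star hφs, conjPow_eq_star hφs, mul_comm ((starRingEnd ℂ) _), ← map_mul] at h
  obtain ⟨r, hr⟩ := Complex.conj_eq_iff_real.1 h.symm
  refine ⟨r, ?_, hr⟩
  rintro rfl
  exact mul_ne_zero (TwistedUnits.val_ne_zero _) (TwistedUnits.val_ne_zero _)
    (hr.trans Complex.ofReal_zero)

theorem isMulCoboundary₂_of_pos (hs : ∀ g, g = 1 ∨ g = s) (hφs : φ s = Multiplicative.ofAdd 1)
    {f : G × G → TwistedUnits φ} (hf : IsMulCocycle₂ f) {r : ℝ} (hr : 0 < r)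
    (h : cocycleInvariant s f = r) : IsMulCoboundary₂ f := by
  classical
  have h1 := ne_one_of_map_eq hφs
  have hr' : ((√r : ℝ) : ℂ) ≠ 0 := Complex.ofReal_ne_zero.2 (Real.sqrt_ne_zero'.2 hr)
  let y : TwistedUnits φ := TwistedUnits.mk0 _ hr'
  -- The identity at `(1, 1)` forces the value `f(1, 1)` at `1`; the one at `(s, s)` asks for
  -- `|x(s)|² = f(1,1) f(s,s) = r`, solved by `√r`.
  refine ⟨fun g => if g = 1 then f (1, 1) else y, fun g k => ?_⟩
  rcases hs g with rfl | rfl <;> rcases hs k with rfl | rfl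
  · simp
  · rw [map_one_fst_of_isMulCocycle₂ hf k]
    simp
  · rw [map_one_snd_of_isMulCocycle₂ hf g]
    simp [h1]
  · simp only [mul_self_eq_one hs hφs, if_pos, if_neg h1]
    rw [div_mul_eq_mul_div, div_eq_iff_eq_mul']
    refine TwistedUnits.val_injective ?_
    rw [TwistedUnits.val_mul, TwistedUnits.val_mul, TwistedUnits.val_smul, conjPow_eq_star hφs]
    refine Eq.trans ?_ h.symm
    change (starRingEnd ℂ) ((√r : ℝ) : ℂ) * ((√r : ℝ) : ℂ) = r
    rw [Complex.conj_ofReal, ← Complex.ofReal_mul, Real.mul_self_sqrt hr.le]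

/-- For the coboundary of `x` the invariant is `|x(s)|²`, which is nonnegative. -/
theorem cocycleInvariant_ne_neg_one (hs : ∀ g, g = 1 ∨ g = s)
    (hφs : φ s = Multiplicative.ofAdd 1) {f : G × G → TwistedUnits φ} (hf : IsMulCoboundary₂ f) :
    cocycleInvariant s f ≠ -1 := by
  obtain ⟨x, hx⟩ := hf
  have h : f (1, 1) * f (s, s) = s • x s * x s := by
    rw [← hx, ← hx, mul_self_eq_one hs hφs, mul_one, one_smul, div_self', one_mul,
      div_mul_eq_mul_div, mul_div_cancel]
  rw [cocycleInvariant, ← TwistedUnits.val_mul, h, TwistedUnits.val_mul, TwistedUnits.val_smul,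
    conjPow_eq_star hφs, mul_comm, Complex.mul_conj]
  intro h
  have h0 := Complex.normSq_nonneg (x s).val
  rw [← Complex.ofReal_one, ← Complex.ofReal_neg, Complex.ofReal_inj] at h
  linarith

/-! ### Multiples of the Clifford class -/

namespace GrBr

theorem four_nsmul_cliffClass [Finite G] : 4 • cliffClass φ =
    ofRep ((swapRep (addHom φ)).tensor (swapRep (addHom φ))) := by
  rw [← ofRep_add, ← cliffClass_add_self]
  abel

theorem two_nsmul_cliffClass [Finite G] : 2 • cliffClass φ = ofRep (swapRep (addHom φ)) := by
  rw [← cliffClass_add_self, two_nsmul]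

theorem tensor_swapRep_deg (χ : Additive G →+ ZMod 2) :
    ((swapRep (φ := φ) χ).tensor (swapRep χ)).deg = 0 :=
  AddMonoidHom.ext fun _ => CharTwo.add_self_eq_zero _

theorem tensor_swapRep_c (χ : Additive G →+ ZMod 2) (p : G × G) :
    ((swapRep (φ := φ) χ).tensor (swapRep χ)).c p =
      TwistedUnits.sign (χ (Additive.ofMul p.1) * χ (Additive.ofMul p.2)) := by
  rw [ProjRep.tensor_c]
  change 1 * 1 * _ = _
  rw [one_mul, one_mul]

/-- The class `4 [Cl]` has degree zero and a cocycle with values `± 1`, so doubling it squares the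
cocycle away. -/
theorem eight_nsmul_cliffClass [Finite G] : 8 • cliffClass φ = 0 := by
  refine (add_nsmul _ 4 4).trans ?_
  rw [four_nsmul_cliffClass, ofRep_add]
  refine ofRep_eq_zero ?_ ⟨1, fun g h => ?_⟩
  · rw [ProjRep.tensor_deg, tensor_swapRep_deg, add_zero]
  · rw [ProjRep.tensor_c, tensor_swapRep_c, tensor_swapRep_deg, AddMonoidHom.zero_apply, zero_mul,
      TwistedUnits.sign_zero, mul_one, TwistedUnits.sign_mul_self]
    simp

theorem cocycleInvariant_tensor_swapRep (hφs : φ s = Multiplicative.ofAdd 1) :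
    cocycleInvariant s ((swapRep (φ := φ) (addHom φ)).tensor (swapRep (addHom φ))).c = -1 := by
  rw [cocycleInvariant, tensor_swapRep_c, tensor_swapRep_c]
  have h1 : addHom φ (Additive.ofMul s) = 1 := congrArg Multiplicative.toAdd hφs
  have h2 : addHom φ (Additive.ofMul 1) = 0 := map_zero _
  simp only [h1, h2, TwistedUnits.val_sign, mul_zero, mul_one, sgn_zero, sgn_one, one_mul]

theorem four_nsmul_cliffClass_ne_zero [Finite G] (hs : ∀ g, g = 1 ∨ g = s)
    (hφs : φ s = Multiplicative.ofAdd 1) : 4 • cliffClass φ ≠ 0 := by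
  rw [four_nsmul_cliffClass, zero_eq_ofRep, Ne, eq_comm, ofRep_eq_iff]
  rintro ⟨-, h⟩
  refine cocycleInvariant_ne_neg_one hs hφs h ?_
  refine Eq.trans ?_ (cocycleInvariant_tensor_swapRep hφs)
  change (_ / 1 : TwistedUnits φ).val * (_ / 1 : TwistedUnits φ).val = _
  rw [div_one, div_one]
  rfl

/-- The sign of the real invariant decides. If it is positive the cocycle is a coboundary; if it is
negative, adding `4 [Cl]`, whose invariant is `-1`, makes it positive, and `4 [Cl]` is its own
inverse. -/
theorem ofRep_eq_zero_or [Finite G] (hs : ∀ g, g = 1 ∨ g = s)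
    (hφs : φ s = Multiplicative.ofAdd 1) {R : ProjRep φ} (hR : R.deg = 0) :
    ofRep R = 0 ∨ ofRep R = 4 • cliffClass φ := by
  obtain ⟨r, hr0, hr⟩ := exists_cocycleInvariant_eq hs hφs R.isMulCocycle₂
  rcases hr0.lt_or_gt with h | h
  · right
    refine add_right_cancel (b := 4 • cliffClass φ)
      (Eq.trans ?_ ((add_nsmul _ 4 4).symm.trans eight_nsmul_cliffClass).symm)
    rw [four_nsmul_cliffClass, ofRep_add]
    refine ofRep_eq_zero ?_ (isMulCoboundary₂_of_pos hs hφs (ProjRep.isMulCocycle₂ _)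
      (r := -r) (neg_pos.2 h) ?_)
    · rw [ProjRep.tensor_deg, hR, tensor_swapRep_deg, add_zero]
    · have h1 := cocycleInvariant_tensor_swapRep hφs
      rw [cocycleInvariant] at h1 hr ⊢
      have hc : ∀ (S : ProjRep φ) p, ((R.tensor S).c p).val = (R.c p).val * (S.c p).val :=
        fun S p => by
          rw [ProjRep.tensor_c, hR, AddMonoidHom.zero_apply, zero_mul, TwistedUnits.sign_zero,
            mul_one, TwistedUnits.val_mul]
      rw [hc, hc, mul_mul_mul_comm, hr, h1]
      simp
  · exact Or.inl (ofRep_eq_zero hR (isMulCoboundary₂_of_pos hs hφs R.isMulCocycle₂ h hr))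

theorem addHom_eq_zero_or (hs : ∀ g, g = 1 ∨ g = s)
    (hφs : φ s = Multiplicative.ofAdd 1) (χ : Additive G →+ ZMod 2) : χ = 0 ∨ χ = addHom φ := by
  have h1 : addHom φ (Additive.ofMul s) = 1 := congrArg Multiplicative.toAdd hφs
  refine (zmod_two_cases (χ (Additive.ofMul s))).imp (fun h => ?_) (fun h => ?_) <;>
  · refine AddMonoidHom.ext fun g => ?_
    rcases hs g.toMul with h' | h'
    · rw [show g = 0 from h', map_zero, map_zero]
    · rw [show g = Additive.ofMul s from h', h]
      first | rfl | exact h1.symm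

/-- The only characters are `0` and `φ`. In degree `φ`, adding `2 [Cl]` leads back to degree zero,
where the class is `0` or `4 [Cl]`. -/
theorem ofRep_mem_zmultiples [Finite G] (hs : ∀ g, g = 1 ∨ g = s)
    (hφs : φ s = Multiplicative.ofAdd 1) (R : ProjRep φ) :
    ofRep R ∈ AddSubgroup.zmultiples (2 • cliffClass φ) := by
  have key : ∀ S : ProjRep φ, S.deg = 0 → ofRep S ∈ AddSubgroup.zmultiples (2 • cliffClass φ) := by
    intro S hS
    rcases ofRep_eq_zero_or hs hφs hS with h | h
    · exact h ▸ zero_mem _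
    · rw [h, show 4 = 2 * 2 from rfl, mul_nsmul]
      exact nsmul_mem (AddSubgroup.mem_zmultiples _) _
  rcases addHom_eq_zero_or hs hφs R.deg with h | h
  · exact key R h
  · have h1 := key (R.tensor (swapRep (addHom φ))) (by
      rw [ProjRep.tensor_deg, h]
      exact AddMonoidHom.ext fun _ => CharTwo.add_self_eq_zero _)
    rw [← ofRep_add, ← two_nsmul_cliffClass] at h1
    exact (add_mem_cancel_right (AddSubgroup.mem_zmultiples _)).1 h1

theorem nonempty_addEquiv_zmod_eight [Finite G] (hφ : Function.Bijective φ) :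
    Nonempty (GrBr φ ≃+ ZMod 8) := by
  obtain ⟨s, hs, hφs⟩ := exists_eq_one_or hφ
  have key : ∀ x ∈ (forget (φ := φ)).ker, x ∈ AddSubgroup.zmultiples (cliffClass φ) := by
    intro x hx
    obtain ⟨R, hR⟩ := exists_eq_ofRep ⟨x, hx⟩
    have h := ofRep_mem_zmultiples hs hφs R
    rw [← hR] at h
    exact AddSubgroup.zmultiples_le_of_mem (nsmul_mem (AddSubgroup.mem_zmultiples _) 2) h
  refine nonempty_addEquiv_zmod (a := cliffClass φ) (n := 8) ?_ fun x => ?_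
  -- The order is exactly `2³`, because `2² [Cl] ≠ 0` and `2³ [Cl] = 0`.
  · exact addOrderOf_eq_prime_pow (p := 2) (n := 2) (four_nsmul_cliffClass_ne_zero hs hφs)
      eight_nsmul_cliffClass
  · rcases GrBrC.eq_zero_or (forget x) with h | h
    · exact key x h
    · have h1 := key (x - cliffClass φ) (by
        rw [AddMonoidHom.mem_ker, map_sub, h, forget_cliffClass, sub_self])
      rw [← sub_add_cancel x (cliffClass φ)]
      exact add_mem h1 (AddSubgroup.mem_zmultiples _)

theorem two_nsmul_cliffClass_mem_ker [Finite G] : 2 • cliffClass φ ∈ (forget (φ := φ)).ker := by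
  rw [two_nsmul_cliffClass]
  exact ofRep_mem_ker _

theorem nonempty_ker_addEquiv_zmod_four [Finite G] (hφ : Function.Bijective φ) :
    Nonempty ((forget (φ := φ)).ker ≃+ ZMod 4) := by
  obtain ⟨s, hs, hφs⟩ := exists_eq_one_or hφ
  refine nonempty_addEquiv_zmod (a := ⟨2 • cliffClass φ, two_nsmul_cliffClass_mem_ker⟩) (n := 4)
    ?_ fun x => ?_
  · refine addOrderOf_eq_prime_pow (p := 2) (n := 1) (fun h => ?_) (Subtype.ext ?_)
    · refine four_nsmul_cliffClass_ne_zero hs hφs (Eq.trans ?_ (congrArg Subtype.val h))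
      exact mul_nsmul _ 2 2
    · exact (mul_nsmul _ 2 4).symm.trans eight_nsmul_cliffClass
  · obtain ⟨R, hR⟩ := exists_eq_ofRep x
    have h := ofRep_mem_zmultiples hs hφs R
    rw [← hR] at h
    obtain ⟨k, hk⟩ := h
    exact ⟨k, Subtype.ext hk⟩

/-- A section would give a class `[R]` of degree `φ` with `2 [R] = 0`. Then `[R] + 2 [Cl]` has
degree zero, so it is `0` or `4 [Cl]` and is killed by two, which forces `4 [Cl] = 0`. -/
theorem not_exists_section_degree [Finite G] (hφ : Function.Bijective φ) :
    ¬ ∃ t : (Additive G →+ ZMod 2) →+ (forget (φ := φ)).ker,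
      degree.comp t = AddMonoidHom.id (Additive G →+ ZMod 2) := by
  obtain ⟨s, hs, hφs⟩ := exists_eq_one_or hφ
  rintro ⟨t, ht⟩
  have h1 : degree (t (addHom φ)) = addHom φ := DFunLike.congr_fun ht _
  have h2 : t (addHom φ) + t (addHom φ) = 0 := by
    rw [← map_add, show addHom φ + addHom φ = 0 from
      AddMonoidHom.ext fun _ => CharTwo.add_self_eq_zero _, map_zero]
  obtain ⟨R, hR⟩ := exists_eq_ofRep (t (addHom φ))
  rw [degree_eq hR] at h1
  have h3 : ofRep R + ofRep R = 0 := by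
    rw [← hR]
    exact congrArg Subtype.val h2
  have h4 := ofRep_eq_zero_or hs hφs (R := R.tensor (swapRep (addHom φ))) (by
      rw [ProjRep.tensor_deg, h1]
      exact AddMonoidHom.ext fun _ => CharTwo.add_self_eq_zero _)
  rw [← ofRep_add, ← two_nsmul_cliffClass] at h4
  have h5 : 2 • (ofRep R + 2 • cliffClass φ) = 0 := by
    rcases h4 with h | h <;> rw [h]
    · exact nsmul_zero 2
    · exact (mul_nsmul _ 4 2).symm.trans eight_nsmul_cliffClass
  rw [nsmul_add, two_nsmul, h3, zero_add] at h5
  exact four_nsmul_cliffClass_ne_zero hs hφs ((mul_nsmul _ 2 2).trans h5)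

end GrBr

end OrderTwo

end MagBrauer

end

open MagBrauer in
theorem mainTheorem2 (G : Type) [Group G] [Finite G]
    (φ : G →* Multiplicative (ZMod 2)) (hφ : Function.Surjective φ) :
    Equivalence CSGA.Similar ∧ Equivalence (MECSGA.Similar (φ := φ)) ∧
    ∃ (_ : AddCommGroup GrBrC) (_ : AddCommGroup (GrBr φ)),
      GrBrC.IsTensorAddition ∧ GrBr.IsTensorAddition φ ∧
      Nonempty (GrBrC ≃+ ZMod 2) ∧
      ∃ forget : GrBr φ →+ GrBrC,
        (∀ A : MECSGA φ, forget (GrBr.mk A) = GrBrC.mk A.forget) ∧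
        Function.Surjective forget ∧
        (¬ ∃ s : GrBrC →+ GrBr φ, forget.comp s = AddMonoidHom.id GrBrC) ∧
        ∃ (ι : H2 φ →+ forget.ker) (ψ : forget.ker →+ (Additive G →+ ZMod 2)),
          (∀ (f : G × G → TwistedUnits φ) (hf : groupCohomology.IsMulCocycle₂ f),
            (∃ A : MECSGA φ, A.1.IsProjectiveEnd f) ∧
            ∀ A : MECSGA φ, A.1.IsProjectiveEnd f →
              (ι (H2.mk f hf) : GrBr φ) = GrBr.mk A) ∧
          (∀ (A : MECSGA φ) (hA : GrBr.mk A ∈ forget.ker),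
            A.1.HasDegreeCharacter (ψ ⟨GrBr.mk A, hA⟩)) ∧
          Function.Injective ι ∧ Function.Exact ι ψ ∧ Function.Surjective ψ ∧
          (Function.Bijective φ →
            Nonempty (GrBr φ ≃+ ZMod 8) ∧ Nonempty (forget.ker ≃+ ZMod 4) ∧
            ¬ ∃ s : (Additive G →+ ZMod 2) →+ forget.ker,
              ψ.comp s = AddMonoidHom.id (Additive G →+ ZMod 2)) := by
  refine ⟨CSGA.similar_equivalence, MECSGA.similar_equivalence φ, GrBrC.addCommGroup, GrBr.addCommGroup,
    GrBrC.isTensorAddition, GrBr.isTensorAddition φ, GrBrC.nonempty_addEquiv, GrBr.forget,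
    GrBr.forget_mk, GrBr.forget_surjective, GrBr.not_exists_section_forget hφ, GrBr.ofH2,
    GrBr.degree, fun f hf => ⟨⟨MECSGA.ofRep (twistedRegular f hf),
      twistedRegular_isProjectiveEnd f hf⟩, GrBr.ofH2_mk_of_isProjectiveEnd f hf⟩,
    GrBr.hasDegreeCharacter_degree, GrBr.ofH2_injective, GrBr.exact_ofH2_degree,
    GrBr.degree_surjective, fun h => ⟨GrBr.nonempty_addEquiv_zmod_eight h,
      GrBr.nonempty_ker_addEquiv_zmod_four h, GrBr.not_exists_section_degree h⟩⟩
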